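/- **Theorem 2.1 (Replacement principle, complex case).** Conventions. A random polynomial $f$ of degree at most $n$ is a random element of the space of complex polynomials of degree at most $n$ (arbitrary joint law of the coefficients). Its zeros are counted with multiplicity, $n-\deg f$ of them being placed at $\infty$ (all $n$ of them if $f\equiv 0$); write $\zeta_1,\dots,\zeta_n$ for the zeros and $N_\Omega(f)$ for the number of zeros in $\Omega\subset\mathbb C$. $B(z,r)$ is the open disk. The $k$-point correlation function $\rho^{(k)}_f$ is the measure on $\mathbb C^k$ with $$\mathbf E\sum_{i_1,\dots,i_k\text{ distinct}}\varphi(\zeta_{i_1},\dots,\zeta_{i_k})=\int_{\mathbb C^k}\varphi(w)\,\rho^{(k)}_f(w)\,dw$$ for all continuous compactly supported $\varphi:\mathbb C^k\to\mathbb C$ (with $\varphi:=0$ when an argument is $\infty$). For $G:\mathbb C^m\to\mathbb C$, $|\nabla^a G(w)|$ is the Euclidean norm of the tensor of all order-$a$ partial derivatives of $G$ in the $2m$ real coordinates. Integrals against $\rho^{(k)}$ below are integrals against this measure, translated by $(z_1,\dots,z_k)$. Let $C, r_0\ge 1\ge c_0>0$ be real and $k,a_0\ge 1$ integers, and set $A:=100\,k\,a_0/c_0$.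 Then there is a constant $\tilde C$ depending only on $C,r_0,c_0,k,a_0$ with the following property. Let $n\ge1$ be an integer, let $f,\tilde f$ be random polynomials of degree at most $n$, and let $z_1,\dots,z_k\in\mathbb C$. Assume: (i) (Non-degeneracy) $f$ is not identically zero with probability at least $1-Cn^{-A}$, and similarly for $\tilde f$. (ii) (Non-clustering) For each $1\le i\le k$ and each $r\ge1$, $N_{B(z_i,r)}(f)\le Cn^{1/A}r^2$ with probability at least $1-Cn^{-A}$, and similarly for $\tilde f$. (iii) (Comparability of log-magnitudes) For every integer $1\le k'\le n^{c_0}$, all $z'_1,\dots,z'_{k'}\in\bigcup_{i=1}^kB(z_i,20r_0)$ and every smooth $F:\mathbb C^{k'}\to\mathbb C$ with $|\nabla^aF(w)|\le n^{c_0}$ for all $0\le a\le a_0$ and $w\in\mathbb C^{k'}$, $$\Big|\mathbf E\,F(\log|f(z'_1)|,\dots,\log|f(z'_{k'})|)-\mathbf E\,F(\log|\tilde f(z'_1)|,\dots,\log|\tilde f(z'_{k'})|)\Big|\le Cn^{-c_0},$$ where $F(\dots)$ is read as $0$ when one or more of its arguments are undefined (that is, when the polynomial vanishes at one of the $z'_i$).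 Let $M>0$ and let $G:\mathbb C^k\to\mathbb C$ be a smooth function supported on $B(0,r_0)^k$ with $|\nabla^aG(w)|\le M$ for all $0\le a\le a_0+2k+1$ and all $w\in\mathbb C^k$. Then $$\Big|\int_{\mathbb C^k}G(w)\,\rho^{(k)}_f(z_1+w_1,\dots,z_k+w_k)\,dw-\int_{\mathbb C^k}G(w)\,\rho^{(k)}_{\tilde f}(z_1+w_1,\dots,z_k+w_k)\,dw\Big|\le\tilde C\,M\,n^{-c_0/4}.$$ -/

import Mathlib

noncomputable section

namespace ReplacementPrinciple

open MeasureTheory Polynomial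

/-! ### Random polynomials and their zeros -/

/-- A random polynomial of degree at most `n`: a polynomial-valued map whose coefficients are
complex random variables. No independence or moment assumption is made, and the value may be the
zero polynomial. -/
structure IsRandomPolynomial {Ω : Type*} [MeasurableSpace Ω] (n : ℕ) (f : Ω → ℂ[X]) : Prop where
  natDegree_le : ∀ ω, (f ω).natDegree ≤ n
  measurable_coeff : ∀ i, Measurable fun ω => (f ω).coeff i

/-- Number of zeros of `p` in `S`, with multiplicity. The zero polynomial has no zeros in `ℂ`
(`Polynomial.roots 0 = 0`), all its zeros being placed at infinity. -/
def zeroCount (p : ℂ[X]) (S : Set ℂ) : ℕ :=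
  open scoped Classical in p.roots.countP (· ∈ S)

/-- The counting measure on `ℂ^k` of the tuples `(ζ_{i_1}, …, ζ_{i_k})` of zeros of `p`, over all
tuples of distinct indices. The index type `p.roots` (a multiset coerced to a type) has exactly as
many elements over each zero as its multiplicity, so only the indices have to be distinct, not the
zeros. -/
def zeroTupleMeasure (k : ℕ) (p : ℂ[X]) : Measure (Fin k → ℂ) :=
  ∑ i : Fin k ↪ p.roots, Measure.dirac (fun j => ((i j : p.roots) : ℂ))

/-- The `k`-point correlation function `ρ^{(k)}_f`, as a measure on `ℂ^k`: the expectation of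
`zeroTupleMeasure k (f ω)`. See `integral_correlationMeasure` for the identity that characterizes
it. -/
def correlationMeasure {Ω : Type*} [MeasurableSpace Ω] (P : Measure Ω) (f : Ω → ℂ[X]) (k : ℕ) :
    Measure (Fin k → ℂ) :=
  P.bind fun ω => zeroTupleMeasure k (f ω)

/-! ### Derivatives of functions on `ℂ^k ≃ ℝ^{2k}` -/

/-- The standard real basis of `ℂ^k`: the directions of `Re w_j` and `Im w_j`. -/
def realBasis {k : ℕ} (e : Fin k × Bool) : Fin k → ℂ :=
  Pi.single e.1 (if e.2 then Complex.I else 1)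

/-- The norm `|∇^a G (w)|`: the Euclidean norm of the tensor of all partial derivatives of order
`a` of `G` with respect to the `2k` real coordinates of `ℂ^k`. -/
def gradNorm {k : ℕ} (a : ℕ) (G : (Fin k → ℂ) → ℂ) (w : Fin k → ℂ) : ℝ :=
  Real.sqrt (∑ e : Fin a → Fin k × Bool,
    ‖iteratedFDeriv ℝ a G w (fun s => realBasis (e s))‖ ^ 2)

/-! ### The three axioms -/

/-- The statistic `F (log |p(z_1)|, …, log |p(z_m)|)`, which is `0` when some `log |p(z_i)|` is
undefined, that is, when some `p(z_i)` is zero. -/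
def logStatistic {m : ℕ} (F : (Fin m → ℂ) → ℂ) (z : Fin m → ℂ) (p : ℂ[X]) : ℂ :=
  open scoped Classical in
  if ∀ i, p.eval (z i) ≠ 0 then F (fun i => ((Real.log ‖p.eval (z i)‖ : ℝ) : ℂ)) else 0

/-- With probability at least `1 - C n^{-A}`, the random polynomial is not identically zero. -/
def NonDegenerate {Ω : Type*} [MeasurableSpace Ω] (P : Measure Ω) (f : Ω → ℂ[X])
    (C A : ℝ) (n : ℕ) : Prop :=
  1 - C * (n : ℝ) ^ (-A) ≤ P.real {ω | f ω ≠ 0}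

/-- For each `i` and each `r ≥ 1`, with probability at least `1 - C n^{-A}`, there are at most
`C n^{1/A} r²` zeros in the open disk `B(z_i, r)`. -/
def NonClustering {Ω : Type*} [MeasurableSpace Ω] (P : Measure Ω) (f : Ω → ℂ[X])
    (C A : ℝ) (n : ℕ) {k : ℕ} (z : Fin k → ℂ) : Prop :=
  ∀ i : Fin k, ∀ r : ℝ, 1 ≤ r →
    1 - C * (n : ℝ) ^ (-A) ≤
      P.real {ω | (zeroCount (f ω) (Metric.ball (z i) r) : ℝ) ≤ C * (n : ℝ) ^ (1 / A) * r ^ 2}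

/-- Comparability of the log-magnitudes of `f` and `g` at up to `n^{c₀}` points of
`⋃ i, B(z_i, 20 r₀)`. -/
def LogComparable {Ω Ω' : Type*} [MeasurableSpace Ω] [MeasurableSpace Ω']
    (P : Measure Ω) (P' : Measure Ω') (f : Ω → ℂ[X]) (g : Ω' → ℂ[X])
    (C r₀ c₀ : ℝ) (a₀ n : ℕ) {k : ℕ} (z : Fin k → ℂ) : Prop :=
  ∀ m : ℕ, 1 ≤ m → (m : ℝ) ≤ (n : ℝ) ^ c₀ →
  ∀ z' : Fin m → ℂ, (∀ i, z' i ∈ ⋃ j, Metric.ball (z j) (20 * r₀)) →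
  ∀ F : (Fin m → ℂ) → ℂ, ContDiff ℝ (⊤ : ℕ∞) F →
    (∀ a ≤ a₀, ∀ w, gradNorm a F w ≤ (n : ℝ) ^ c₀) →
    ‖(∫ ω, logStatistic F z' (f ω) ∂P) - ∫ ω, logStatistic F z' (g ω) ∂P'‖
      ≤ C * (n : ℝ) ^ (-c₀)

/-! ### The correlation measure is well defined

The remaining facts show that `zeroTupleMeasure k (f ω)` depends measurably on `ω`, so that
`correlationMeasure` is the expectation it is meant to be. -/

lemma zeroTupleMeasure_eq_of_roots {k d : ℕ} {p : ℂ[X]} (ζ : Fin d → ℂ)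
    (h : p.roots = Finset.univ.val.map ζ) :
    zeroTupleMeasure k p = ∑ i : Fin k ↪ Fin d, Measure.dirac (fun j => ζ (i j)) := by
  have hnd : (Finset.univ : Finset (Fin d)).val.Nodup := Finset.univ.nodup
  let u : Multiset (Fin d) := Finset.univ.val
  let e₁ : u ≃ Fin d := Equiv.ofBijective (fun x => (x : Fin d)) <| by
    rw [Fintype.bijective_iff_surjective_and_card]
    refine ⟨fun x => ⟨⟨x, ⟨0, ?_⟩⟩, rfl⟩, by simp [u]⟩
    exact Multiset.count_pos.2 (Finset.mem_univ x)
  let e₂ : p.roots ≃ Fin d :=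
    ((Multiset.cast h).trans (Multiset.mapEquiv u ζ).symm).trans e₁
  have he₂ : ∀ x : p.roots, ζ (e₂ x) = (x : ℂ) := by
    intro x
    have := Multiset.mapEquiv_apply u ζ ((Multiset.mapEquiv u ζ).symm (Multiset.cast h x))
    rw [Equiv.apply_symm_apply] at this
    exact this.symm
  unfold zeroTupleMeasure
  refine Fintype.sum_equiv (Equiv.embeddingCongr (Equiv.refl _) e₂) _ _ fun i => ?_
  congr 1
  funext j
  simp [he₂]

lemma zeroTupleMeasure_apply_le {k : ℕ} (p : ℂ[X]) (s : Set (Fin k → ℂ)) :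
    zeroTupleMeasure k p s ≤ Fintype.card (Fin k ↪ p.roots) := by
  unfold zeroTupleMeasure
  rw [Measure.finsetSum_apply]
  refine (Finset.sum_le_sum fun i _ => prob_le_one).trans ?_
  simp

instance {k : ℕ} (p : ℂ[X]) : IsFiniteMeasure (zeroTupleMeasure k p) :=
  ⟨(zeroTupleMeasure_apply_le p _).trans_lt (by simp)⟩

/-- The number of tuples of distinct indices whose tuple of zeros lies in `s`. -/
def tupleCount {k d : ℕ} (s : Set (Fin k → ℂ)) (ζ : Fin d → ℂ) : ℕ :=
  open scoped Classical in
  (Finset.univ.filter fun i : Fin k ↪ Fin d => (fun j => ζ (i j)) ∈ s).card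

lemma zeroTupleMeasure_apply_of_roots {k d : ℕ} {p : ℂ[X]} (ζ : Fin d → ℂ)
    (h : p.roots = Finset.univ.val.map ζ) {s : Set (Fin k → ℂ)} (hs : MeasurableSet s) :
    zeroTupleMeasure k p s = tupleCount s ζ := by
  classical
  rw [zeroTupleMeasure_eq_of_roots ζ h, Measure.finsetSum_apply]
  simp only [Measure.dirac_apply' _ hs, tupleCount, Set.indicator_apply, Pi.one_apply]
  rw [Finset.sum_boole]

lemma isClosed_le_tupleCount {k d : ℕ} {s : Set (Fin k → ℂ)} (hs : IsClosed s) (m : ℕ) :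
    IsClosed {ζ : Fin d → ℂ | m ≤ tupleCount s ζ} := by
  classical
  have : {ζ : Fin d → ℂ | m ≤ tupleCount s ζ} =
      ⋃ T ∈ {T : Finset (Fin k ↪ Fin d) | m ≤ T.card},
        ⋂ i ∈ T, (fun ζ : Fin d → ℂ => fun j => ζ (i j)) ⁻¹' s := by
    ext ζ
    simp only [Set.mem_ofPred_eq, Set.mem_iUnion, Set.mem_iInter, Set.mem_preimage, exists_prop,
      tupleCount]
    constructor
    · intro h
      refine ⟨_, h, fun i hi => ?_⟩
      simpa using hi
    · rintro ⟨T, hT, h⟩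
      refine hT.trans (Finset.card_le_card fun i hi => ?_)
      simpa using h i hi
  rw [this]
  refine Set.Finite.isClosed_biUnion (Set.toFinite _) fun T _ => ?_
  refine isClosed_biInter fun i _ => hs.preimage ?_
  fun_prop

/-- Coefficients of `c ∏ (X - ζ_i)`. -/
def coeffMap (n d : ℕ) (x : ℂ × (Fin d → ℂ)) : Fin (n + 1) → ℂ :=
  fun i => (Polynomial.C x.1 * ∏ j, (X - Polynomial.C (x.2 j))).coeff i

lemma continuous_coeff_prod (d i : ℕ) :
    Continuous fun ζ : Fin d → ℂ => (∏ j, (X - Polynomial.C (ζ j))).coeff i := by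
  induction d generalizing i with
  | zero => simpa using continuous_const
  | succ d ih =>
    simp only [Fin.prod_univ_succ, sub_mul, coeff_sub, coeff_C_mul]
    have h (l : ℕ) : Continuous fun ζ : Fin (d + 1) → ℂ =>
        (∏ j : Fin d, (X - Polynomial.C (ζ j.succ))).coeff l := by
      have hshift : Continuous fun ζ : Fin (d + 1) → ℂ => fun j : Fin d => ζ j.succ := by fun_prop
      exact (ih l).comp hshift
    refine Continuous.sub ?_ ((continuous_apply 0).mul (h i))
    cases i with
    | zero => simpa using continuous_const
    | succ i => simpa [coeff_X_mul] using h i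

lemma continuous_coeffMap (n d : ℕ) : Continuous (coeffMap n d) := by
  refine continuous_pi fun i => ?_
  simp only [coeffMap, coeff_C_mul]
  exact continuous_fst.mul ((continuous_coeff_prod d i).comp continuous_snd)

lemma measurableSet_image_coeffMap (n d : ℕ) {K : Set (Fin d → ℂ)} (hK : IsClosed K) :
    MeasurableSet (coeffMap n d '' ({c | c ≠ 0} ×ˢ K)) := by
  have hset : ({c : ℂ | c ≠ 0} ×ˢ K : Set (ℂ × (Fin d → ℂ))) =
      ⋃ l : ℕ, {c : ℂ | 1 / ((l : ℝ) + 1) ≤ ‖c‖} ×ˢ K := by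
    ext ⟨c, ζ⟩
    simp only [Set.mem_prod, Set.mem_ofPred_eq, Set.mem_iUnion]
    constructor
    · rintro ⟨hc, h⟩
      obtain ⟨l, hl⟩ := exists_nat_one_div_lt (norm_pos_iff.2 hc)
      exact ⟨l, hl.le, h⟩
    · rintro ⟨l, hl, h⟩
      refine ⟨norm_pos_iff.1 (lt_of_lt_of_le (by positivity) hl), h⟩
  rw [hset, Set.image_iUnion]
  refine MeasurableSet.iUnion fun l => ?_
  have hcl : IsClosed ({c : ℂ | 1 / ((l : ℝ) + 1) ≤ ‖c‖} ×ˢ K) :=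
    (isClosed_le continuous_const continuous_norm).prod hK
  obtain ⟨B, hB, hBU⟩ := (isSigmaCompact_univ.of_isClosed_subset hcl (Set.subset_univ _)).image (continuous_coeffMap n d)
  rw [← hBU]
  exact MeasurableSet.iUnion fun m => (hB m).measurableSet

lemma roots_C_mul_prod {d : ℕ} {c : ℂ} (hc : c ≠ 0) (ζ : Fin d → ℂ) :
    (Polynomial.C c * ∏ j, (X - Polynomial.C (ζ j))).roots = Finset.univ.val.map ζ := by
  rw [roots_C_mul _ hc]
  have : ∏ j, (X - Polynomial.C (ζ j)) =
      ((Finset.univ.val.map ζ).map fun a => X - Polynomial.C a).prod := by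
    rw [Multiset.map_map]; rfl
  rw [this, roots_multiset_prod_X_sub_C]

lemma exists_eq_C_mul_prod {p : ℂ[X]} (hp : p ≠ 0) :
    ∃ d ≤ p.natDegree, ∃ c : ℂ, c ≠ 0 ∧ ∃ ζ : Fin d → ℂ,
      p = Polynomial.C c * ∏ j, (X - Polynomial.C (ζ j)) := by
  have hs : p.Splits := IsAlgClosed.splits p
  refine ⟨p.roots.toList.length, ?_, p.leadingCoeff, leadingCoeff_ne_zero.2 hp,
    fun j => p.roots.toList[j.1], ?_⟩
  · rw [Multiset.length_toList]
    exact card_roots' p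
  · conv_lhs => rw [hs.eq_prod_roots]
    congr 1
    rw [Fin.prod_univ_fun_getElem p.roots.toList (fun a => X - Polynomial.C a),
      ← Multiset.prod_coe, ← Multiset.map_coe, Multiset.coe_toList]

theorem measurable_zeroTupleMeasure {Ω : Type*} [MeasurableSpace Ω] {n : ℕ} {f : Ω → ℂ[X]}
    (hf : IsRandomPolynomial n f) (k : ℕ) : Measurable fun w => zeroTupleMeasure k (f w) := by
  have hcoeff : Measurable fun w => fun i : Fin (n + 1) => (f w).coeff i :=
    measurable_pi_lambda _ fun i => hf.measurable_coeff i
  have key : ∀ s : Set (Fin k → ℂ), IsClosed s →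
      Measurable fun w => zeroTupleMeasure k (f w) s := by
    intro s hs
    have hnat : ∀ w, ∃ m : ℕ, zeroTupleMeasure k (f w) s = m := by
      intro w
      by_cases h0 : f w = 0
      · exact ⟨_, zeroTupleMeasure_apply_of_roots (d := 0) Fin.elim0 (by simp [h0])
          hs.measurableSet⟩
      · obtain ⟨d, -, c, hc, ζ, hζ⟩ := exists_eq_C_mul_prod h0
        exact ⟨_, zeroTupleMeasure_apply_of_roots ζ (by rw [hζ, roots_C_mul_prod hc])
          hs.measurableSet⟩
    choose N hN using hnat
    have hzero : MeasurableSet {w | f w = 0} := by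
      have : {w | f w = 0} = (fun w => fun i : Fin (n + 1) => (f w).coeff i) ⁻¹' {0} := by
        ext w
        simp only [Set.mem_ofPred_eq, Set.mem_preimage, Set.mem_singleton_iff]
        refine ⟨fun h => by ext; simp [h], fun h => ?_⟩
        ext i
        by_cases hi : i < n + 1
        · simpa using congrFun h ⟨i, hi⟩
        · rw [coeff_zero]
          exact coeff_eq_zero_of_natDegree_lt (by have := hf.natDegree_le w; omega)
      rw [this]
      exact hcoeff (measurableSet_singleton 0)
    have hNm : Measurable N := by
      refine measurable_of_Ici fun m => ?_
      have : N ⁻¹' Set.Ici m = ({w | f w = 0} ∩ {_w | m ≤ tupleCount s (Fin.elim0 : Fin 0 → ℂ)}) ∪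
          (⋃ d ∈ Set.Iic n, (fun w => fun i : Fin (n + 1) => (f w).coeff i) ⁻¹'
            (coeffMap n d '' ({c | c ≠ 0} ×ˢ {ζ | m ≤ tupleCount s ζ}))) := by
        ext w
        simp only [Set.mem_preimage, Set.mem_Ici, Set.mem_union, Set.mem_inter_iff,
          Set.mem_ofPred_eq, Set.mem_iUnion, Set.mem_Iic, Set.mem_image, Set.mem_prod, exists_prop]
        constructor
        · intro hm
          by_cases h0 : f w = 0
          · left
            refine ⟨h0, ?_⟩
            have := hN w
            rw [zeroTupleMeasure_apply_of_roots (d := 0) Fin.elim0 (by simp [h0])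
              hs.measurableSet, Nat.cast_inj] at this
            rwa [this]
          · right
            obtain ⟨d, hd, c, hc, ζ, hζ⟩ := exists_eq_C_mul_prod h0
            refine ⟨d, hd.trans (hf.natDegree_le w), (c, ζ), ⟨hc, ?_⟩, ?_⟩
            · have := hN w
              rw [zeroTupleMeasure_apply_of_roots ζ (by rw [hζ, roots_C_mul_prod hc])
                hs.measurableSet, Nat.cast_inj] at this
              rwa [this]
            · funext i
              exact congrArg (fun p : ℂ[X] => p.coeff i) hζ.symm
        · rintro (⟨h0, hm⟩ | ⟨d, hd, ⟨c, ζ⟩, ⟨hc, hm⟩, h⟩)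
          · have := hN w
            rw [zeroTupleMeasure_apply_of_roots (d := 0) Fin.elim0 (by simp [h0])
              hs.measurableSet, Nat.cast_inj] at this
            rwa [← this]
          · have hfw : f w = Polynomial.C c * ∏ j, (X - Polynomial.C (ζ j)) := by
              ext i
              by_cases hi : i < n + 1
              · exact (congrFun h ⟨i, hi⟩).symm
              · rw [coeff_eq_zero_of_natDegree_lt (by have := hf.natDegree_le w; omega),
                  coeff_eq_zero_of_natDegree_lt]
                refine (natDegree_C_mul_le _ _).trans_lt ?_
                rw [natDegree_finsetProd_X_sub_C_eq_card]
                simp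
                omega
            have := hN w
            rw [zeroTupleMeasure_apply_of_roots ζ (by rw [hfw, roots_C_mul_prod hc])
              hs.measurableSet, Nat.cast_inj] at this
            rwa [← this]
      rw [this]
      refine (hzero.inter (.const _)).union ?_
      refine MeasurableSet.biUnion (Set.to_countable _) fun d _ => hcoeff ?_
      exact measurableSet_image_coeffMap n d (isClosed_le_tupleCount hs m)
    simp only [hN]
    exact (measurable_of_countable fun m : ℕ => (m : ENNReal)).comp hNm
  refine Measurable.measure_of_isPiSystem
    (BorelSpace.measurable_eq.trans borel_eq_generateFrom_isClosed) isPiSystem_isClosed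
    key (key _ isClosed_univ)

/-- The defining property of the correlation function: for every continuous compactly supported
`φ` on `ℂ^k`, the expected sum of `φ(ζ_{i_1}, …, ζ_{i_k})` over distinct indices is the integral
of `φ` against `ρ^{(k)}`. -/
theorem integral_correlationMeasure {Ω : Type*} [MeasurableSpace Ω] (P : Measure Ω)
    [IsProbabilityMeasure P] {n : ℕ} {f : Ω → ℂ[X]} (hf : IsRandomPolynomial n f) (k : ℕ)
    (φ : (Fin k → ℂ) → ℂ) (hφ : Continuous φ) (hφ' : HasCompactSupport φ) :
    ∫ u, φ u ∂(correlationMeasure P f k) =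
      ∫ w, ∑ i : Fin k ↪ (f w).roots, φ (fun j => ((i j : (f w).roots) : ℂ)) ∂P := by
  let κ : ProbabilityTheory.Kernel Ω (Fin k → ℂ) :=
    ⟨fun w => zeroTupleMeasure k (f w), measurable_zeroTupleMeasure hf k⟩
  have hfin : IsFiniteMeasure (P.bind κ) := by
    refine ⟨?_⟩
    rw [Measure.bind_apply .univ κ.aemeasurable]
    have hb : ∀ w, κ w Set.univ ≤ ((n ^ k : ℕ) : ENNReal) := by
      intro w
      refine (zeroTupleMeasure_apply_le (f w) _).trans ?_
      rw [Fintype.card_embedding_eq, Fintype.card_fin, Multiset.card_coe]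
      exact_mod_cast (Nat.descFactorial_le_pow _ _).trans
        (Nat.pow_le_pow_left ((card_roots' _).trans (hf.natDegree_le w)) k)
    refine (lintegral_mono hb).trans_lt ?_
    simp [ENNReal.pow_lt_top_iff]
  have hint : Integrable φ (P.bind κ) := hφ.integrable_of_hasCompactSupport hφ'
  have h : ∫ u, φ u ∂(P.bind κ) = ∫ w, ∫ u, φ u ∂(κ w) ∂P := by
    rw [Measure.comp_eq_comp_const_apply] at hint ⊢
    rw [ProbabilityTheory.Kernel.integral_comp hint]
    simp
  refine h.trans (integral_congr_ae (.of_forall fun w => ?_))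
  show ∫ u, φ u ∂(zeroTupleMeasure k (f w)) = _
  unfold zeroTupleMeasure
  rw [integral_finsetSum_measure]
  · simp
  · intro i _
    exact integrable_dirac (by simp)

end ReplacementPrinciple

end

open MeasureTheory Polynomial ReplacementPrinciple

/-!
The function `log |p|` determines the zeros of `p`: its distributional Laplacian is
`2π ∑ δ_ζ`. Applying this in each of `l` complex variables to a smooth `G` supported in a polydisk,
the sum of `G` over all `l`-tuples of zeros, repetitions included (`fullSum`), is an integral of
`∏ log |p(c_j + w_j)|` against the product of the `l` planar Laplacians of `G` (`multiLap`). Sums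
over tuples of distinct zeros reduce to such sums by inclusion-exclusion over coincidences
(`sum_embedding_roots_eq`), which restricts `G` to diagonals.

The hypotheses give no control on the size of `log |p|`, only on the number of zeros in disks. So
`log |p|` is replaced by its `residual`, the difference between its value at `w` and the affine
interpolation of its values at `y`, `y + 1`, `y + i`. The subtracted affine function of `w` does not
change the integral against a Laplacian (`IsLogPotential.integral_residual_mul_planeLap`), and it
removes the leading coefficient of `p`. A zero at distance `ρ` contributes only `O(ρ⁻²)`, so a sum
over dyadic annuli bounds the effect of the distant zeros by the non-clustering hypothesis, and
the nearby zeros have logarithms with bounded moments. Hence all moments of the residual are of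
size `D = n^{O(1/A)}` (`exists_moment_le`).

The integral is then estimated by the mean over `m ≈ n^{c₀}` random samples of the residuals,
smoothly truncated at a height slightly above `D` (`estimator`). The moments control the bias caused
by truncation, and the variance gives a fluctuation of order `m^{-1/2}`
(`integral_norm_estimator_sub_le`). For fixed samples the estimator is a smooth function of the
`4lm` logarithms observed. Its derivatives are bounded independently of `m`, since it is a mean of
functions of `4l` logarithms each (`exists_gradNorm_estimatorFun_le`), so the comparability
hypothesis applies to it. Since the estimate holds in mean over the samples for both `f` and `g`,
some choice of the samples works for both at once
(`exists_norm_integral_fullSum_sub_le_of_parameters`). The exceptional polynomials, which vanish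
identically or have too many zeros in some disk, have probability `O(n^{-A} log n)`, which beats the
trivial bound `n^l` for the sum over tuples.
-/


noncomputable section

namespace ReplacementPrinciple

open MeasureTheory Polynomial

/-! ### Directional derivatives and the planar Laplacian -/

/-- The derivative of `G` in the real direction `v`. -/
def dirDeriv {E : Type*} [NormedAddCommGroup E] [NormedSpace ℝ E] (v : E) (G : E → ℂ) : E → ℂ :=
  fun w => fderiv ℝ G w v

/-- The Laplacian on `ℂ ≃ ℝ²`. -/
def planeLap (φ : ℂ → ℂ) (w : ℂ) : ℂ :=
  ∑ b : Bool, dirDeriv (if b then Complex.I else 1) (dirDeriv (if b then Complex.I else 1) φ) w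

section
variable {E : Type*} [NormedAddCommGroup E] [NormedSpace ℝ E]

lemma contDiff_dirDeriv {G : E → ℂ} (hG : ContDiff ℝ (⊤ : ℕ∞) G) (v : E) :
    ContDiff ℝ (⊤ : ℕ∞) (dirDeriv v G) :=
  (hG.fderiv_right (m := (⊤ : ℕ∞)) (by simp)).clm_apply contDiff_const

lemma tsupport_dirDeriv_subset (G : E → ℂ) (v : E) : tsupport (dirDeriv v G) ⊆ tsupport G :=
  tsupport_fderiv_apply_subset ℝ v

lemma hasCompactSupport_dirDeriv {G : E → ℂ} (hG : HasCompactSupport G) (v : E) :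
    HasCompactSupport (dirDeriv v G) :=
  hG.of_isClosed_subset (isClosed_tsupport _) (tsupport_dirDeriv_subset G v)
end

lemma contDiff_planeLap {φ : ℂ → ℂ} (hφ : ContDiff ℝ (⊤ : ℕ∞) φ) :
    ContDiff ℝ (⊤ : ℕ∞) (planeLap φ) :=
  ContDiff.sum fun _ _ => contDiff_dirDeriv (contDiff_dirDeriv hφ _) _

lemma planeLap_eq_zero {φ : ℂ → ℂ} {w : ℂ} (hw : w ∉ tsupport φ) : planeLap φ w = 0 :=
  Finset.sum_eq_zero fun _ _ => image_eq_zero_of_notMem_tsupport fun h =>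
    hw (tsupport_dirDeriv_subset _ _ (tsupport_dirDeriv_subset _ _ h))

lemma hasCompactSupport_planeLap {φ : ℂ → ℂ} (hφ : HasCompactSupport φ) :
    HasCompactSupport (planeLap φ) :=
  HasCompactSupport.intro hφ fun _ hw => planeLap_eq_zero hw

/-! ### The logarithm is locally integrable -/

lemma locallyIntegrable_inv_norm_sub (ζ : ℂ) : LocallyIntegrable fun w : ℂ => ‖w - ζ‖⁻¹ := by
  have h0 : LocallyIntegrable fun w : ℂ => ‖w‖⁻¹ := by
    rw [locallyIntegrable_iff]
    intro K hK
    obtain ⟨R, hR⟩ := hK.isBounded.subset_ball (0 : ℂ)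
    refine IntegrableOn.mono_set ?_ hR
    rw [integrableOn_fun_norm_addHaar volume (f := fun r : ℝ => r⁻¹)]
    have : IntegrableOn (fun _ : ℝ => (1 : ℝ)) (Set.Ioo 0 R) := by simp
    refine this.congr_fun (fun r hr => ?_) measurableSet_Ioo
    simp [hr.1.ne']
  rw [locallyIntegrable_iff] at h0 ⊢
  intro K hK
  have hmp := measurePreserving_sub_right (volume : Measure ℂ) ζ
  have := (hmp.integrableOn_comp_preimage (MeasurableEquiv.subRight ζ).measurableEmbedding
    (f := fun w : ℂ => ‖w‖⁻¹) (s := (fun w => w - ζ) '' K)).2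
    (h0 _ (hK.image (by fun_prop)))
  exact this.mono_set (Set.subset_preimage_image _ _)

lemma abs_log_le_add_inv {t : ℝ} (ht : 0 ≤ t) : |Real.log t| ≤ t + t⁻¹ := by
  rcases ht.eq_or_lt with rfl | ht
  · simp
  · have h1 := Real.log_le_sub_one_of_pos ht
    have h2 := Real.one_sub_inv_le_log_of_pos ht
    have h3 := inv_pos.2 ht
    rw [abs_le]; constructor <;> linarith

lemma locallyIntegrable_log_norm_sub (ζ : ℂ) :
    LocallyIntegrable fun w : ℂ => Real.log ‖w - ζ‖ := by
  have h : LocallyIntegrable fun w : ℂ => ‖w - ζ‖ + ‖w - ζ‖⁻¹ :=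
    (Continuous.locallyIntegrable (by fun_prop)).add (locallyIntegrable_inv_norm_sub ζ)
  refine h.mono (Measurable.aestronglyMeasurable (by fun_prop)) (.of_forall fun w => ?_)
  rw [Real.norm_eq_abs, Real.norm_of_nonneg (by positivity)]
  exact abs_log_le_add_inv (norm_nonneg _)

/-! ### Green's formula for one zero -/

/-- Integration by parts in the direction `v`. -/
lemma integral_ofReal_mul_dirDeriv {u : ℂ → ℝ} {ψ : ℂ → ℂ} (hu : ContDiff ℝ (⊤ : ℕ∞) u)
    (hψ : ContDiff ℝ (⊤ : ℕ∞) ψ) (hψc : HasCompactSupport ψ) (v : ℂ) :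
    ∫ w, (u w : ℂ) * dirDeriv v ψ w = - ∫ w, ((fderiv ℝ u w v : ℝ) : ℂ) * ψ w := by
  have hfd : Continuous fun w => fderiv ℝ u w v :=
    ((hu.fderiv_right (m := (⊤ : ℕ∞)) (by simp)).clm_apply contDiff_const).continuous
  have hu' : ∀ w, fderiv ℝ (fun w => (u w : ℂ)) w v = ((fderiv ℝ u w v : ℝ) : ℂ) := by
    intro w
    have := (Complex.ofRealCLM.hasFDerivAt.comp w
      (hu.differentiable (by simp) w).hasFDerivAt).fderiv
    have h2 := congrArg (fun L : ℂ →L[ℝ] ℂ => L v) this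
    simpa [Function.comp_def] using h2
  have huc : Continuous fun w => (u w : ℂ) := Complex.continuous_ofReal.comp hu.continuous
  have hdc : Differentiable ℝ fun w => (u w : ℂ) :=
    (Complex.ofRealCLM.contDiff.comp hu).differentiable (by simp)
  have := integral_mul_fderiv_eq_neg_fderiv_mul_of_integrable (μ := (volume : Measure ℂ))
    (f := fun w => (u w : ℂ)) (g := ψ) (v := v) ?_ ?_ ?_ (fun w _ => hdc w)
    (fun w _ => hψ.differentiable (by simp) w)
  · simp only [hu'] at this
    exact this
  · simp only [hu']
    exact ((Complex.continuous_ofReal.comp hfd).mul hψ.continuous).integrable_of_hasCompactSupport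
      hψc.mul_left
  · exact (huc.mul (contDiff_dirDeriv hψ v).continuous).integrable_of_hasCompactSupport
      (hasCompactSupport_dirDeriv hψc v).mul_left
  · exact (huc.mul hψ.continuous).integrable_of_hasCompactSupport hψc.mul_left

/-- `½ log (|w|² + ε²)`, a smooth approximation of `log |w|`. -/
def regLog (ε : ℝ) (w : ℂ) : ℝ := Real.log (w.re ^ 2 + w.im ^ 2 + ε ^ 2) / 2

lemma contDiff_re : ContDiff ℝ (⊤ : ℕ∞) fun w : ℂ => w.re := Complex.reCLM.contDiff
lemma contDiff_im : ContDiff ℝ (⊤ : ℕ∞) fun w : ℂ => w.im := Complex.imCLM.contDiff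

lemma contDiff_regLog {ε : ℝ} (hε : 0 < ε) : ContDiff ℝ (⊤ : ℕ∞) (regLog ε) := by
  refine ContDiff.div_const (ContDiff.log ?_ fun w => by positivity) 2
  exact ((contDiff_re.pow 2).add (contDiff_im.pow 2)).add contDiff_const

lemma fderiv_regLog {ε : ℝ} (hε : 0 < ε) (w v : ℂ) :
    fderiv ℝ (regLog ε) w v = (w.re * v.re + w.im * v.im) / (w.re ^ 2 + w.im ^ 2 + ε ^ 2) := by
  have hre : HasFDerivAt (fun w : ℂ => w.re) Complex.reCLM w := Complex.reCLM.hasFDerivAt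
  have him : HasFDerivAt (fun w : ℂ => w.im) Complex.imCLM w := Complex.imCLM.hasFDerivAt
  have hpos : w.re ^ 2 + w.im ^ 2 + ε ^ 2 ≠ 0 := by positivity
  have h0 : HasFDerivAt (fun w : ℂ => w.re ^ 2 + w.im ^ 2 + ε ^ 2) _ w :=
    ((hre.pow 2).add (him.pow 2)).add_const (ε ^ 2)
  have h' : HasFDerivAt (regLog ε) _ w := (h0.log hpos).mul_const (2⁻¹ : ℝ)
  rw [h'.fderiv]
  simp
  field_simp

lemma norm_sq_eq (w : ℂ) : w.re ^ 2 + w.im ^ 2 = ‖w‖ ^ 2 := by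
  rw [← Complex.normSq_eq_norm_sq, Complex.normSq_apply]; ring

lemma tendsto_regLog {w : ℂ} (hw : w ≠ 0) :
    Filter.Tendsto (fun ε => regLog ε w) (nhdsWithin 0 (Set.Ioi 0)) (nhds (Real.log ‖w‖)) := by
  have h : ContinuousAt (fun ε => regLog ε w) 0 := by
    refine ContinuousAt.div_const (ContinuousAt.log (by fun_prop) ?_) 2
    rw [norm_sq_eq]; simp [hw]
  have h2 := h.tendsto
  have : regLog 0 w = Real.log ‖w‖ := by
    simp [regLog, norm_sq_eq]
  rw [this] at h2
  exact h2.mono_left nhdsWithin_le_nhds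

lemma abs_regLog_le {ε : ℝ} (hε : 0 < ε) (hε1 : ε ≤ 1) {w : ℂ} (hw : w ≠ 0) :
    |regLog ε w| ≤ ‖w‖ ^ 2 + 1 + ‖w‖⁻¹ := by
  have hw' := norm_pos_iff.2 hw
  rw [regLog, norm_sq_eq, abs_le]
  have h1 := Real.log_le_sub_one_of_pos (show 0 < ‖w‖ ^ 2 + ε ^ 2 by positivity)
  have h2 : Real.log (‖w‖ ^ 2) ≤ Real.log (‖w‖ ^ 2 + ε ^ 2) :=
    Real.log_le_log (by positivity) (by nlinarith)
  rw [Real.log_pow] at h2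
  have h3 := Real.one_sub_inv_le_log_of_pos hw'
  have h4 := inv_pos.2 hw'
  push_cast at h2
  constructor <;> nlinarith

/-- In polar coordinates the integrand is the radial derivative of `φ`, whose integral along each
ray from the origin is `-φ 0`. -/
lemma integral_radial {φ : ℂ → ℂ} (hφ : ContDiff ℝ (⊤ : ℕ∞) φ) (hφc : HasCompactSupport φ) :
    ∫ w : ℂ, ((‖w‖ ^ 2)⁻¹ : ℝ) • (fderiv ℝ φ w w) = - (2 * Real.pi * φ 0) := by
  let e : ℝ → ℂ := fun θ => Real.cos θ + Real.sin θ * Complex.I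
  have he : ∀ θ, ‖e θ‖ = 1 := fun θ => by
    simp only [e, Complex.ofReal_cos, Complex.ofReal_sin, ← Complex.exp_mul_I]
    exact Complex.norm_exp_ofReal_mul_I θ
  have hec : Continuous e := by fun_prop
  let D : ℝ × ℝ → ℂ := fun p => fderiv ℝ φ (p.1 * e p.2) (e p.2)
  have hfc : Continuous (fderiv ℝ φ) := hφ.continuous_fderiv (by simp)
  have hD : Continuous D := by
    have : Continuous fun p : ℝ × ℝ => ((p.1 : ℂ) * e p.2) := by fun_prop
    exact (hfc.comp this).clm_apply (hec.comp continuous_snd)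
  obtain ⟨R, hR0, hR⟩ : ∃ R : ℝ, 0 ≤ R ∧ ∀ w : ℂ, R < ‖w‖ → w ∉ tsupport φ := by
    obtain ⟨R, hR⟩ := hφc.isCompact.isBounded.subset_closedBall (0 : ℂ)
    refine ⟨max R 0, le_max_right _ _, fun w hw hw' => ?_⟩
    have := hR hw'
    simp at this
    exact absurd (lt_of_le_of_lt (le_max_left _ _) hw) (not_lt.2 this)
  have hDint : IntegrableOn D (Set.Ioi 0 ×ˢ Set.Ioo (-Real.pi) Real.pi) (volume.prod volume) := by
    have h1 : IntegrableOn D (Set.Icc 0 R ×ˢ Set.Icc (-Real.pi) Real.pi) (volume.prod volume) :=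
      hD.continuousOn.integrableOn_compact (isCompact_Icc.prod isCompact_Icc)
    refine h1.of_forall_sdiff_eq_zero (measurableSet_Ioi.prod measurableSet_Ioo) ?_
    rintro ⟨r, θ⟩ ⟨⟨hr, hθ⟩, h⟩
    have hr' : R < r := by
      by_contra hh
      exact h ⟨⟨le_of_lt hr, not_lt.1 hh⟩, ⟨hθ.1.le, hθ.2.le⟩⟩
    have hz : fderiv ℝ φ (r * e θ) = 0 := by
      refine image_eq_zero_of_notMem_tsupport fun h' => hR (r * e θ) ?_ (tsupport_fderiv_subset ℝ h')
      rw [norm_mul, he, mul_one, Complex.norm_real, Real.norm_eq_abs, abs_of_pos hr]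
      exact hr'
    simp [D, hz]
  rw [← Complex.integral_comp_polarCoord_symm, polarCoord_target]
  have h2 : ∀ p ∈ Set.Ioi (0:ℝ) ×ˢ Set.Ioo (-Real.pi) Real.pi,
      p.1 • ((‖Complex.polarCoord.symm p‖ ^ 2)⁻¹ : ℝ) •
        (fderiv ℝ φ (Complex.polarCoord.symm p) (Complex.polarCoord.symm p)) = D p := by
    rintro ⟨r, θ⟩ ⟨hr, -⟩
    have hr : 0 < r := hr
    have hp : Complex.polarCoord.symm (r, θ) = r * e θ := by simp [e]
    have hs : (r * e θ : ℂ) = r • e θ := by simp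
    rw [Complex.norm_polarCoord_symm, hp]
    simp only [D]
    nth_rewrite 2 [hs]
    rw [map_smul, smul_smul, smul_smul]
    have : r * (|r| ^ 2)⁻¹ * r = 1 := by rw [sq_abs]; field_simp
    rw [this, one_smul]
  rw [setIntegral_congr_fun (measurableSet_Ioi.prod measurableSet_Ioo) h2]
  have hray : ∀ θ, ∫ r in Set.Ioi (0 : ℝ), D (r, θ) = - φ 0 := by
    intro θ
    let g : ℝ → ℂ := fun r => φ (r * e θ)
    have hlin : ∀ r : ℝ, HasDerivAt (fun r : ℝ => (r * e θ : ℂ)) (e θ) r := fun r => by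
      simpa using (Complex.ofRealCLM.hasDerivAt (x := r)).mul_const (e θ)
    have hgd : ∀ r, HasDerivAt g (D (r, θ)) r := fun r =>
      (hφ.differentiable (by simp) (r * e θ)).hasFDerivAt.comp_hasDerivAt r (hlin r)
    have hg : ContDiff ℝ 1 g := by
      refine (hφ.of_le (by simp)).comp ?_
      exact Complex.ofRealCLM.contDiff.mul contDiff_const
    have hgc : HasCompactSupport g := by
      refine HasCompactSupport.intro (K := Set.Icc (-R) R) isCompact_Icc fun r hr => ?_
      refine image_eq_zero_of_notMem_tsupport (f := φ) (hR _ ?_)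
      rw [norm_mul, he, mul_one, Complex.norm_real, Real.norm_eq_abs]
      by_contra hh
      exact hr (abs_le.1 (not_lt.1 hh))
    have := hgc.integral_Ioi_deriv_eq hg 0
    simpa [(hgd _).deriv, g] using this
  rw [Measure.volume_eq_prod, ← Measure.prod_restrict, integral_prod_symm]
  · simp only [hray]
    rw [setIntegral_const]
    have : volume.real (Set.Ioo (-Real.pi) Real.pi) = 2 * Real.pi := by
      rw [Real.volume_real_Ioo_of_le (by linarith [Real.pi_pos])]; ring
    rw [this]; simp
  · rwa [Measure.prod_restrict]

/-- The case of a pole at the origin: replace `log |w|` by `regLog ε`, integrate by parts once, and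
let `ε → 0` on both sides. -/
lemma integral_log_norm_mul_planeLap_zero {φ : ℂ → ℂ} (hφ : ContDiff ℝ (⊤ : ℕ∞) φ)
    (hφc : HasCompactSupport φ) :
    ∫ w, (Real.log ‖w‖ : ℂ) * planeLap φ w = 2 * Real.pi * φ 0 := by
  have hreg : ∀ ε : ℝ, 0 < ε → ∫ w, (regLog ε w : ℂ) * planeLap φ w =
      - ∫ w, ((‖w‖ ^ 2 + ε ^ 2)⁻¹ : ℝ) • (fderiv ℝ φ w w) := by
    intro ε hε
    have hint : ∀ v, Integrable fun w => (regLog ε w : ℂ) * dirDeriv v (dirDeriv v φ) w := fun v =>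
      ((Complex.continuous_ofReal.comp (contDiff_regLog hε).continuous).mul
        (contDiff_dirDeriv (contDiff_dirDeriv hφ v) v).continuous).integrable_of_hasCompactSupport
        (hasCompactSupport_dirDeriv (hasCompactSupport_dirDeriv hφc v) v).mul_left
    have hfd (v : ℂ) : Continuous fun w => ((fderiv ℝ (regLog ε) w v : ℝ) : ℂ) :=
      Complex.continuous_ofReal.comp ((((contDiff_regLog hε).fderiv_right (m := (⊤ : ℕ∞))
        (by simp)).clm_apply contDiff_const).continuous)
    have hint2 : ∀ v, Integrable fun w => ((fderiv ℝ (regLog ε) w v : ℝ) : ℂ) * dirDeriv v φ w :=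
      fun v => ((hfd v).mul (contDiff_dirDeriv hφ v).continuous).integrable_of_hasCompactSupport
        (hasCompactSupport_dirDeriv hφc v).mul_left
    simp only [planeLap, Finset.mul_sum]
    rw [integral_finsetSum _ fun b _ => hint _]
    simp only [integral_ofReal_mul_dirDeriv (contDiff_regLog hε) (contDiff_dirDeriv hφ _)
      (hasCompactSupport_dirDeriv hφc _)]
    rw [Finset.sum_neg_distrib, ← integral_finsetSum _ fun b _ => hint2 _]
    congr 1
    refine integral_congr_ae (.of_forall fun w => ?_)
    have hw : fderiv ℝ φ w w = w.re • fderiv ℝ φ w 1 + w.im • fderiv ℝ φ w Complex.I := by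
      rw [← map_smul, ← map_smul, ← map_add]
      congr 1
      simp
    simp only [Fintype.sum_bool, if_true, fderiv_regLog hε, hw, dirDeriv, norm_sq_eq]
    simp
    ring
  have hne : ∀ᵐ w : ℂ, w ≠ 0 := by simp [ae_iff]
  have hlim1 : Filter.Tendsto (fun ε : ℝ => ∫ w, (regLog ε w : ℂ) * planeLap φ w)
      (nhdsWithin 0 (Set.Ioi 0)) (nhds (∫ w, (Real.log ‖w‖ : ℂ) * planeLap φ w)) := by
    have hΔc := (contDiff_planeLap hφ).continuous
    refine tendsto_integral_filter_of_dominated_convergence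
      (fun w => (‖w‖ ^ 2 + 1 + ‖w‖⁻¹) * ‖planeLap φ w‖) ?_ ?_ ?_ ?_
    · filter_upwards [self_mem_nhdsWithin] with ε hε
      exact ((Complex.continuous_ofReal.comp (contDiff_regLog hε).continuous).mul
        hΔc).aestronglyMeasurable
    · filter_upwards [Ioc_mem_nhdsGT (zero_lt_one' ℝ)] with ε hε
      filter_upwards [hne] with w hw
      rw [norm_mul, Complex.norm_real]
      gcongr
      exact abs_regLog_le hε.1 hε.2 hw
    · have h : LocallyIntegrable fun w : ℂ => ‖w‖ ^ 2 + 1 + ‖w‖⁻¹ := by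
        have := (Continuous.locallyIntegrable (μ := (volume : Measure ℂ))
          (f := fun w : ℂ => ‖w‖ ^ 2 + 1) (by fun_prop)).add (locallyIntegrable_inv_norm_sub 0)
        simp only [sub_zero] at this
        exact this
      exact h.integrable_smul_right_of_hasCompactSupport hΔc.norm
        (hasCompactSupport_planeLap hφc).norm
    · filter_upwards [hne] with w hw
      exact ((Complex.continuous_ofReal.tendsto _).comp (tendsto_regLog hw)).mul_const _
  have hlim2 : Filter.Tendsto (fun ε : ℝ => - ∫ w, ((‖w‖ ^ 2 + ε ^ 2)⁻¹ : ℝ) • (fderiv ℝ φ w w))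
      (nhdsWithin 0 (Set.Ioi 0)) (nhds (- ∫ w, ((‖w‖ ^ 2)⁻¹ : ℝ) • (fderiv ℝ φ w w))) := by
    have hfc : Continuous (fderiv ℝ φ) := hφ.continuous_fderiv (by simp)
    have hfc' : Continuous fun w => fderiv ℝ φ w w := hfc.clm_apply continuous_id
    refine Filter.Tendsto.neg ?_
    refine tendsto_integral_filter_of_dominated_convergence
      (fun w => ‖w‖⁻¹ * ‖fderiv ℝ φ w‖) ?_ ?_ ?_ ?_
    · filter_upwards [self_mem_nhdsWithin] with ε hε
      have hε : 0 < ε := hε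
      have hc : Continuous fun w : ℂ => ‖w‖ ^ 2 + ε ^ 2 := by fun_prop
      exact ((hc.inv₀ fun w => by positivity).smul hfc').aestronglyMeasurable
    · filter_upwards [self_mem_nhdsWithin] with ε hε
      have hε : 0 < ε := hε
      filter_upwards [hne] with w hw
      have hw' := norm_pos_iff.2 hw
      rw [norm_smul, Real.norm_of_nonneg (by positivity)]
      calc (‖w‖ ^ 2 + ε ^ 2)⁻¹ * ‖fderiv ℝ φ w w‖ ≤ (‖w‖ ^ 2)⁻¹ * (‖fderiv ℝ φ w‖ * ‖w‖) := by
            gcongr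
            · nlinarith
            · exact ContinuousLinearMap.le_opNorm _ _
        _ = ‖w‖⁻¹ * ‖fderiv ℝ φ w‖ := by field_simp
    · have := locallyIntegrable_inv_norm_sub 0
      simp only [sub_zero] at this
      exact this.integrable_smul_right_of_hasCompactSupport hfc.norm (hφc.fderiv ℝ).norm
    · filter_upwards [hne] with w hw
      refine Filter.Tendsto.smul_const ?_ _
      have h : ContinuousAt (fun ε : ℝ => (‖w‖ ^ 2 + ε ^ 2)⁻¹) 0 :=
        ContinuousAt.inv₀ (by fun_prop) (by simp [hw])
      have h2 := h.tendsto
      simp only [ne_eq, OfNat.ofNat_ne_zero, not_false_eq_true, zero_pow, add_zero] at h2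
      exact h2.mono_left nhdsWithin_le_nhds
  have heq := tendsto_nhds_unique (hlim1.congr' (f₂ := fun ε : ℝ =>
    - ∫ w, ((‖w‖ ^ 2 + ε ^ 2)⁻¹ : ℝ) • (fderiv ℝ φ w w))
    (by filter_upwards [self_mem_nhdsWithin] with ε hε using hreg ε hε)) hlim2
  rw [heq, integral_radial hφ hφc, neg_neg]

/-- Green's formula: `log |w - ζ|` is `2π` times a fundamental solution of the Laplacian. -/
lemma integral_log_norm_sub_mul_planeLap {φ : ℂ → ℂ} (hφ : ContDiff ℝ (⊤ : ℕ∞) φ)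
    (hφc : HasCompactSupport φ) (ζ : ℂ) :
    ∫ w, (Real.log ‖w - ζ‖ : ℂ) * planeLap φ w = 2 * Real.pi * φ ζ := by
  have h := integral_log_norm_mul_planeLap_zero (φ := fun w => φ (w + ζ))
    (hφ.comp (contDiff_id.add contDiff_const)) (hφc.comp_homeomorph (Homeomorph.addRight ζ))
  rw [zero_add] at h
  rw [← h, ← integral_add_right_eq_self _ ζ]
  refine integral_congr_ae (.of_forall fun w => ?_)
  have hd (ψ : ℂ → ℂ) (v : ℂ) : dirDeriv v (fun w => ψ (w + ζ)) = fun w => dirDeriv v ψ (w + ζ) := by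
    funext w
    simp [dirDeriv, fderiv_comp_add_right]
  simp [planeLap, hd]

/-! ### Sampling points and the removal of affine functions -/

/-- The uniform probability measure on the closed disk of radius `r` about `0`. -/
def diskMeasure (r : ℝ) : Measure ℂ :=
  (volume (Metric.closedBall (0 : ℂ) r))⁻¹ • volume.restrict (Metric.closedBall 0 r)

lemma isProbabilityMeasure_diskMeasure {r : ℝ} (hr : 0 < r) :
    IsProbabilityMeasure (diskMeasure r) := by
  refine ⟨?_⟩
  simp only [diskMeasure, Measure.smul_apply, Measure.restrict_apply_univ, smul_eq_mul]
  exact ENNReal.inv_mul_cancel (Metric.measure_closedBall_pos _ _ hr).ne'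
    measure_closedBall_lt_top.ne

instance (r : ℝ) : SFinite (diskMeasure r) := by unfold diskMeasure; infer_instance

lemma diskMeasure_absolutelyContinuous (r : ℝ) : diskMeasure r ≪ volume :=
  (Measure.smul_absolutelyContinuous).trans Measure.restrict_le_self.absolutelyContinuous

lemma ae_diskMeasure_mem (r : ℝ) : ∀ᵐ w ∂(diskMeasure r), w ∈ Metric.closedBall (0 : ℂ) r :=
  (Measure.smul_absolutelyContinuous).ae_le (ae_restrict_mem Metric.isClosed_closedBall.measurableSet)

/-- The area of the disk of radius `r`. -/
def diskArea (r : ℝ) : ℝ := volume.real (Metric.closedBall (0 : ℂ) r)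

lemma diskArea_pos {r : ℝ} (hr : 0 < r) : 0 < diskArea r :=
  ENNReal.toReal_pos (Metric.measure_closedBall_pos _ _ hr).ne' measure_closedBall_lt_top.ne

lemma integral_diskMeasure {E : Type*} [NormedAddCommGroup E] [NormedSpace ℝ E] (r : ℝ)
    (f : ℂ → E) :
    ∫ w, f w ∂(diskMeasure r) = (diskArea r)⁻¹ • ∫ w in Metric.closedBall 0 r, f w := by
  rw [diskMeasure, integral_smul_measure, ENNReal.toReal_inv]; rfl

lemma integrable_diskMeasure {E : Type*} [NormedAddCommGroup E] {r : ℝ} (hr : 0 < r)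
    {f : ℂ → E} (hf : LocallyIntegrable f) : Integrable f (diskMeasure r) := by
  have h : IntegrableOn f (Metric.closedBall 0 r) :=
    hf.integrableOn_isCompact (isCompact_closedBall _ _)
  exact Integrable.smul_measure h
    (ENNReal.inv_ne_top.2 (Metric.measure_closedBall_pos _ _ hr).ne')

/-- The four points at which a pair `(w, y)` samples a function: `w` itself, and the vertices
`y`, `y + 1`, `y + i` of a triangle. -/
def node (x : ℂ × ℂ) : Fin 4 → ℂ := ![x.1, x.2, x.2 + 1, x.2 + Complex.I]

/-- The coefficients with which `node x` computes the difference between a function at `w` and its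
affine interpolation from the vertices `y`, `y + 1`, `y + i`. -/
def weight (x : ℂ × ℂ) : Fin 4 → ℝ :=
  ![1, -(1 - (x.1 - x.2).re - (x.1 - x.2).im), -(x.1 - x.2).re, -(x.1 - x.2).im]

/-- The error at `w` of the affine interpolation of `u` from the vertices `y`, `y + 1`, `y + i`. -/
def residual (u : ℂ → ℝ) (x : ℂ × ℂ) : ℝ := ∑ q, weight x q * u (node x q)

lemma residual_eq (u : ℂ → ℝ) (x : ℂ × ℂ) :
    residual u x = u x.1 + (-(1 - (x.1 - x.2).re - (x.1 - x.2).im)) * u x.2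
      + (-(x.1 - x.2).re) * u (x.2 + 1) + (-(x.1 - x.2).im) * u (x.2 + Complex.I) := by
  simp [residual, Fin.sum_univ_four, weight, node]

lemma continuous_node (q : Fin 4) : Continuous fun x => node x q := by
  fin_cases q <;> simp [node] <;> fun_prop

lemma continuous_weight (q : Fin 4) : Continuous fun x => weight x q := by
  fin_cases q <;> simp [weight] <;> fun_prop

lemma abs_weight_le {r : ℝ} (hr : 1 ≤ r) {x : ℂ × ℂ} (h1 : ‖x.1‖ ≤ r) (h2 : ‖x.2‖ ≤ r)
    (q : Fin 4) : |weight x q| ≤ 5 * r := by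
  have h : ‖x.1 - x.2‖ ≤ 2 * r := (norm_sub_le _ _).trans (by linarith)
  have hre := abs_le.1 ((Complex.abs_re_le_norm (x.1 - x.2)).trans h)
  have him := abs_le.1 ((Complex.abs_im_le_norm (x.1 - x.2)).trans h)
  rw [abs_le]
  fin_cases q <;> simp only [weight] <;> simp [-Complex.sub_re, -Complex.sub_im] <;>
    constructor <;> linarith

lemma norm_node_le {r : ℝ} (hr : 1 ≤ r) {x : ℂ × ℂ} (h1 : ‖x.1‖ ≤ r) (h2 : ‖x.2‖ ≤ r)
    (q : Fin 4) : ‖node x q‖ ≤ 2 * r := by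
  have e1 : ‖x.2 + 1‖ ≤ ‖x.2‖ + 1 := (norm_add_le _ _).trans (by simp)
  have e2 : ‖x.2 + Complex.I‖ ≤ ‖x.2‖ + 1 := (norm_add_le _ _).trans (by simp)
  fin_cases q <;> simp [node] <;> linarith

lemma ae_diskMeasure_prod_mem (r : ℝ) :
    ∀ᵐ x ∂((diskMeasure r).prod (diskMeasure r)), ‖x.1‖ ≤ r ∧ ‖x.2‖ ≤ r := by
  have h := ae_diskMeasure_mem r
  simp only [Metric.mem_closedBall, dist_zero_right] at h
  exact (Measure.quasiMeasurePreserving_fst.ae h).and (Measure.quasiMeasurePreserving_snd.ae h)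

lemma integrable_residual {r : ℝ} (hr : 1 ≤ r) {u : ℂ → ℝ} (hu : LocallyIntegrable u) :
    Integrable (residual u) ((diskMeasure r).prod (diskMeasure r)) := by
  have hr0 : 0 < r := by linarith
  have := isProbabilityMeasure_diskMeasure hr0
  have hb : ∀ q, ∀ᵐ x ∂((diskMeasure r).prod (diskMeasure r)), ‖weight x q‖ ≤ 5 * r := by
    intro q
    filter_upwards [ae_diskMeasure_prod_mem r] with x hx using abs_weight_le hr hx.1 hx.2 q
  refine integrable_finsetSum _ fun q _ => ?_
  refine Integrable.bdd_mul (c := 5 * r) ?_ (continuous_weight q).aestronglyMeasurable (hb q)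
  have hshift : ∀ c : ℂ, Integrable (fun w => u (w + c)) (diskMeasure r) := by
    intro c
    refine integrable_diskMeasure hr0 ?_
    rw [locallyIntegrable_iff] at hu ⊢
    intro K hK
    have := ((measurePreserving_add_right (volume : Measure ℂ) c).integrableOn_comp_preimage
      (MeasurableEquiv.addRight c).measurableEmbedding (f := u) (s := (fun w => w + c) '' K)).2
      (hu _ (hK.image (by fun_prop)))
    exact this.mono_set (Set.subset_preimage_image _ _)
  have h0 := hshift 0
  simp only [add_zero] at h0
  fin_cases q
  · exact h0.comp_fst _
  · exact h0.comp_snd _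
  · exact (hshift 1).comp_snd _
  · exact (hshift Complex.I).comp_snd _

/-! ### Green's formula for the residual -/

lemma integral_dirDeriv_eq_zero {ψ : ℂ → ℂ} (hψ : ContDiff ℝ (⊤ : ℕ∞) ψ)
    (hψc : HasCompactSupport ψ) (v : ℂ) : ∫ w, dirDeriv v ψ w = 0 := by
  have := integral_ofReal_mul_dirDeriv (u := fun _ => (1 : ℝ)) contDiff_const hψ hψc v
  simpa using this

/-- Affine functions are harmonic. -/
lemma integral_affine_mul_planeLap {φ : ℂ → ℂ} (hφ : ContDiff ℝ (⊤ : ℕ∞) φ)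
    (hφc : HasCompactSupport φ) (l : ℂ →L[ℝ] ℝ) (c : ℝ) :
    ∫ w, ((l w + c : ℝ) : ℂ) * planeLap φ w = 0 := by
  have hu : ContDiff ℝ (⊤ : ℕ∞) fun w => l w + c := l.contDiff.add contDiff_const
  have hint (v : ℂ) : Integrable fun w => ((l w + c : ℝ) : ℂ) * dirDeriv v (dirDeriv v φ) w :=
    ((Complex.continuous_ofReal.comp hu.continuous).mul
      (contDiff_dirDeriv (contDiff_dirDeriv hφ v) v).continuous).integrable_of_hasCompactSupport
      (hasCompactSupport_dirDeriv (hasCompactSupport_dirDeriv hφc v) v).mul_left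
  have hfd (w v : ℂ) : fderiv ℝ (fun w => l w + c) w v = l v := by
    rw [fderiv_add_const, l.fderiv]
  simp only [planeLap, Finset.mul_sum]
  rw [integral_finsetSum _ fun b _ => hint _]
  refine Finset.sum_eq_zero fun b _ => ?_
  rw [integral_ofReal_mul_dirDeriv hu (contDiff_dirDeriv hφ _) (hasCompactSupport_dirDeriv hφc _)]
  simp only [hfd]
  rw [integral_const_mul, integral_dirDeriv_eq_zero hφ hφc, mul_zero, neg_zero]

/-- `u` is a potential of the point masses `ζ j`: a locally integrable function whose
distributional Laplacian is `2π ∑ j, δ_{ζ j}`. -/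
structure IsLogPotential {ι : Type*} [Fintype ι] (ζ : ι → ℂ) (u : ℂ → ℝ) : Prop where
  locallyIntegrable : LocallyIntegrable u
  integral_mul_planeLap : ∀ φ : ℂ → ℂ, ContDiff ℝ (⊤ : ℕ∞) φ → HasCompactSupport φ →
    ∫ w, (u w : ℂ) * planeLap φ w = 2 * Real.pi * ∑ j, φ (ζ j)

lemma setIntegral_mul_planeLap {r : ℝ} {φ : ℂ → ℂ}
    (hφB : tsupport φ ⊆ Metric.closedBall 0 r) (u : ℂ → ℂ) :
    ∫ w in Metric.closedBall 0 r, u w * planeLap φ w = ∫ w, u w * planeLap φ w :=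
  setIntegral_eq_integral_of_forall_compl_eq_zero fun w hw => by
    rw [planeLap_eq_zero fun h => hw (hφB h), mul_zero]

/-- For fixed `y`, the residual differs from `u` by an affine function of `w`, which does not change
the integral against a Laplacian. -/
lemma IsLogPotential.integral_residual_mul_planeLap {ι : Type*} [Fintype ι] {ζ : ι → ℂ}
    {u : ℂ → ℝ} (hu : IsLogPotential ζ u) {r : ℝ} (hr : 1 ≤ r) {φ : ℂ → ℂ}
    (hφ : ContDiff ℝ (⊤ : ℕ∞) φ) (hφB : tsupport φ ⊆ Metric.closedBall 0 r) :
    ∫ x, (residual u x : ℂ) * planeLap φ x.1 ∂((diskMeasure r).prod (diskMeasure r)) =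
      (2 * Real.pi / diskArea r : ℝ) * ∑ j, φ (ζ j) := by
  have hr0 : 0 < r := by linarith
  have := isProbabilityMeasure_diskMeasure hr0
  have hφc : HasCompactSupport φ :=
    (isCompact_closedBall _ _).of_isClosed_subset (isClosed_tsupport _) hφB
  have hΔc := (contDiff_planeLap hφ).continuous
  have hΔs := hasCompactSupport_planeLap hφc
  obtain ⟨K, hK⟩ := hΔs.exists_bound_of_continuous hΔc
  have hint : Integrable (fun x : ℂ × ℂ => (residual u x : ℂ) * planeLap φ x.1)
      ((diskMeasure r).prod (diskMeasure r)) :=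
    (integrable_residual hr hu.locallyIntegrable).ofReal.mul_bdd (c := K)
      (hΔc.comp continuous_fst).aestronglyMeasurable (.of_forall fun x => hK _)
  rw [integral_prod_symm _ hint]
  have hinner : ∀ y : ℂ, ∫ w, (residual u (w, y) : ℂ) * planeLap φ w ∂(diskMeasure r) =
      (2 * Real.pi / diskArea r : ℝ) * ∑ j, φ (ζ j) := by
    intro y
    rw [integral_diskMeasure, setIntegral_mul_planeLap hφB (fun w => (residual u (w, y) : ℂ))]
    let l : ℂ →L[ℝ] ℝ := (u y - u (y + 1)) • Complex.reCLM + (u y - u (y + Complex.I)) • Complex.imCLM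
    let c : ℝ := -l y - u y
    have hsplit : ∀ w, (residual u (w, y) : ℂ) * planeLap φ w =
        (u w : ℂ) * planeLap φ w + ((l w + c : ℝ) : ℂ) * planeLap φ w := by
      intro w
      rw [← add_mul, ← Complex.ofReal_add]
      congr 2
      simp [residual_eq, l, c]
      ring
    simp only [hsplit]
    rw [integral_add, hu.integral_mul_planeLap φ hφ hφc, integral_affine_mul_planeLap hφ hφc]
    · simp; ring
    · have h : LocallyIntegrable fun w => (u w : ℂ) := fun x => by
        obtain ⟨s, hs, h⟩ := hu.locallyIntegrable x
        exact ⟨s, hs, h.ofReal⟩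
      exact h.integrable_smul_right_of_hasCompactSupport hΔc hΔs
    · exact ((Complex.continuous_ofReal.comp (by fun_prop)).mul hΔc).integrable_of_hasCompactSupport
        hΔs.mul_left
  simp only [hinner]
  simp

/-! ### The logarithm of a polynomial -/

lemma log_norm_eval_eq {ι : Type*} [Fintype ι] {a : ℂ} (ha : a ≠ 0) (ζ : ι → ℂ) (c w : ℂ)
    (hw : ∀ j, w ≠ ζ j - c) :
    Real.log ‖(Polynomial.C a * ∏ j, (X - Polynomial.C (ζ j))).eval (c + w)‖ =
      Real.log ‖a‖ + ∑ j, Real.log ‖w - (ζ j - c)‖ := by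
  have h : ∀ j, ‖w - (ζ j - c)‖ ≠ 0 := fun j => norm_ne_zero_iff.2 (sub_ne_zero.2 (hw j))
  rw [eval_mul, eval_C, eval_prod, norm_mul, norm_prod]
  have h2 : ∀ j, ‖(X - Polynomial.C (ζ j)).eval (c + w)‖ = ‖w - (ζ j - c)‖ := fun j => by
    simp only [eval_sub, eval_X, eval_C]; congr 1; ring
  simp only [h2]
  rw [Real.log_mul (norm_ne_zero_iff.2 ha) (Finset.prod_ne_zero_iff.2 fun j _ => h j),
    Real.log_prod fun j _ => h j]

lemma ae_forall_ne_sub {ι : Type*} [Finite ι] (ζ : ι → ℂ) (c : ℂ) : ∀ᵐ w : ℂ, ∀ j, w ≠ ζ j - c := by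
  rw [ae_all_iff]
  intro j
  simp [ae_iff]

lemma isLogPotential_log_norm_eval {ι : Type*} [Fintype ι] {a : ℂ} (ha : a ≠ 0) (ζ : ι → ℂ) (c : ℂ) :
    IsLogPotential (fun j => ζ j - c) fun w =>
      Real.log ‖(Polynomial.C a * ∏ j, (X - Polynomial.C (ζ j))).eval (c + w)‖ := by
  have hae : (fun w => Real.log ‖(Polynomial.C a * ∏ j, (X - Polynomial.C (ζ j))).eval (c + w)‖)
      =ᵐ[volume] fun w => Real.log ‖a‖ + ∑ j, Real.log ‖w - (ζ j - c)‖ := by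
    filter_upwards [ae_forall_ne_sub ζ c] with w hw using log_norm_eval_eq ha ζ c w hw
  have hloc : LocallyIntegrable fun w : ℂ => Real.log ‖a‖ + ∑ j, Real.log ‖w - (ζ j - c)‖ := by
    have h1 : LocallyIntegrable fun w : ℂ => ∑ j, Real.log ‖w - (ζ j - c)‖ :=
      locallyIntegrable_finsetSum _ fun j _ => locallyIntegrable_log_norm_sub _
    exact (locallyIntegrable_const _).add h1
  refine ⟨fun x => ?_, fun φ hφ hφc => ?_⟩
  · obtain ⟨s, hs, h⟩ := hloc x
    exact ⟨s, hs, h.congr (ae_restrict_of_ae hae.symm)⟩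
  · have hΔc := (contDiff_planeLap hφ).continuous
    have hΔs := hasCompactSupport_planeLap hφc
    have hint : ∀ j, Integrable fun w => (Real.log ‖w - (ζ j - c)‖ : ℂ) * planeLap φ w := by
      intro j
      have h : LocallyIntegrable fun w => (Real.log ‖w - (ζ j - c)‖ : ℂ) := fun x => by
        obtain ⟨s, hs, h⟩ := locallyIntegrable_log_norm_sub (ζ j - c) x
        exact ⟨s, hs, h.ofReal⟩
      exact h.integrable_smul_right_of_hasCompactSupport hΔc hΔs
    have hconst : ∫ w, ((Real.log ‖a‖ : ℝ) : ℂ) * planeLap φ w = 0 := by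
      have := integral_affine_mul_planeLap hφ hφc 0 (Real.log ‖a‖)
      simpa using this
    calc _ = ∫ w, (((Real.log ‖a‖ : ℝ) : ℂ) * planeLap φ w
          + ∑ j, (Real.log ‖w - (ζ j - c)‖ : ℂ) * planeLap φ w) := by
          refine integral_congr_ae ?_
          filter_upwards [hae] with w hw
          rw [hw, ← Finset.sum_mul, ← add_mul]
          push_cast; rfl
      _ = _ := by
          rw [integral_add, hconst, integral_finsetSum _ fun j _ => hint j, zero_add]
          · simp only [integral_log_norm_sub_mul_planeLap hφ hφc, Finset.mul_sum]
          · exact (hΔc.integrable_of_hasCompactSupport hΔs).const_mul _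
          · exact integrable_finsetSum _ fun j _ => hint j

/-! ### The iterated Laplacian in `k` complex variables -/

lemma contDiff_nat_of_top {E F : Type*} [NormedAddCommGroup E] [NormedSpace ℝ E]
    [NormedAddCommGroup F] [NormedSpace ℝ F] {G : E → F} (hG : ContDiff ℝ (⊤ : ℕ∞) G) (a : ℕ) :
    ContDiff ℝ a G := contDiff_infty.1 hG a

/-- The Laplacian in the `j`-th complex variable. -/
def coordLap {k : ℕ} (j : Fin k) (G : (Fin k → ℂ) → ℂ) (w : Fin k → ℂ) : ℂ :=
  ∑ b : Bool, dirDeriv (realBasis (j, b)) (dirDeriv (realBasis (j, b)) G) w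

/-- The successive application of the Laplacians in the variables listed in `l`. -/
def lapList {k : ℕ} (l : List (Fin k)) (G : (Fin k → ℂ) → ℂ) : (Fin k → ℂ) → ℂ :=
  l.foldl (fun K j => coordLap j K) G

/-- The composition of the Laplacians in all `k` complex variables. -/
def multiLap {k : ℕ} (G : (Fin k → ℂ) → ℂ) : (Fin k → ℂ) → ℂ :=
  lapList (List.finRange k) G

lemma lapList_cons {k : ℕ} (j : Fin k) (l : List (Fin k)) (G : (Fin k → ℂ) → ℂ) :
    lapList (j :: l) G = lapList l (coordLap j G) := rfl

lemma contDiff_coordLap {k : ℕ} {G : (Fin k → ℂ) → ℂ} (hG : ContDiff ℝ (⊤ : ℕ∞) G) (j : Fin k) :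
    ContDiff ℝ (⊤ : ℕ∞) (coordLap j G) :=
  ContDiff.sum fun _ _ => contDiff_dirDeriv (contDiff_dirDeriv hG _) _

lemma contDiff_lapList {k : ℕ} (l : List (Fin k)) {G : (Fin k → ℂ) → ℂ}
    (hG : ContDiff ℝ (⊤ : ℕ∞) G) : ContDiff ℝ (⊤ : ℕ∞) (lapList l G) := by
  induction l generalizing G with
  | nil => exact hG
  | cons j l ih => exact ih (contDiff_coordLap hG j)

lemma contDiff_multiLap {k : ℕ} {G : (Fin k → ℂ) → ℂ} (hG : ContDiff ℝ (⊤ : ℕ∞) G) :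
    ContDiff ℝ (⊤ : ℕ∞) (multiLap G) := contDiff_lapList _ hG

lemma support_coordLap_subset {k : ℕ} {G : (Fin k → ℂ) → ℂ} {S : Set (Fin k → ℂ)}
    (hS : IsClosed S) (hG : Function.support G ⊆ S) (j : Fin k) :
    Function.support (coordLap j G) ⊆ S := by
  intro w hw
  by_contra h
  have h' : w ∉ tsupport G := fun h'' => h (closure_minimal hG hS h'')
  exact hw (Finset.sum_eq_zero fun _ _ => image_eq_zero_of_notMem_tsupport fun h'' =>
    h' (tsupport_dirDeriv_subset _ _ (tsupport_dirDeriv_subset _ _ h'')))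

lemma norm_realBasis_le {k : ℕ} (e : Fin k × Bool) : ‖(realBasis e : Fin k → ℂ)‖ ≤ 1 := by
  rw [realBasis, Pi.norm_single]
  split_ifs <;> simp

lemma norm_iteratedFDeriv_dirDeriv_le {k : ℕ} {G : (Fin k → ℂ) → ℂ}
    (hG : ContDiff ℝ (⊤ : ℕ∞) G) (e : Fin k × Bool) (a : ℕ) (w : Fin k → ℂ) :
    ‖iteratedFDeriv ℝ a (dirDeriv (realBasis e) G) w‖ ≤ ‖iteratedFDeriv ℝ (a + 1) G w‖ := by
  have h1 : ContDiffAt ℝ a (fderiv ℝ G) w :=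
    (contDiff_nat_of_top (hG.fderiv_right (m := (⊤ : ℕ∞)) (by simp)) a).contDiffAt
  refine (norm_iteratedFDeriv_clm_apply_const (c := realBasis e) h1 le_rfl).trans ?_
  rw [norm_iteratedFDeriv_fderiv]
  exact mul_le_of_le_one_left (norm_nonneg _) (norm_realBasis_le e)

lemma norm_iteratedFDeriv_lapList_le {k : ℕ} (l : List (Fin k)) {G : (Fin k → ℂ) → ℂ}
    (hG : ContDiff ℝ (⊤ : ℕ∞) G) {a : ℕ} {M : ℝ}
    (hM : ∀ w, ‖iteratedFDeriv ℝ (a + 2 * l.length) G w‖ ≤ M) (w : Fin k → ℂ) :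
    ‖iteratedFDeriv ℝ a (lapList l G) w‖ ≤ 2 ^ l.length * M := by
  induction l generalizing G M with
  | nil => simpa [lapList] using hM w
  | cons j l ih =>
    rw [lapList_cons]
    refine (ih (contDiff_coordLap hG j) (M := 2 * M) fun w => ?_).trans_eq ?_
    · have : coordLap j G = fun w => ∑ b : Bool,
          dirDeriv (realBasis (j, b)) (dirDeriv (realBasis (j, b)) G) w := rfl
      have hs : ∀ b ∈ (Finset.univ : Finset Bool), ContDiff ℝ (a + 2 * l.length : ℕ)
          (dirDeriv (realBasis (j, b)) (dirDeriv (realBasis (j, b)) G)) := fun b _ =>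
        contDiff_nat_of_top (contDiff_dirDeriv (contDiff_dirDeriv hG _) _) _
      rw [this, iteratedFDeriv_sum hs]
      have hb : ∀ b, ‖iteratedFDeriv ℝ (a + 2 * l.length)
          (dirDeriv (realBasis (j, b)) (dirDeriv (realBasis (j, b)) G)) w‖ ≤ M := fun b =>
        (norm_iteratedFDeriv_dirDeriv_le (contDiff_dirDeriv hG _) _ _ _).trans
          ((norm_iteratedFDeriv_dirDeriv_le hG _ _ _).trans (by
            have := hM w
            rwa [List.length_cons, show a + 2 * (l.length + 1) = a + 2 * l.length + 1 + 1 by ring]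
              at this))
      simp only [Fintype.sum_bool]
      exact (norm_add_le _ _).trans (by linarith [hb true, hb false])
    · rw [List.length_cons]; ring

lemma norm_multiLap_le {k : ℕ} {G : (Fin k → ℂ) → ℂ} (hG : ContDiff ℝ (⊤ : ℕ∞) G) {M : ℝ}
    (hM : ∀ w, ‖iteratedFDeriv ℝ (2 * k) G w‖ ≤ M) (w : Fin k → ℂ) :
    ‖multiLap G w‖ ≤ 2 ^ k * M := by
  have hk : 2 * k = 0 + 2 * (List.finRange k).length := by simp
  rw [hk] at hM
  have := norm_iteratedFDeriv_lapList_le (List.finRange k) hG hM w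
  simpa [multiLap] using this

/-! ### Slices -/

lemma contDiff_cons_right {k : ℕ} (t : ℂ) :
    ContDiff ℝ (⊤ : ℕ∞) fun w : Fin k → ℂ => (Fin.cons t w : Fin (k + 1) → ℂ) := by
  refine contDiff_pi.2 fun i => ?_
  cases i using Fin.cases with
  | zero => simpa using contDiff_const
  | succ i => simpa using contDiff_apply ℝ ℂ i

lemma contDiff_cons_left {k : ℕ} (w : Fin k → ℂ) :
    ContDiff ℝ (⊤ : ℕ∞) fun t : ℂ => (Fin.cons t w : Fin (k + 1) → ℂ) := by
  refine contDiff_pi.2 fun i => ?_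
  cases i using Fin.cases with
  | zero => exact contDiff_id
  | succ i => simpa using contDiff_const

lemma dirDeriv_cons_right {k : ℕ} {G : (Fin (k + 1) → ℂ) → ℂ} (hG : ContDiff ℝ (⊤ : ℕ∞) G)
    (t : ℂ) (w : Fin k → ℂ) (j : Fin k) (b : Bool) :
    dirDeriv (realBasis (j.succ, b)) G (Fin.cons t w) =
      dirDeriv (realBasis (j, b)) (fun w => G (Fin.cons t w)) w := by
  unfold dirDeriv
  rw [← (hG.differentiable (by simp) _).lineDeriv_eq_fderiv,
    ← DifferentiableAt.lineDeriv_eq_fderiv (f := fun w => G (Fin.cons t w))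
      ((hG.comp (contDiff_cons_right t)).differentiable (by simp) w)]
  unfold lineDeriv
  congr 1
  funext s
  congr 1
  funext i
  cases i using Fin.cases with
  | zero => simp [realBasis, (Fin.succ_ne_zero j).symm]
  | succ i => simp [realBasis, Pi.single_apply]

lemma dirDeriv_cons_left {k : ℕ} {G : (Fin (k + 1) → ℂ) → ℂ} (hG : ContDiff ℝ (⊤ : ℕ∞) G)
    (t : ℂ) (w : Fin k → ℂ) (b : Bool) :
    dirDeriv (realBasis (0, b)) G (Fin.cons t w) =
      dirDeriv (if b then Complex.I else 1) (fun t => G (Fin.cons t w)) t := by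
  unfold dirDeriv
  rw [← (hG.differentiable (by simp) _).lineDeriv_eq_fderiv,
    ← DifferentiableAt.lineDeriv_eq_fderiv (f := fun t => G (Fin.cons t w))
      ((hG.comp (contDiff_cons_left w)).differentiable (by simp) t)]
  unfold lineDeriv
  congr 1
  funext s
  congr 1
  funext i
  cases i using Fin.cases with
  | zero => simp [realBasis]
  | succ i => simp [realBasis]

lemma coordLap_succ_cons {k : ℕ} {G : (Fin (k + 1) → ℂ) → ℂ} (hG : ContDiff ℝ (⊤ : ℕ∞) G)
    (t : ℂ) (w : Fin k → ℂ) (j : Fin k) :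
    coordLap j.succ G (Fin.cons t w) = coordLap j (fun w => G (Fin.cons t w)) w := by
  refine Finset.sum_congr rfl fun b _ => ?_
  rw [dirDeriv_cons_right (contDiff_dirDeriv hG _)]
  congr 1
  funext w
  exact dirDeriv_cons_right hG t w j b

lemma coordLap_zero_cons {k : ℕ} {G : (Fin (k + 1) → ℂ) → ℂ} (hG : ContDiff ℝ (⊤ : ℕ∞) G)
    (t : ℂ) (w : Fin k → ℂ) :
    coordLap 0 G (Fin.cons t w) = planeLap (fun t => G (Fin.cons t w)) t := by
  refine Finset.sum_congr rfl fun b _ => ?_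
  rw [dirDeriv_cons_left (contDiff_dirDeriv hG _)]
  congr 1
  funext t
  exact dirDeriv_cons_left hG t w b

lemma lapList_map_succ_cons {k : ℕ} (l : List (Fin k)) {G : (Fin (k + 1) → ℂ) → ℂ}
    (hG : ContDiff ℝ (⊤ : ℕ∞) G) (t : ℂ) (w : Fin k → ℂ) :
    lapList (l.map Fin.succ) G (Fin.cons t w) = lapList l (fun w => G (Fin.cons t w)) w := by
  induction l generalizing G with
  | nil => rfl
  | cons j l ih =>
    rw [List.map_cons, lapList_cons, lapList_cons, ih (contDiff_coordLap hG _)]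
    congr 1
    funext w
    exact coordLap_succ_cons hG t w j

lemma multiLap_cons {k : ℕ} {G : (Fin (k + 1) → ℂ) → ℂ} (hG : ContDiff ℝ (⊤ : ℕ∞) G)
    (t : ℂ) (w : Fin k → ℂ) :
    multiLap G (Fin.cons t w) = multiLap (fun w => coordLap 0 G (Fin.cons t w)) w := by
  rw [multiLap, List.finRange_succ, lapList_cons, lapList_map_succ_cons _ (contDiff_coordLap hG 0)]
  rfl

/-! ### Green's formula in `k` complex variables -/

/-- Green's formula in several variables, for samples `x j` that are independent with the same law
`ρ`. The planar formula is applied to one variable at a time. -/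
lemma integral_pi_prod_mul_multiLap {Y : Type*} [MeasurableSpace Y] (ρ : Measure Y)
    [IsProbabilityMeasure ρ] {W : Y → ℂ} (hW : Measurable W) {r : ℝ} {ι : Type*}
    [Fintype ι] (κ : ℂ) {k : ℕ} {v : Fin k → Y → ℝ} (hv : ∀ j, Integrable (v j) ρ)
    {ζ : Fin k → ι → ℂ}
    (hgreen : ∀ j, ∀ φ : ℂ → ℂ, ContDiff ℝ (⊤ : ℕ∞) φ → tsupport φ ⊆ Metric.closedBall 0 r →
      ∫ y, (v j y : ℂ) * planeLap φ (W y) ∂ρ = κ * ∑ i, φ (ζ j i))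
    {G : (Fin k → ℂ) → ℂ} (hG : ContDiff ℝ (⊤ : ℕ∞) G)
    (hGs : Function.support G ⊆ Set.pi Set.univ fun _ => Metric.closedBall (0 : ℂ) r) :
    Integrable (fun x => (∏ j, (v j (x j) : ℂ)) * multiLap G (fun j => W (x j)))
      (Measure.pi fun _ : Fin k => ρ) ∧
    ∫ x, (∏ j, (v j (x j) : ℂ)) * multiLap G (fun j => W (x j)) ∂(Measure.pi fun _ : Fin k => ρ) =
      κ ^ k * ∑ i : Fin k → ι, G fun j => ζ j (i j) := by
  classical
  have hint : ∀ {k : ℕ} {v : Fin k → Y → ℝ} (_ : ∀ j, Integrable (v j) ρ) {G : (Fin k → ℂ) → ℂ}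
      (_ : ContDiff ℝ (⊤ : ℕ∞) G)
      (_ : Function.support G ⊆ Set.pi Set.univ fun _ => Metric.closedBall (0 : ℂ) r),
      Integrable (fun x => (∏ j, (v j (x j) : ℂ)) * multiLap G (fun j => W (x j)))
        (Measure.pi fun _ : Fin k => ρ) := by
    intro k v hv G hG hGs
    have hc : IsCompact (Set.pi Set.univ fun _ : Fin k => Metric.closedBall (0 : ℂ) r) :=
      isCompact_univ_pi fun _ => isCompact_closedBall _ _
    have hGc : HasCompactSupport G := hc.of_isClosed_subset (isClosed_tsupport _)
      (closure_minimal hGs hc.isClosed)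
    have hbd : ∃ M, ∀ w, ‖iteratedFDeriv ℝ (2 * k) G w‖ ≤ M :=
      (hGc.iteratedFDeriv (𝕜 := ℝ) (2 * k)).exists_bound_of_continuous
        ((contDiff_nat_of_top hG (2 * k)).continuous_iteratedFDeriv le_rfl)
    obtain ⟨M, hM⟩ := hbd
    refine Integrable.mul_bdd (c := 2 ^ k * M) ?_ ?_
      (.of_forall fun x => norm_multiLap_le hG hM _)
    · exact Integrable.fintype_prod_dep (f := fun j y => (v j y : ℂ)) fun j => (hv j).ofReal
    · exact ((contDiff_multiLap hG).continuous.measurable.comp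
        (measurable_pi_lambda _ fun j => hW.comp (measurable_pi_apply j))).aestronglyMeasurable
  refine ⟨hint hv hG hGs, ?_⟩
  induction k with
  | zero =>
    simp only [Finset.univ_eq_empty, Finset.prod_empty, one_mul, pow_zero]
    have hm : multiLap G = G := by simp [multiLap, lapList]
    rw [hm]
    simp only [Fintype.sum_unique]
    have : ∀ x : Fin 0 → Y, G (fun j => W (x j)) = G fun j => ζ j ((default : Fin 0 → ι) j) :=
      fun x => congrArg G (Subsingleton.elim _ _)
    simp [this]
  | succ k ih =>
    let e := MeasurableEquiv.piFinSuccAbove (fun _ : Fin (k + 1) => Y) 0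
    have hmp : MeasurePreserving e (Measure.pi fun _ : Fin (k + 1) => ρ)
        (ρ.prod (Measure.pi fun _ : Fin k => ρ)) :=
      measurePreserving_piFinSuccAbove (fun _ : Fin (k + 1) => ρ) 0
    let f : Y × (Fin k → Y) → ℂ := fun p =>
      (v 0 p.1 : ℂ) * ((∏ j, (v (Fin.succ j) (p.2 j) : ℂ)) *
        multiLap (fun w => coordLap 0 G (Fin.cons (W p.1) w)) (fun j => W (p.2 j)))
    have hf : ∀ x, (∏ j, (v j (x j) : ℂ)) * multiLap G (fun j => W (x j)) = f (e x) := by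
      intro x
      have h1 : (fun j => W (x j)) = Fin.cons (W (x 0)) (fun j : Fin k => W (x j.succ)) := by
        funext j
        cases j using Fin.cases <;> rfl
      rw [h1, multiLap_cons hG, Fin.prod_univ_succ, mul_assoc]
      rfl
    have hfint : Integrable f (ρ.prod (Measure.pi fun _ : Fin k => ρ)) := by
      rw [← hmp.integrable_comp_emb e.measurableEmbedding]
      exact (hint hv hG hGs).congr (.of_forall hf)
    rw [integral_congr_ae (.of_forall hf), hmp.integral_comp e.measurableEmbedding,
      integral_prod _ hfint]
    have hGt : ∀ t : ℂ, ContDiff ℝ (⊤ : ℕ∞) fun w : Fin k → ℂ => coordLap 0 G (Fin.cons t w) :=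
      fun t => (contDiff_coordLap hG 0).comp (contDiff_cons_right t)
    have hclosed {k : ℕ} :
        IsClosed (Set.pi Set.univ fun _ : Fin k => Metric.closedBall (0 : ℂ) r) :=
      isClosed_set_pi fun _ _ => Metric.isClosed_closedBall
    have hGts : ∀ t : ℂ, Function.support (fun w : Fin k → ℂ => coordLap 0 G (Fin.cons t w)) ⊆
        Set.pi Set.univ fun _ => Metric.closedBall (0 : ℂ) r := by
      intro t w hw j _
      have := support_coordLap_subset hclosed hGs 0 hw j.succ (Set.mem_univ _)
      simpa using this
    have hinner : ∀ y, ∫ x', f (y, x') ∂(Measure.pi fun _ : Fin k => ρ) =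
        ∑ i : Fin k → ι, κ ^ k * ((v 0 y : ℂ) *
          planeLap (fun t => G (Fin.cons t fun j => ζ j.succ (i j))) (W y)) := by
      intro y
      simp only [f]
      rw [integral_const_mul, ih (fun j => hv j.succ) (fun j => hgreen j.succ) (hGt _) (hGts _)]
      simp only [coordLap_zero_cons hG, Finset.mul_sum]
      exact Finset.sum_congr rfl fun i _ => by ring
    simp only [hinner]
    have hslice : ∀ u : Fin k → ℂ, ContDiff ℝ (⊤ : ℕ∞) fun t => G (Fin.cons t u) :=
      fun u => hG.comp (contDiff_cons_left u)
    have hslices : ∀ u : Fin k → ℂ,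
        tsupport (fun t => G (Fin.cons t u)) ⊆ Metric.closedBall 0 r := by
      intro u
      refine closure_minimal (fun t ht => ?_) Metric.isClosed_closedBall
      simpa using hGs ht 0 (Set.mem_univ _)
    have hi : ∀ u : Fin k → ℂ, Integrable (fun y => (v 0 y : ℂ) *
        planeLap (fun t => G (Fin.cons t u)) (W y)) ρ := by
      intro u
      have hΔ := contDiff_planeLap (hslice u)
      have hc : HasCompactSupport fun t => G (Fin.cons t u) :=
        (isCompact_closedBall _ _).of_isClosed_subset (isClosed_tsupport _) (hslices u)
      obtain ⟨K, hK⟩ := (hasCompactSupport_planeLap hc).exists_bound_of_continuous hΔ.continuous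
      exact (hv 0).ofReal.mul_bdd (c := K)
        (hΔ.continuous.measurable.comp hW).aestronglyMeasurable (.of_forall fun y => hK _)
    rw [integral_finsetSum _ fun i _ => (hi _).const_mul _]
    simp only [integral_const_mul, hgreen 0 _ (hslice _) (hslices _)]
    rw [← (Fin.consEquiv fun _ => ι).sum_comp, Fintype.sum_prod_type_right, Finset.mul_sum]
    refine Finset.sum_congr rfl fun i _ => ?_
    rw [pow_succ, mul_assoc]
    congr 2
    refine Finset.sum_congr rfl fun i0 _ => ?_
    congr 1
    funext j
    cases j using Fin.cases <;> rfl

/-! ### Derivative norms -/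

/-- The coordinates with respect to `realBasis`. -/
def realCoord {k : ℕ} (v : Fin k → ℂ) (e : Fin k × Bool) : ℝ :=
  if e.2 then (v e.1).im else (v e.1).re

lemma sum_realCoord_smul {k : ℕ} (v : Fin k → ℂ) :
    ∑ e, realCoord v e • (realBasis e : Fin k → ℂ) = v := by
  funext j
  rw [Fintype.sum_prod_type]
  simp only [Fintype.sum_bool, Finset.sum_apply, Pi.add_apply, Pi.smul_apply, realCoord, realBasis]
  rw [Finset.sum_eq_single j]
  · simp only [if_true, Pi.single_eq_same]
    simp only [Complex.real_smul, Bool.false_eq_true, if_false, mul_one]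
    rw [add_comm, Complex.re_add_im]
  · intro i _ hi
    simp [Pi.single_eq_of_ne hi.symm]
  · simp

lemma abs_realCoord_le {k : ℕ} (v : Fin k → ℂ) (e : Fin k × Bool) : |realCoord v e| ≤ ‖v‖ := by
  unfold realCoord
  split_ifs
  · exact (Complex.abs_im_le_norm _).trans (norm_le_pi_norm v _)
  · exact (Complex.abs_re_le_norm _).trans (norm_le_pi_norm v _)

/-- Expand each argument in the basis `realBasis`. The operator norm refers to the supremum norm
of `ℂ^k`, whence the factor `(2 k)^a`. -/
lemma norm_iteratedFDeriv_le_gradNorm {k : ℕ} (a : ℕ) (G : (Fin k → ℂ) → ℂ) (w : Fin k → ℂ) :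
    ‖iteratedFDeriv ℝ a G w‖ ≤ (2 * k) ^ a * gradNorm a G w := by
  have hg : 0 ≤ gradNorm a G w := Real.sqrt_nonneg _
  refine ContinuousMultilinearMap.opNorm_le_bound (by positivity) fun v => ?_
  have hent : ∀ e : Fin a → Fin k × Bool,
      ‖iteratedFDeriv ℝ a G w (fun s => realBasis (e s))‖ ≤ gradNorm a G w := by
    intro e
    refine Real.le_sqrt_of_sq_le ?_
    exact Finset.single_le_sum
      (f := fun e : Fin a → Fin k × Bool =>
        ‖iteratedFDeriv ℝ a G w (fun s => realBasis (e s))‖ ^ 2)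
      (fun _ _ => sq_nonneg _) (Finset.mem_univ e)
  conv_lhs => rw [show v = fun s => ∑ e, realCoord (v s) e • realBasis e from
    funext fun s => (sum_realCoord_smul (v s)).symm]
  rw [ContinuousMultilinearMap.map_sum]
  refine (norm_sum_le _ _).trans ?_
  calc ∑ e : Fin a → Fin k × Bool, ‖iteratedFDeriv ℝ a G w
          (fun s => realCoord (v s) (e s) • realBasis (e s))‖
      ≤ ∑ _e : Fin a → Fin k × Bool, gradNorm a G w * ∏ s, ‖v s‖ := by
        refine Finset.sum_le_sum fun e _ => ?_
        rw [ContinuousMultilinearMap.map_smul_univ, norm_smul, norm_prod, mul_comm]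
        gcongr
        · exact hent e
        · exact abs_realCoord_le _ _
    _ = _ := by
        simp only [Finset.sum_const, Finset.card_univ, Fintype.card_fun, Fintype.card_prod,
          Fintype.card_fin, Fintype.card_bool, nsmul_eq_mul]
        push_cast
        ring

lemma norm_iteratedFDeriv_comp_affine_le {k l : ℕ} (a : ℕ) {G : (Fin k → ℂ) → ℂ}
    (hG : ContDiff ℝ (⊤ : ℕ∞) G) (σ : Fin k → Fin l) (b : Fin k → ℂ) (w : Fin l → ℂ) :
    ‖iteratedFDeriv ℝ a (fun w => G (fun j => w (σ j) + b j)) w‖ ≤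
      ‖iteratedFDeriv ℝ a G (fun j => w (σ j) + b j)‖ := by
  let L : (Fin l → ℂ) →L[ℝ] (Fin k → ℂ) := ContinuousLinearMap.pi fun j =>
    ContinuousLinearMap.proj (R := ℝ) (φ := fun _ : Fin l => ℂ) (σ j)
  have hL : ‖L‖ ≤ 1 := L.opNorm_le_bound zero_le_one fun w => by
    rw [one_mul]
    exact (pi_norm_le_iff_of_nonneg (norm_nonneg _)).2 fun j => norm_le_pi_norm w (σ j)
  have h1 : ContDiff ℝ (⊤ : ℕ∞) fun u => G (u + b) := hG.comp (contDiff_id.add contDiff_const)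
  have h2 : (fun w : Fin l → ℂ => G (fun j => w (σ j) + b j)) = (fun u => G (u + b)) ∘ L := rfl
  rw [h2, L.iteratedFDeriv_comp_right (contDiff_nat_of_top h1 a) w le_rfl,
    iteratedFDeriv_comp_add_right]
  refine (ContinuousMultilinearMap.norm_compContinuousLinearMap_le _ _).trans ?_
  refine mul_le_of_le_one_right (norm_nonneg _) ?_
  exact Finset.prod_le_one (fun _ _ => norm_nonneg _) fun _ _ => hL

/-! ### Sums over distinct indices -/

/-- The number of classes that remain when the two members of each pair in `E` are identified. -/
def mergeCard {k : ℕ} (E : Finset (Fin k × Fin k)) : ℕ :=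
  Nat.card (Quot fun a b : Fin k => (a, b) ∈ E)

/-- The class of an index when the two members of each pair in `E` are identified. -/
def merge {k : ℕ} (E : Finset (Fin k × Fin k)) (a : Fin k) : Fin (mergeCard E) :=
  Finite.equivFin _ (Quot.mk _ a)

lemma merge_surjective {k : ℕ} (E : Finset (Fin k × Fin k)) : Function.Surjective (merge E) :=
  (Finite.equivFin _).surjective.comp Quot.mk_surjective

lemma mergeCard_le {k : ℕ} (E : Finset (Fin k × Fin k)) : mergeCard E ≤ k := by
  simpa using Fintype.card_le_of_surjective _ (merge_surjective E)

lemma mergeCard_pos {k : ℕ} (hk : 1 ≤ k) (E : Finset (Fin k × Fin k)) : 1 ≤ mergeCard E :=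
  (Nat.zero_le _).trans_lt (merge E ⟨0, hk⟩).2

/-- Tuples that are constant along the pairs in `E` are functions of the classes. -/
def mergeEquiv {k : ℕ} (E : Finset (Fin k × Fin k)) (ι : Type*) :
    (Fin (mergeCard E) → ι) ≃ {i : Fin k → ι // ∀ p ∈ E, i p.1 = i p.2} where
  toFun i := ⟨i ∘ merge E, fun p hp => congrArg (fun q => i (Finite.equivFin _ q)) (Quot.sound hp)⟩
  invFun i := fun b => Quot.lift i.1 (fun a b h => i.2 (a, b) h) ((Finite.equivFin _).symm b)
  left_inv i := by
    funext b
    obtain ⟨a, rfl⟩ := merge_surjective E b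
    simp [merge]
  right_inv i := by
    ext a
    simp [merge]

/-- Inclusion-exclusion for sums over distinct indices: expand
`∏ (1 - 1_{i a = i b})` over all pairs `a ≠ b`. -/
lemma sum_embedding_eq {k : ℕ} {ι : Type*} [Fintype ι] (φ : (Fin k → ι) → ℂ) :
    ∑ i : Fin k ↪ ι, φ i =
      ∑ E ∈ (Finset.univ : Finset (Fin k)).offDiag.powerset,
        (-1) ^ E.card * ∑ i : Fin (mergeCard E) → ι, φ (i ∘ merge E) := by
  classical
  have h1 : ∑ i : Fin k ↪ ι, φ i = ∑ i : Fin k → ι, if Function.Injective i then φ i else 0 := by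
    rw [← Finset.sum_filter, ← (Equiv.subtypeInjectiveEquivEmbedding (Fin k) ι).sum_comp]
    exact (Finset.sum_subtype _ (by simp) φ).symm
  have h2 : ∀ i : Fin k → ι, (if Function.Injective i then φ i else 0) =
      ∑ E ∈ (Finset.univ : Finset (Fin k)).offDiag.powerset,
        (-1) ^ E.card * if ∀ p ∈ E, i p.1 = i p.2 then φ i else 0 := by
    intro i
    have hprod := Finset.prod_add (fun p : Fin k × Fin k => if i p.1 = i p.2 then (-1 : ℂ) else 0)
      (fun _ => 1) (Finset.univ : Finset (Fin k)).offDiag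
    have hl : ∏ p ∈ (Finset.univ : Finset (Fin k)).offDiag,
        ((if i p.1 = i p.2 then (-1 : ℂ) else 0) + 1) = if Function.Injective i then 1 else 0 := by
      split_ifs with hi
      · refine Finset.prod_eq_one fun p hp => ?_
        rw [if_neg fun h => (Finset.mem_offDiag.1 hp).2.2 (hi h), zero_add]
      · simp only [Function.Injective, not_forall] at hi
        obtain ⟨a, b, hab, hne⟩ := hi
        refine Finset.prod_eq_zero (i := (a, b)) (by simp [hne]) ?_
        simp [hab]
    have hr : ∀ E : Finset (Fin k × Fin k), ∏ p ∈ E, (if i p.1 = i p.2 then (-1 : ℂ) else 0) =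
        (-1) ^ E.card * if ∀ p ∈ E, i p.1 = i p.2 then 1 else 0 := by
      intro E
      split_ifs with hE
      · rw [Finset.prod_congr rfl fun p hp => if_pos (hE p hp), Finset.prod_const, mul_one]
      · push Not at hE
        obtain ⟨p, hp, hne⟩ := hE
        rw [mul_zero]
        exact Finset.prod_eq_zero hp (if_neg hne)
    rw [hl] at hprod
    simp only [Finset.prod_const_one, mul_one, hr] at hprod
    calc (if Function.Injective i then φ i else 0)
        = (if Function.Injective i then 1 else 0) * φ i := by split_ifs <;> simp
      _ = _ := by
        rw [hprod, Finset.sum_mul]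
        refine Finset.sum_congr rfl fun E _ => ?_
        split_ifs <;> simp
  rw [h1]
  simp only [h2]
  rw [Finset.sum_comm]
  refine Finset.sum_congr rfl fun E _ => ?_
  rw [← Finset.mul_sum, ← Finset.sum_filter,
    ← (mergeEquiv E ι).symm.sum_comp fun i => φ (i ∘ merge E)]
  congr 1
  rw [Finset.sum_subtype (p := fun i : Fin k → ι => ∀ p ∈ E, i p.1 = i p.2) _ (by simp) φ]
  refine Finset.sum_congr rfl fun i _ => ?_
  congr 1
  exact (congrArg Subtype.val ((mergeEquiv E ι).apply_symm_apply i)).symm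

/-- The sum of `G (ζ_{i_1} - c_1, …, ζ_{i_l} - c_l)` over all tuples of indices of zeros of `p`,
repetitions included. -/
def fullSum {l : ℕ} (G : (Fin l → ℂ) → ℂ) (c : Fin l → ℂ) (p : ℂ[X]) : ℂ :=
  ∑ i : Fin l → p.roots, G fun j => ((i j : p.roots) : ℂ) - c j

/-- The restriction of `G` to the diagonal on which the members of each pair in `E` coincide,
recentred at one representative of each class. -/
def diagRestrict {k : ℕ} (E : Finset (Fin k × Fin k)) (z : Fin k → ℂ) (G : (Fin k → ℂ) → ℂ)
    (w : Fin (mergeCard E) → ℂ) : ℂ :=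
  G fun j => w (merge E j) + (z (Function.surjInv (merge_surjective E) (merge E j)) - z j)

/-- A sum over tuples of distinct zeros is an alternating sum of sums over all tuples. -/
lemma sum_embedding_roots_eq {k : ℕ} (G : (Fin k → ℂ) → ℂ) (z : Fin k → ℂ) (p : ℂ[X]) :
    ∑ i : Fin k ↪ p.roots, G (fun j => ((i j : p.roots) : ℂ) - z j) =
      ∑ E ∈ (Finset.univ : Finset (Fin k)).offDiag.powerset, (-1) ^ E.card *
        fullSum (diagRestrict E z G) (fun b => z (Function.surjInv (merge_surjective E) b)) p := by
  rw [sum_embedding_eq fun i : Fin k → p.roots => G fun j => ((i j : p.roots) : ℂ) - z j]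
  refine Finset.sum_congr rfl fun E _ => ?_
  congr 1
  refine Finset.sum_congr rfl fun i _ => ?_
  unfold diagRestrict
  congr 1
  funext j
  simp only [Function.comp]
  ring

lemma contDiff_diagRestrict {k : ℕ} (E : Finset (Fin k × Fin k)) (z : Fin k → ℂ)
    {G : (Fin k → ℂ) → ℂ} (hG : ContDiff ℝ (⊤ : ℕ∞) G) :
    ContDiff ℝ (⊤ : ℕ∞) (diagRestrict E z G) :=
  hG.comp <| contDiff_pi.2 fun j => (contDiff_apply ℝ ℂ (merge E j)).add contDiff_const

lemma support_diagRestrict {k : ℕ} (E : Finset (Fin k × Fin k)) (z : Fin k → ℂ)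
    {G : (Fin k → ℂ) → ℂ} {r : ℝ}
    (hG : Function.support G ⊆ Set.pi Set.univ fun _ => Metric.ball (0 : ℂ) r) :
    Function.support (diagRestrict E z G) ⊆ Set.pi Set.univ fun _ => Metric.closedBall (0 : ℂ) r := by
  intro w hw b _
  have h := hG hw (Function.surjInv (merge_surjective E) b) (Set.mem_univ _)
  simp only [Function.surjInv_eq, sub_self, add_zero] at h
  exact Metric.ball_subset_closedBall h

lemma norm_iteratedFDeriv_diagRestrict_le {k : ℕ} (E : Finset (Fin k × Fin k)) (z : Fin k → ℂ)
    {G : (Fin k → ℂ) → ℂ} (hG : ContDiff ℝ (⊤ : ℕ∞) G) {a : ℕ} {M : ℝ}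
    (hM : ∀ w, gradNorm a G w ≤ M) (w : Fin (mergeCard E) → ℂ) :
    ‖iteratedFDeriv ℝ a (diagRestrict E z G) w‖ ≤ (2 * k) ^ a * M := by
  refine (norm_iteratedFDeriv_comp_affine_le a hG (merge E) _ w).trans ?_
  refine (norm_iteratedFDeriv_le_gradNorm _ _ _).trans ?_
  gcongr
  exact hM _

/-! ### Distant zeros -/

/-- The logarithm of `|1 + x|` agrees with `Re x` to second order. -/
lemma abs_log_norm_one_add_sub_re_le {x : ℂ} (hx : ‖x‖ ≤ 1 / 2) :
    |Real.log ‖1 + x‖ - x.re| ≤ ‖x‖ ^ 2 := by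
  have h := Complex.norm_log_one_add_sub_self_le (z := x) (by linarith)
  have h1 : (1 - ‖x‖)⁻¹ ≤ 2 := by
    rw [inv_le_comm₀ (by linarith) (by norm_num)]; linarith
  have h2 : |(Complex.log (1 + x) - x).re| ≤ ‖Complex.log (1 + x) - x‖ :=
    Complex.abs_re_le_norm _
  rw [Complex.sub_re, Complex.log_re] at h2
  refine h2.trans (h.trans ?_)
  have := mul_le_mul_of_nonneg_left h1 (sq_nonneg ‖x‖)
  linarith

lemma log_norm_add_eq {s b : ℂ} (hs : s ≠ 0) (hb : ‖b * s⁻¹‖ ≤ 1 / 2) :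
    Real.log ‖s + b‖ = Real.log ‖s‖ + Real.log ‖1 + b * s⁻¹‖ := by
  have h1 : 0 < ‖1 + b * s⁻¹‖ := by
    have := norm_sub_norm_le (1 : ℂ) (-(b * s⁻¹))
    rw [norm_neg, norm_one, sub_neg_eq_add] at this
    linarith
  rw [← Real.log_mul (norm_ne_zero_iff.2 hs) h1.ne', ← norm_mul]
  congr 2
  field_simp

/-- With `s = y - ζ`, each of the four logarithms is `log |s| + log |1 + b / s|` for a bounded `b`.
The residual annihilates the affine part of the expansion in `b / s`. -/
lemma abs_residual_log_le_of_ne {ζ w y : ℂ} (hs : y - ζ ≠ 0) {r : ℝ}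
    (hr : ‖w - y‖ ≤ r) (haq : ‖(w - y) * (y - ζ)⁻¹‖ ≤ 1 / 2) (hq : ‖(y - ζ)⁻¹‖ ≤ 1 / 2) :
    |residual (fun w => Real.log ‖w - ζ‖) (w, y)| ≤ (r ^ 2 + 2 * r) * ‖(y - ζ)⁻¹‖ ^ 2 := by
  have e0 := log_norm_add_eq hs haq
  have e1 := log_norm_add_eq (b := 1) hs (by simpa using hq)
  have hiq : ‖Complex.I * (y - ζ)⁻¹‖ ≤ 1 / 2 := by simpa using hq
  have e2 := log_norm_add_eq hs hiq
  rw [one_mul] at e1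
  have n0 : y - ζ + (w - y) = w - ζ := by ring
  have n1 : y - ζ + 1 = y + 1 - ζ := by ring
  have n2 : y - ζ + Complex.I = y + Complex.I - ζ := by ring
  rw [n0] at e0
  rw [n1] at e1
  rw [n2] at e2
  rw [residual_eq]
  dsimp only
  rw [e0, e1, e2]
  generalize (y - ζ)⁻¹ = q at *
  generalize w - y = a at *
  have b0 := abs_log_norm_one_add_sub_re_le haq
  have b1 := abs_log_norm_one_add_sub_re_le hq
  have b2 := abs_log_norm_one_add_sub_re_le hiq
  rw [norm_mul] at b0
  rw [norm_mul, Complex.norm_I, one_mul] at b2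
  have are := (Complex.abs_re_le_norm a).trans hr
  have aim := (Complex.abs_im_le_norm a).trans hr
  have hr0 : 0 ≤ r := (norm_nonneg a).trans hr
  have t1 : |a.re * (Real.log ‖1 + q‖ - q.re)| ≤ r * ‖q‖ ^ 2 := by
    rw [abs_mul]; exact mul_le_mul are b1 (abs_nonneg _) hr0
  have t2 : |a.im * (Real.log ‖1 + Complex.I * q‖ - (Complex.I * q).re)| ≤ r * ‖q‖ ^ 2 := by
    rw [abs_mul]; exact mul_le_mul aim b2 (abs_nonneg _) hr0
  have t0 : |Real.log ‖1 + a * q‖ - (a * q).re| ≤ r ^ 2 * ‖q‖ ^ 2 := by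
    refine b0.trans ?_
    rw [mul_pow]
    exact mul_le_mul_of_nonneg_right (pow_le_pow_left₀ (norm_nonneg _) hr 2) (sq_nonneg _)
  have key : ∀ S : ℝ, S + Real.log ‖1 + a * q‖ + -(1 - a.re - a.im) * S
        + -a.re * (S + Real.log ‖1 + q‖) + -a.im * (S + Real.log ‖1 + Complex.I * q‖) =
      (Real.log ‖1 + a * q‖ - (a * q).re) - a.re * (Real.log ‖1 + q‖ - q.re)
        - a.im * (Real.log ‖1 + Complex.I * q‖ - (Complex.I * q).re) := by
    intro S
    rw [Complex.mul_re, Complex.mul_re, Complex.I_re, Complex.I_im]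
    ring
  rw [key]
  refine (abs_sub _ _).trans ?_
  refine (add_le_add (abs_sub _ _) le_rfl).trans ?_
  linarith

/-- Affine interpolation of `log |w - ζ|` has an error of second order in `1 / |ζ|`. -/
lemma abs_residual_log_le {r : ℝ} (hr : 1 ≤ r) {ζ : ℂ} (hζ : 8 * r ≤ ‖ζ‖) {x : ℂ × ℂ}
    (h1 : ‖x.1‖ ≤ r) (h2 : ‖x.2‖ ≤ r) :
    |residual (fun w => Real.log ‖w - ζ‖) x| ≤ 16 * r ^ 2 * (‖ζ‖ ^ 2)⁻¹ := by
  obtain ⟨w, y⟩ := x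
  simp only at h1 h2
  have hζ0 : 0 < ‖ζ‖ := by linarith
  have hsn : 7 / 8 * ‖ζ‖ ≤ ‖y - ζ‖ := by
    have := norm_sub_norm_le ζ y
    rw [norm_sub_rev] at this
    linarith
  have hs0 : 0 < ‖y - ζ‖ := by linarith
  have hqn : ‖(y - ζ)⁻¹‖ ≤ 8 / 7 * ‖ζ‖⁻¹ := by
    rw [norm_inv]
    calc ‖y - ζ‖⁻¹ ≤ (7 / 8 * ‖ζ‖)⁻¹ := by gcongr
      _ = _ := by rw [mul_inv]; norm_num
  have hζi : ‖ζ‖⁻¹ ≤ (8 * r)⁻¹ := by gcongr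
  have hri : (8 * r)⁻¹ * r = 1 / 8 := by field_simp
  have hqr : ‖(y - ζ)⁻¹‖ * r ≤ 1 / 7 := by
    calc ‖(y - ζ)⁻¹‖ * r ≤ (8 / 7 * (8 * r)⁻¹) * r := by gcongr; linarith
      _ = 1 / 7 := by rw [mul_assoc, hri]; norm_num
  have han : ‖w - y‖ ≤ 2 * r := (norm_sub_le _ _).trans (by linarith)
  have hq1 : ‖(y - ζ)⁻¹‖ ≤ 1 / 2 :=
    (le_mul_of_one_le_right (norm_nonneg _) hr).trans (by linarith)
  have haq : ‖(w - y) * (y - ζ)⁻¹‖ ≤ 1 / 2 := by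
    rw [norm_mul]
    have := mul_le_mul_of_nonneg_right han (norm_nonneg (y - ζ)⁻¹)
    linarith
  refine (abs_residual_log_le_of_ne (norm_pos_iff.1 hs0) han haq hq1).trans ?_
  have tq : ‖(y - ζ)⁻¹‖ ^ 2 ≤ 2 * (‖ζ‖ ^ 2)⁻¹ := by
    calc ‖(y - ζ)⁻¹‖ ^ 2 ≤ (8 / 7 * ‖ζ‖⁻¹) ^ 2 := by gcongr
      _ = 64 / 49 * (‖ζ‖ ^ 2)⁻¹ := by rw [mul_pow, inv_pow]; norm_num
      _ ≤ _ := by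
        have : 0 ≤ (‖ζ‖ ^ 2)⁻¹ := by positivity
        linarith
  have hrr : (2 * r) ^ 2 + 2 * (2 * r) ≤ 8 * r ^ 2 := by nlinarith
  calc _ ≤ (8 * r ^ 2) * (2 * (‖ζ‖ ^ 2)⁻¹) := mul_le_mul hrr tq (sq_nonneg _) (by positivity)
    _ = _ := by ring

/-- A dyadic majorant of the function `x⁻²` on `[R, ∞)`. -/
lemma inv_sq_le_dyadic {R x : ℝ} (hR : 0 < R) (hx : R ≤ x) (L : ℕ) :
    (x ^ 2)⁻¹ ≤ (∑ t ∈ Finset.range L, if x < 2 ^ (t + 1) * R then ((2 ^ t * R) ^ 2)⁻¹ else 0)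
      + ((2 ^ L * R) ^ 2)⁻¹ := by
  induction L with
  | zero => simp only [Finset.range_zero, Finset.sum_empty, zero_add, pow_zero, one_mul]; gcongr
  | succ L ih =>
    rw [Finset.sum_range_succ]
    split_ifs with h
    · have : 0 ≤ ((2 ^ (L + 1) * R) ^ 2)⁻¹ := by positivity
      linarith
    · have h1 : (x ^ 2)⁻¹ ≤ ((2 ^ (L + 1) * R) ^ 2)⁻¹ := by
        have := not_lt.1 h
        gcongr
      have h2 : 0 ≤ ∑ t ∈ Finset.range L,
          if x < 2 ^ (t + 1) * R then ((2 ^ t * R) ^ 2)⁻¹ else 0 :=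
        Finset.sum_nonneg fun t _ => by split_ifs <;> positivity
      linarith

/-- At most `B ρ²` of the points `ζ i` lie in the disk of radius `ρ` about `0`, for each of the
radii `ρ = 2^t R` with `t ≤ L`. -/
def NonClustered {ι : Type*} [Fintype ι] (ζ : ι → ℂ) (B R : ℝ) (L : ℕ) : Prop :=
  ∀ t ≤ L, ((Finset.univ.filter fun i => ‖ζ i‖ < 2 ^ t * R).card : ℝ) ≤ B * (2 ^ t * R) ^ 2

/-- The distant points are counted annulus by annulus: each of the `L` dyadic annuli contributes at
most `4 B`, and the points beyond the last radius at most `1` in total, as there are at most `2 ^ L`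
of them. -/
lemma NonClustered.sum_inv_sq_le {ι : Type*} [Fintype ι] {ζ : ι → ℂ} {B R : ℝ} {L : ℕ}
    (h : NonClustered ζ B R L) (hR : 1 ≤ R) (hL : (Fintype.card ι : ℝ) ≤ 2 ^ L) :
    ∑ i with ¬ ‖ζ i‖ < R, (‖ζ i‖ ^ 2)⁻¹ ≤ 4 * B * L + 1 := by
  have hR0 : 0 < R := by linarith
  calc ∑ i with ¬ ‖ζ i‖ < R, (‖ζ i‖ ^ 2)⁻¹
      ≤ ∑ i with ¬ ‖ζ i‖ < R, ((∑ t ∈ Finset.range L,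
          if ‖ζ i‖ < 2 ^ (t + 1) * R then ((2 ^ t * R) ^ 2)⁻¹ else 0) + ((2 ^ L * R) ^ 2)⁻¹) :=
        Finset.sum_le_sum fun i hi =>
          inv_sq_le_dyadic hR0 (not_lt.1 (Finset.mem_filter.1 hi).2) L
    _ ≤ ∑ i, ((∑ t ∈ Finset.range L,
          if ‖ζ i‖ < 2 ^ (t + 1) * R then ((2 ^ t * R) ^ 2)⁻¹ else 0) + ((2 ^ L * R) ^ 2)⁻¹) :=
        Finset.sum_le_sum_of_subset_of_nonneg (Finset.filter_subset _ _) fun i _ _ =>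
          add_nonneg (Finset.sum_nonneg fun t _ => by split_ifs <;> positivity) (by positivity)
    _ = (∑ t ∈ Finset.range L, ((Finset.univ.filter fun i => ‖ζ i‖ < 2 ^ (t + 1) * R).card : ℝ) *
          ((2 ^ t * R) ^ 2)⁻¹) + Fintype.card ι * ((2 ^ L * R) ^ 2)⁻¹ := by
        rw [Finset.sum_add_distrib, Finset.sum_comm]
        congr 1
        · refine Finset.sum_congr rfl fun t _ => ?_
          rw [← Finset.sum_filter, Finset.sum_const, nsmul_eq_mul]
        · rw [Finset.sum_const, nsmul_eq_mul, Finset.card_univ]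
    _ ≤ (∑ t ∈ Finset.range L, 4 * B) + 1 := by
        refine add_le_add (Finset.sum_le_sum fun t ht => ?_) ?_
        · have h1 := h (t + 1) (Finset.mem_range.1 ht)
          calc _ ≤ B * (2 ^ (t + 1) * R) ^ 2 * ((2 ^ t * R) ^ 2)⁻¹ := by gcongr
            _ = 4 * B := by rw [pow_succ]; field_simp; ring
        · rw [← div_eq_mul_inv, div_le_one (by positivity)]
          have h2 : (1 : ℝ) ≤ 2 ^ L := one_le_pow₀ (by norm_num)
          have h3 : (2 : ℝ) ^ L ≤ 2 ^ L * R := le_mul_of_one_le_right (by positivity) hR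
          nlinarith
    _ = _ := by rw [Finset.sum_const, Finset.card_range, nsmul_eq_mul]; ring

/-! ### Moments of the residual -/

lemma ae_node {r : ℝ} {q : ℂ → Prop} (h : ∀ᵐ w : ℂ, q w) :
    ∀ᵐ x ∂((diskMeasure r).prod (diskMeasure r)), ∀ i, q (node x i) := by
  have hs : ∀ c : ℂ, ∀ᵐ w ∂(diskMeasure r), q (w + c) := fun c =>
    (diskMeasure_absolutelyContinuous r).ae_le
      ((measurePreserving_add_right (volume : Measure ℂ) c).quasiMeasurePreserving.ae h)
  have h0 : ∀ᵐ w ∂(diskMeasure r), q w := (diskMeasure_absolutelyContinuous r).ae_le h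
  rw [ae_all_iff]
  intro i
  fin_cases i
  · exact Measure.quasiMeasurePreserving_fst.ae h0
  · exact Measure.quasiMeasurePreserving_snd.ae h0
  · exact Measure.quasiMeasurePreserving_snd.ae (hs 1)
  · exact Measure.quasiMeasurePreserving_snd.ae (hs Complex.I)

/-- The weights add up to zero, so the residual of a constant vanishes. -/
lemma residual_const_add_sum {ι : Type*} [Fintype ι] (u : ι → ℂ → ℝ) (c : ℝ) {U : ℂ → ℝ}
    {x : ℂ × ℂ} (h : ∀ q, U (node x q) = c + ∑ i, u i (node x q)) :
    residual U x = ∑ i, residual (u i) x := by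
  have hw : ∑ q, weight x q = 0 := by
    simp [Fin.sum_univ_four, weight]; ring
  simp only [residual, h, mul_add, Finset.sum_add_distrib, ← Finset.sum_mul, hw, zero_mul, zero_add,
    Finset.mul_sum]
  exact Finset.sum_comm

/-- The nodes are uniformly distributed in translates of the disk, and `|w| + |w|⁻¹` is locally
integrable. The sum `t + t⁻¹` is used as a majorant of powers of `log t`. -/
lemma exists_integral_node_le {r : ℝ} (hr : 1 ≤ r) : ∃ K : ℝ, 0 ≤ K ∧ ∀ ζ : ℂ, ‖ζ‖ ≤ 8 * r →
    ∀ q : Fin 4, Integrable (fun x => ‖node x q - ζ‖ + ‖node x q - ζ‖⁻¹)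
        ((diskMeasure r).prod (diskMeasure r)) ∧
      ∫ x, (‖node x q - ζ‖ + ‖node x q - ζ‖⁻¹) ∂((diskMeasure r).prod (diskMeasure r)) ≤ K := by
  have hr0 : 0 < r := by linarith
  have := isProbabilityMeasure_diskMeasure hr0
  have hloc : ∀ b : ℂ, LocallyIntegrable fun w : ℂ => ‖w - b‖ + ‖w - b‖⁻¹ := fun b =>
    (Continuous.locallyIntegrable (by fun_prop)).add (locallyIntegrable_inv_norm_sub b)
  let K : ℝ := (diskArea r)⁻¹ * ∫ w in Metric.closedBall (0 : ℂ) (10 * r), (‖w‖ + ‖w‖⁻¹)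
  have hone : ∀ b : ℂ, ‖b‖ ≤ 9 * r → ∫ w, (‖w - b‖ + ‖w - b‖⁻¹) ∂(diskMeasure r) ≤ K := by
    intro b hb
    rw [integral_diskMeasure, smul_eq_mul]
    refine mul_le_mul_of_nonneg_left ?_ (inv_nonneg.2 (diskArea_pos hr0).le)
    have hmp := measurePreserving_sub_right (volume : Measure ℂ) b
    have hpre : Metric.closedBall 0 r ⊆ (fun w => w - b) ⁻¹' Metric.closedBall 0 (10 * r) := by
      intro w hw
      simp only [Set.mem_preimage, Metric.mem_closedBall, dist_zero_right] at hw ⊢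
      exact (norm_sub_le _ _).trans (by linarith)
    have h0 := hloc 0
    simp only [sub_zero] at h0
    rw [← hmp.setIntegral_preimage_emb (MeasurableEquiv.subRight b).measurableEmbedding
      (fun w => ‖w‖ + ‖w‖⁻¹)]
    refine setIntegral_mono_set ?_ (.of_forall fun w => by positivity)
      hpre.eventuallyLE
    exact (hmp.integrableOn_comp_preimage (MeasurableEquiv.subRight b).measurableEmbedding
      (f := fun w : ℂ => ‖w‖ + ‖w‖⁻¹)).2
      (h0.integrableOn_isCompact (isCompact_closedBall _ _))
  have hint : ∀ b : ℂ, Integrable (fun w : ℂ => ‖w - b‖ + ‖w - b‖⁻¹) (diskMeasure r) := fun b =>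
    integrable_diskMeasure hr0 (hloc b)
  refine ⟨K, ?_, fun ζ hζ q => ?_⟩
  · exact mul_nonneg (inv_nonneg.2 (diskArea_pos hr0).le) (integral_nonneg fun w => by positivity)
  have hcase : ∀ b : ℂ, ‖b‖ ≤ 9 * r →
      (Integrable (fun x : ℂ × ℂ => ‖x.1 - b‖ + ‖x.1 - b‖⁻¹)
        ((diskMeasure r).prod (diskMeasure r)) ∧
      ∫ x, (‖x.1 - b‖ + ‖x.1 - b‖⁻¹) ∂((diskMeasure r).prod (diskMeasure r)) ≤ K) ∧
      (Integrable (fun x : ℂ × ℂ => ‖x.2 - b‖ + ‖x.2 - b‖⁻¹)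
        ((diskMeasure r).prod (diskMeasure r)) ∧
      ∫ x, (‖x.2 - b‖ + ‖x.2 - b‖⁻¹) ∂((diskMeasure r).prod (diskMeasure r)) ≤ K) := by
    intro b hb
    refine ⟨⟨(hint b).comp_fst _, ?_⟩, ⟨(hint b).comp_snd _, ?_⟩⟩
    · rw [integral_fun_fst (fun w : ℂ => ‖w - b‖ + ‖w - b‖⁻¹)]
      simpa using hone b hb
    · rw [integral_fun_snd (fun w : ℂ => ‖w - b‖ + ‖w - b‖⁻¹)]
      simpa using hone b hb
  have n1 : ‖ζ - 1‖ ≤ 9 * r := (norm_sub_le _ _).trans (by rw [norm_one]; linarith)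
  have n2 : ‖ζ - Complex.I‖ ≤ 9 * r := (norm_sub_le _ _).trans (by rw [Complex.norm_I]; linarith)
  have s1 : ∀ y : ℂ, y + 1 - ζ = y - (ζ - 1) := fun y => by ring
  have s2 : ∀ y : ℂ, y + Complex.I - ζ = y - (ζ - Complex.I) := fun y => by ring
  fin_cases q
  · exact (hcase ζ (by linarith)).1
  · exact (hcase ζ (by linarith)).2
  · simpa [node, s1] using (hcase _ n1).2
  · simpa [node, s2] using (hcase _ n2).2

lemma abs_log_pow_le {p : ℕ} (hp : p ≠ 0) {t : ℝ} (ht : 0 ≤ t) :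
    |Real.log t| ^ p ≤ p.factorial * (t + t⁻¹) := by
  rcases ht.eq_or_lt with rfl | ht
  · simp [hp]
  · have h := Real.pow_div_factorial_le_exp |Real.log t| (abs_nonneg _) p
    rw [div_le_iff₀ (by positivity)] at h
    have h2 : Real.exp |Real.log t| ≤ t + t⁻¹ := by
      have := inv_pos.2 ht
      rcases abs_choice (Real.log t) with h | h <;> rw [h]
      · rw [Real.exp_log ht]; linarith
      · rw [Real.exp_neg, Real.exp_log ht]; linarith
    calc _ ≤ _ := h
      _ ≤ (t + t⁻¹) * p.factorial := by gcongr
      _ = _ := mul_comm _ _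

/-- The residual of `log |p|` is bounded by the logarithms of the distances from the nodes to the
nearby zeros, and by the inverse squares of the moduli of the distant zeros. -/
lemma ae_abs_residual_le {r : ℝ} (hr : 1 ≤ r) {ι : Type*} [Fintype ι] (ζ : ι → ℂ) (c : ℝ)
    {U : ℂ → ℝ} (hU : ∀ᵐ w, U w = c + ∑ i, Real.log ‖w - ζ i‖) :
    ∀ᵐ x ∂((diskMeasure r).prod (diskMeasure r)), |residual U x| ≤
      5 * r * ∑ e ∈ (Finset.univ.filter fun i => ‖ζ i‖ < 8 * r) ×ˢ (Finset.univ : Finset (Fin 4)),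
        |Real.log ‖node x e.2 - ζ e.1‖| +
      16 * r ^ 2 * ∑ i with ¬ ‖ζ i‖ < 8 * r, (‖ζ i‖ ^ 2)⁻¹ := by
  filter_upwards [ae_node hU, ae_diskMeasure_prod_mem r] with x hx hb
  rw [residual_const_add_sum (fun i w => Real.log ‖w - ζ i‖) c hx]
  refine (Finset.abs_sum_le_sum_abs _ _).trans ?_
  rw [← Finset.sum_filter_add_sum_filter_not Finset.univ (fun i => ‖ζ i‖ < 8 * r)]
  refine add_le_add ?_ ?_
  · rw [Finset.sum_product, Finset.mul_sum]
    refine Finset.sum_le_sum fun i _ => ?_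
    rw [Finset.mul_sum]
    refine (Finset.abs_sum_le_sum_abs _ _).trans (Finset.sum_le_sum fun q _ => ?_)
    rw [abs_mul]
    gcongr
    exact abs_weight_le hr hb.1 hb.2 q
  · rw [Finset.mul_sum]
    exact Finset.sum_le_sum fun i hi =>
      abs_residual_log_le hr (not_lt.1 (Finset.mem_filter.1 hi).2) hb.1 hb.2

/-- All moments of the residual of `log |p|` are bounded, after division by a bound `D` for the
number of nearby zeros and for the influence of the distant ones. -/
lemma exists_moment_le {r : ℝ} (hr : 1 ≤ r) (p : ℕ) : ∃ K : ℝ,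
    ∀ (ι : Type) [Fintype ι] (ζ : ι → ℂ) (c : ℝ) (U : ℂ → ℝ) (B D : ℝ) (L : ℕ),
      LocallyIntegrable U → (∀ᵐ w, U w = c + ∑ i, Real.log ‖w - ζ i‖) →
      0 < B → NonClustered ζ B (8 * r) L → (Fintype.card ι : ℝ) ≤ 2 ^ L →
      5 * r * (B * (8 * r) ^ 2) ≤ D → 16 * r ^ 2 * (4 * B * L + 1) ≤ D →
      Integrable (fun x => (1 + |residual U x| / D) ^ (p + 1))
        ((diskMeasure r).prod (diskMeasure r)) ∧
      ∫ x, (1 + |residual U x| / D) ^ (p + 1) ∂((diskMeasure r).prod (diskMeasure r)) ≤ K := by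
  obtain ⟨K, hK0, hK⟩ := exists_integral_node_le hr
  have hr0 : 0 < r := by linarith
  have := isProbabilityMeasure_diskMeasure hr0
  refine ⟨2 ^ p * (2 ^ (p + 1) + 4 ^ (p + 1) * (p + 1).factorial * K), ?_⟩
  intro ι _ ζ c U B D L hloc hU hB hnc hcard hD1 hD2
  set N : ℝ := B * (8 * r) ^ 2 with hN
  have hN0 : 0 < N := by positivity
  have hD0 : 0 < D := lt_of_lt_of_le (by positivity) hD1
  set s := (Finset.univ.filter fun i => ‖ζ i‖ < 8 * r) ×ˢ (Finset.univ : Finset (Fin 4)) with hs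
  have hscard : (s.card : ℝ) ≤ 4 * N := by
    have h0 := hnc 0 (Nat.zero_le _)
    rw [pow_zero, one_mul] at h0
    rw [hs, Finset.card_product, Finset.card_univ, Fintype.card_fin]
    push_cast
    linarith
  have hsζ : ∀ e ∈ s, ‖ζ e.1‖ ≤ 8 * r := fun e he =>
    (Finset.mem_filter.1 (Finset.mem_product.1 he).1).2.le
  let h : ι × Fin 4 → ℂ × ℂ → ℝ := fun e x => ‖node x e.2 - ζ e.1‖ + ‖node x e.2 - ζ e.1‖⁻¹
  let g : ℂ × ℂ → ℝ := fun x => 2 ^ p * (2 ^ (p + 1) +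
    (4 * N) ^ p * (N ^ (p + 1))⁻¹ * (p + 1).factorial * ∑ e ∈ s, h e x)
  have hgint : Integrable g ((diskMeasure r).prod (diskMeasure r)) :=
    ((integrable_const _).add ((integrable_finsetSum _ fun e he =>
      (hK _ (hsζ e he) e.2).1).const_mul _)).const_mul _
  have hle : ∀ᵐ x ∂((diskMeasure r).prod (diskMeasure r)),
      (1 + |residual U x| / D) ^ (p + 1) ≤ g x := by
    filter_upwards [ae_abs_residual_le hr ζ c hU] with x hx
    set S := ∑ e ∈ s, |Real.log ‖node x e.2 - ζ e.1‖| with hS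
    have hS0 : 0 ≤ S := Finset.sum_nonneg fun _ _ => abs_nonneg _
    have hfar := hnc.sum_inv_sq_le (by linarith) hcard
    have h1 : |residual U x| / D ≤ S / N + 1 := by
      rw [div_le_iff₀ hD0]
      refine hx.trans ?_
      have e1 : 5 * r * S ≤ S / N * D := by
        calc 5 * r * S = S / N * (5 * r * N) := by field_simp
          _ ≤ S / N * D := by gcongr
      have e2 : 16 * r ^ 2 * ∑ i with ¬ ‖ζ i‖ < 8 * r, (‖ζ i‖ ^ 2)⁻¹ ≤ D :=
        (mul_le_mul_of_nonneg_left hfar (by positivity)).trans hD2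
      linarith
    have h2 : S ^ (p + 1) ≤ (4 * N) ^ p * ((p + 1).factorial * ∑ e ∈ s, h e x) := by
      refine (pow_sum_le_card_mul_sum_pow (fun _ _ => abs_nonneg _) p).trans ?_
      refine mul_le_mul (pow_le_pow_left₀ (Nat.cast_nonneg _) hscard p) ?_
        (Finset.sum_nonneg fun _ _ => by positivity) (by positivity)
      rw [Finset.mul_sum]
      exact Finset.sum_le_sum fun e _ => abs_log_pow_le (Nat.succ_ne_zero p) (norm_nonneg _)
    calc (1 + |residual U x| / D) ^ (p + 1) ≤ (2 + S / N) ^ (p + 1) := by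
          have : 0 ≤ |residual U x| / D := by positivity
          exact pow_le_pow_left₀ (by linarith) (by linarith) _
      _ ≤ 2 ^ p * (2 ^ (p + 1) + (S / N) ^ (p + 1)) := by
          have := add_pow_le (zero_le_two : (0:ℝ) ≤ 2) (by positivity : 0 ≤ S / N) (p + 1)
          simpa using this
      _ ≤ g x := by
          simp only [g]
          gcongr
          rw [div_pow, div_eq_mul_inv]
          calc S ^ (p + 1) * (N ^ (p + 1))⁻¹ ≤
                ((4 * N) ^ p * ((p + 1).factorial * ∑ e ∈ s, h e x)) * (N ^ (p + 1))⁻¹ := by gcongr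
            _ = _ := by ring
  have hmeas : AEStronglyMeasurable (fun x => (1 + |residual U x| / D) ^ (p + 1))
      ((diskMeasure r).prod (diskMeasure r)) := by
    have h1 := (integrable_residual hr hloc).aestronglyMeasurable
    have hc : Continuous fun t : ℝ => (1 + |t| / D) ^ (p + 1) := by fun_prop
    exact hc.comp_aestronglyMeasurable h1
  have hint : Integrable (fun x => (1 + |residual U x| / D) ^ (p + 1))
      ((diskMeasure r).prod (diskMeasure r)) := by
    refine hgint.mono' hmeas ?_
    filter_upwards [hle] with x hx
    rwa [Real.norm_of_nonneg (by positivity)]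
  refine ⟨hint, (integral_mono_ae hint hgint hle).trans ?_⟩
  have hgi : ∫ x, g x ∂((diskMeasure r).prod (diskMeasure r)) = 2 ^ p * (2 ^ (p + 1) +
      (4 * N) ^ p * (N ^ (p + 1))⁻¹ * (p + 1).factorial *
        ∑ e ∈ s, ∫ x, h e x ∂((diskMeasure r).prod (diskMeasure r))) := by
    simp only [g]
    rw [integral_const_mul, integral_add (integrable_const _), integral_const_mul,
      integral_finsetSum _ fun e he => (hK _ (hsζ e he) e.2).1]
    · simp [h]
    · exact (integrable_finsetSum _ fun e he => (hK _ (hsζ e he) e.2).1).const_mul _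
  rw [hgi]
  have hsum : ∑ e ∈ s, ∫ x, h e x ∂((diskMeasure r).prod (diskMeasure r)) ≤ 4 * N * K := by
    calc _ ≤ ∑ _e ∈ s, K := Finset.sum_le_sum fun e he => (hK _ (hsζ e he) e.2).2
      _ = s.card * K := by rw [Finset.sum_const, nsmul_eq_mul]
      _ ≤ _ := by gcongr
  refine mul_le_mul_of_nonneg_left (add_le_add le_rfl ?_) (by positivity)
  refine (mul_le_mul_of_nonneg_left hsum (by positivity)).trans_eq ?_
  rw [mul_pow, pow_succ N, pow_succ (4 : ℝ)]
  field_simp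

/-! ### Monte Carlo sampling -/

lemma integral_abs_le_sqrt {S : Type*} [MeasurableSpace S] {ρ : Measure S} [IsProbabilityMeasure ρ]
    {Y : S → ℝ} (hY : MemLp Y 2 ρ) : ∫ x, |Y x| ∂ρ ≤ Real.sqrt (∫ x, Y x ^ 2 ∂ρ) := by
  have h := ProbabilityTheory.variance_nonneg |Y| ρ
  rw [ProbabilityTheory.variance_eq_sub hY.abs] at h
  refine Real.le_sqrt_of_sq_le ?_
  have h2 : ∫ x, (|Y| ^ 2) x ∂ρ = ∫ x, Y x ^ 2 ∂ρ := by simp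
  rw [h2] at h
  have h3 : ∫ x, |Y| x ∂ρ = ∫ x, |Y x| ∂ρ := rfl
  rw [h3] at h
  linarith

lemma integral_abs_average_sub_le {S : Type*} [MeasurableSpace S] {ρ : Measure S}
    [IsProbabilityMeasure ρ] {W : S → ℝ} (hW : Measurable W) {b : ℝ} (hb : ∀ x, |W x| ≤ b)
    {m : ℕ} (hm : 1 ≤ m) :
    ∫ X, |(m : ℝ)⁻¹ * ∑ s, W (X s) - ∫ x, W x ∂ρ| ∂(Measure.pi fun _ : Fin m => ρ) ≤
      b / Real.sqrt m := by
  obtain ⟨x₀⟩ : Nonempty S := ρ.nonempty_of_neZero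
  have hb0 : 0 ≤ b := (abs_nonneg _).trans (hb x₀)
  have hm0 : (0 : ℝ) < m := by exact_mod_cast hm
  have hmem : MemLp W 2 ρ := MemLp.of_bound hW.aestronglyMeasurable b (.of_forall hb)
  have hmean : ∀ s : Fin m, ∫ X : Fin m → S, W (X s) ∂(Measure.pi fun _ : Fin m => ρ) =
      ∫ x, W x ∂ρ := fun s =>
    integral_comp_eval (μ := fun _ : Fin m => ρ) (i := s) hW.aestronglyMeasurable
  have hbd : ∀ X : Fin m → S, |∑ s, W (X s)| ≤ m * b := fun X =>
    (Finset.abs_sum_le_sum_abs _ _).trans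
      ((Finset.sum_le_sum fun s _ => hb (X s)).trans_eq (by simp))
  have hsm : Measurable fun X : Fin m → S => ∑ s, W (X s) := by fun_prop
  have hsmem : MemLp (fun X : Fin m → S => ∑ s, W (X s)) 2 (Measure.pi fun _ : Fin m => ρ) :=
    MemLp.of_bound hsm.aestronglyMeasurable _ (.of_forall hbd)
  have hsint : ∫ X : Fin m → S, ∑ s, W (X s) ∂(Measure.pi fun _ : Fin m => ρ) =
      m * ∫ x, W x ∂ρ := by
    rw [integral_finsetSum]
    · simp [hmean]
    · intro s _
      exact Integrable.of_bound (hW.comp (measurable_pi_apply s)).aestronglyMeasurable b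
        (.of_forall fun X => hb (X s))
  have hvar := ProbabilityTheory.variance_sum_pi (μ := fun _ : Fin m => ρ) (X := fun _ => W)
    (fun _ => hmem)
  have hvar1 : ProbabilityTheory.variance W ρ ≤ b ^ 2 := by
    refine (ProbabilityTheory.variance_le_expectation_sq hW.aestronglyMeasurable).trans ?_
    calc ∫ x, (W ^ 2) x ∂ρ ≤ ∫ _x, b ^ 2 ∂ρ := by
          refine integral_mono_of_nonneg (.of_forall fun x => sq_nonneg _) (integrable_const _)
            (.of_forall fun x => ?_)
          exact sq_le_sq' (abs_le.1 (hb x)).1 (abs_le.1 (hb x)).2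
      _ = b ^ 2 := by simp
  have hvar2 : ∫ X : Fin m → S, ((m : ℝ)⁻¹ * ∑ s, W (X s) - ∫ x, W x ∂ρ) ^ 2
      ∂(Measure.pi fun _ : Fin m => ρ) ≤ b ^ 2 / m := by
    have h1 : ∀ X : Fin m → S, ((m : ℝ)⁻¹ * ∑ s, W (X s) - ∫ x, W x ∂ρ) ^ 2 =
        ((m : ℝ)⁻¹) ^ 2 * (∑ s, W (X s) - m * ∫ x, W x ∂ρ) ^ 2 := by
      intro X; rw [← mul_pow, mul_sub, ← mul_assoc, inv_mul_cancel₀ hm0.ne', one_mul]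
    have h2 : ∫ X : Fin m → S, (∑ s, W (X s) - m * ∫ x, W x ∂ρ) ^ 2
        ∂(Measure.pi fun _ : Fin m => ρ) ≤ m * b ^ 2 := by
      have hsm' : Measurable (∑ s : Fin m, fun X : Fin m → S => W (X s)) := by
        convert hsm using 1
        funext X
        simp
      rw [ProbabilityTheory.variance_eq_integral hsm'.aemeasurable] at hvar
      simp only [Finset.sum_apply, hsint] at hvar
      rw [hvar]
      calc _ ≤ ∑ _s : Fin m, b ^ 2 := Finset.sum_le_sum fun _ _ => hvar1
        _ = _ := by simp
    simp only [h1]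
    rw [integral_const_mul]
    calc _ ≤ ((m : ℝ)⁻¹) ^ 2 * (m * b ^ 2) := by gcongr
      _ = _ := by field_simp
  have hfmem : MemLp (fun X : Fin m → S => (m : ℝ)⁻¹ * ∑ s, W (X s) - ∫ x, W x ∂ρ) 2
      (Measure.pi fun _ : Fin m => ρ) := (hsmem.const_mul _).sub (memLp_const _)
  refine (integral_abs_le_sqrt hfmem).trans ?_
  refine (Real.sqrt_le_sqrt hvar2).trans_eq ?_
  rw [Real.sqrt_div (sq_nonneg b), Real.sqrt_sq hb0]

/-- The mean of `m` independent samples of a bounded variable is within `O(m ^ (-1/2))` of its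
expectation on average, by the variance of a sum of independent variables. -/
lemma integral_norm_average_sub_le {S : Type*} [MeasurableSpace S] {ρ : Measure S}
    [IsProbabilityMeasure ρ] {W : S → ℂ} (hW : Measurable W) {b : ℝ} (hb : ∀ x, ‖W x‖ ≤ b)
    {m : ℕ} (hm : 1 ≤ m) :
    ∫ X, ‖(m : ℂ)⁻¹ * ∑ s, W (X s) - ∫ x, W x ∂ρ‖ ∂(Measure.pi fun _ : Fin m => ρ) ≤
      2 * b / Real.sqrt m := by
  have hint : Integrable W ρ := Integrable.of_bound hW.aestronglyMeasurable b (.of_forall hb)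
  have hre := integral_abs_average_sub_le (ρ := ρ) (Complex.measurable_re.comp hW)
    (fun x => (Complex.abs_re_le_norm (W x)).trans (hb x)) hm
  have him := integral_abs_average_sub_le (ρ := ρ) (Complex.measurable_im.comp hW)
    (fun x => (Complex.abs_im_le_norm (W x)).trans (hb x)) hm
  have hI : ∀ {V : S → ℝ}, Measurable V → (∀ x, |V x| ≤ b) → Integrable (fun X : Fin m → S =>
      |(m : ℝ)⁻¹ * ∑ s, V (X s) - ∫ x, V x ∂ρ|) (Measure.pi fun _ : Fin m => ρ) := by
    intro V hV hVb
    refine Integrable.abs (Integrable.sub (Integrable.const_mul ?_ _) (integrable_const _))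
    exact integrable_finsetSum _ fun s _ =>
      Integrable.of_bound (hV.comp (measurable_pi_apply s)).aestronglyMeasurable b
        (.of_forall fun X => hVb (X s))
  have hIre := hI (Complex.measurable_re.comp hW)
    (fun x => (Complex.abs_re_le_norm (W x)).trans (hb x))
  have hIim := hI (Complex.measurable_im.comp hW)
    (fun x => (Complex.abs_im_le_norm (W x)).trans (hb x))
  have hcast : (m : ℂ)⁻¹ = (((m : ℝ)⁻¹ : ℝ) : ℂ) := by push_cast; rfl
  calc _ ≤ ∫ X, (|(m : ℝ)⁻¹ * ∑ s, (W (X s)).re - ∫ x, (W x).re ∂ρ| +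
        |(m : ℝ)⁻¹ * ∑ s, (W (X s)).im - ∫ x, (W x).im ∂ρ|) ∂(Measure.pi fun _ : Fin m => ρ) := by
        refine integral_mono_of_nonneg (.of_forall fun X => norm_nonneg _) (hIre.add hIim)
          (.of_forall fun X => ?_)
        have h1 : ∫ x, (W x).re ∂ρ = (∫ x, W x ∂ρ).re := integral_re hint
        have h2 : ∫ x, (W x).im ∂ρ = (∫ x, W x ∂ρ).im := integral_im hint
        refine (Complex.norm_le_abs_re_add_abs_im _).trans_eq ?_
        simp only [hcast, h1, h2, Complex.sub_re, Complex.sub_im, Complex.re_ofReal_mul,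
          Complex.im_ofReal_mul, Complex.re_sum, Complex.im_sum]
    _ ≤ b / Real.sqrt m + b / Real.sqrt m := by
        exact (integral_add hIre hIim).trans_le (add_le_add hre him)
    _ = _ := by ring

/-! ### Truncation -/

/-- A smooth compactly supported function that agrees with the identity on `[-1, 1]`. -/
def trunc (x : ℝ) : ℝ := (⟨1, 2, one_pos, one_lt_two⟩ : ContDiffBump (0 : ℝ)) x * x

lemma contDiff_trunc : ContDiff ℝ (⊤ : ℕ∞) trunc := (ContDiffBump.contDiff _).mul contDiff_id

lemma hasCompactSupport_trunc : HasCompactSupport trunc :=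
  (ContDiffBump.hasCompactSupport _).mul_right

lemma trunc_of_abs_le {x : ℝ} (hx : |x| ≤ 1) : trunc x = x := by
  rw [trunc, ContDiffBump.one_of_mem_closedBall _ (by simpa using hx), one_mul]

lemma abs_trunc_le (x : ℝ) : |trunc x| ≤ |x| := by
  rw [trunc, abs_mul, abs_of_nonneg (ContDiffBump.nonneg _)]
  exact mul_le_of_le_one_left (abs_nonneg _) (ContDiffBump.le_one _)

lemma abs_trunc_le_two (x : ℝ) : |trunc x| ≤ 2 := by
  by_cases hx : |x| ≤ 2
  · exact (abs_trunc_le x).trans hx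
  · rw [trunc, ContDiffBump.zero_of_le_dist _ (by simpa using (not_le.1 hx).le)]
    simp

/-- The rescaled truncation, which agrees with the identity on `[-T, T]`. -/
def truncAt (T x : ℝ) : ℝ := T * trunc (x / T)

lemma truncAt_of_abs_le {T x : ℝ} (hT : 0 < T) (hx : |x| ≤ T) : truncAt T x = x := by
  rw [truncAt, trunc_of_abs_le (by rwa [abs_div, abs_of_pos hT, div_le_one hT])]
  field_simp

lemma abs_truncAt_le {T : ℝ} (hT : 0 < T) (x : ℝ) : |truncAt T x| ≤ |x| := by
  rw [truncAt, abs_mul, abs_of_pos hT]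
  calc T * |trunc (x / T)| ≤ T * |x / T| := mul_le_mul_of_nonneg_left (abs_trunc_le _) hT.le
    _ = |x| := by rw [abs_div, abs_of_pos hT]; field_simp

lemma abs_truncAt_le_two_mul {T : ℝ} (hT : 0 < T) (x : ℝ) : |truncAt T x| ≤ 2 * T := by
  rw [truncAt, abs_mul, abs_of_pos hT, mul_comm]
  exact mul_le_mul_of_nonneg_right (abs_trunc_le_two _) hT.le

lemma continuous_truncAt (T : ℝ) : Continuous (truncAt T) :=
  continuous_const.mul (contDiff_trunc.continuous.comp (continuous_id.div_const T))

/-- A product is changed by truncation only if a factor exceeds `D * T₁`, and there the product is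
small compared with `∏ (1 + |v j| / D) ^ (p + 1)`. -/
lemma abs_prod_sub_prod_truncAt_le {l : ℕ} {D T₁ : ℝ} (hD : 0 < D) (hT₁ : 0 < T₁) (p : ℕ)
    (v : Fin l → ℝ) :
    |∏ j, v j - ∏ j, truncAt (D * T₁) (v j)| ≤
      2 * D ^ l * (T₁ ^ p)⁻¹ * ∏ j, (1 + |v j| / D) ^ (p + 1) := by
  by_cases h : ∀ j, |v j| ≤ D * T₁
  · rw [Finset.prod_congr rfl fun j _ => truncAt_of_abs_le (by positivity) (h j), sub_self, abs_zero]
    positivity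
  · push Not at h
    obtain ⟨j₀, hj₀⟩ := h
    have h1 : |∏ j, v j - ∏ j, truncAt (D * T₁) (v j)| ≤ 2 * ∏ j, |v j| := by
      refine (abs_sub _ _).trans ?_
      rw [Finset.abs_prod, Finset.abs_prod]
      have : ∏ j, |truncAt (D * T₁) (v j)| ≤ ∏ j, |v j| :=
        Finset.prod_le_prod (fun _ _ => abs_nonneg _) fun j _ => abs_truncAt_le (by positivity) _
      linarith
    have h2 : ∏ j, |v j| ≤ D ^ l * ∏ j, (1 + |v j| / D) := by
      have : D ^ l = ∏ _j : Fin l, D := by simp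
      rw [this, ← Finset.prod_mul_distrib]
      refine Finset.prod_le_prod (fun _ _ => abs_nonneg _) fun j _ => ?_
      rw [mul_add, mul_div_cancel₀ _ hD.ne']
      linarith
    have h3 : T₁ ≤ ∏ j, (1 + |v j| / D) := by
      have hone : ∀ j, 1 ≤ 1 + |v j| / D := fun j => by
        have : 0 ≤ |v j| / D := by positivity
        linarith
      have h4 : T₁ ≤ 1 + |v j₀| / D := by
        have : T₁ ≤ |v j₀| / D := by rw [le_div_iff₀ hD, mul_comm]; exact hj₀.le
        linarith
      refine h4.trans ?_
      rw [← Finset.mul_prod_erase _ _ (Finset.mem_univ j₀)]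
      refine le_mul_of_one_le_right (by positivity) ?_
      calc (1 : ℝ) = ∏ j ∈ Finset.univ.erase j₀, 1 := by simp
        _ ≤ _ := Finset.prod_le_prod (fun _ _ => zero_le_one) fun j _ => hone j
    have h5 : 1 ≤ (T₁ ^ p)⁻¹ * (∏ j, (1 + |v j| / D)) ^ p := by
      rw [inv_mul_eq_div, one_le_div (by positivity)]
      gcongr
    rw [Finset.prod_pow, pow_succ]
    have hP : 0 ≤ ∏ j, (1 + |v j| / D) := Finset.prod_nonneg fun j _ => by positivity
    calc _ ≤ 2 * (D ^ l * ∏ j, (1 + |v j| / D)) := h1.trans (by gcongr)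
      _ = 2 * D ^ l * (1 * ∏ j, (1 + |v j| / D)) := by ring
      _ ≤ 2 * D ^ l * (((T₁ ^ p)⁻¹ * (∏ j, (1 + |v j| / D)) ^ p) * ∏ j, (1 + |v j| / D)) := by
        gcongr
      _ = _ := by ring

/-! ### The Monte Carlo estimator of a sum over zeros -/

/-- The law of one sample: independent pairs `(w j, y j)` of uniform points of the disk. -/
def sampleMeasure (r : ℝ) (l : ℕ) : Measure (Fin l → ℂ × ℂ) :=
  Measure.pi fun _ => (diskMeasure r).prod (diskMeasure r)

lemma isProbabilityMeasure_sampleMeasure {r : ℝ} (hr : 0 < r) (l : ℕ) :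
    IsProbabilityMeasure (sampleMeasure r l) := by
  have := isProbabilityMeasure_diskMeasure hr
  unfold sampleMeasure
  infer_instance

/-- The constant by which sampling from the disk scales Green's formula. -/
def greenConst (r : ℝ) : ℝ := 2 * Real.pi / diskArea r

lemma greenConst_pos {r : ℝ} (hr : 0 < r) : 0 < greenConst r :=
  div_pos Real.two_pi_pos (diskArea_pos hr)

/-- The contribution of the sample `x` to the estimator, where `y j q` is the logarithm observed
at the `q`-th node of `x j`. The residuals are truncated at height `T`. -/
def sampleValue {l : ℕ} (T : ℝ) (G : (Fin l → ℂ) → ℂ) (x : Fin l → ℂ × ℂ)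
    (y : Fin l → Fin 4 → ℝ) : ℂ :=
  (∏ j, ((truncAt T (∑ q, weight (x j) q * y j q) : ℝ) : ℂ)) * multiLap G fun j => (x j).1

/-- The estimator of the sum of `G` over tuples of zeros, from the samples `X s` and the
logarithms `y s j q` observed at their nodes. -/
def estimator {m l : ℕ} (r T : ℝ) (G : (Fin l → ℂ) → ℂ) (X : Fin m → Fin l → ℂ × ℂ)
    (y : Fin m → Fin l → Fin 4 → ℝ) : ℂ :=
  ((greenConst r : ℂ) ^ l)⁻¹ * ((m : ℂ)⁻¹ * ∑ s, sampleValue T G (X s) (y s))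

lemma norm_sampleValue_le {l : ℕ} {T : ℝ} (hT : 0 < T) {G : (Fin l → ℂ) → ℂ} {M : ℝ}
    (hM : ∀ w, ‖multiLap G w‖ ≤ M) (x : Fin l → ℂ × ℂ) (y : Fin l → Fin 4 → ℝ) :
    ‖sampleValue T G x y‖ ≤ (2 * T) ^ l * M := by
  rw [sampleValue, norm_mul, norm_prod]
  refine mul_le_mul ?_ (hM _) (norm_nonneg _) (by positivity)
  calc _ ≤ ∏ _j : Fin l, 2 * T := Finset.prod_le_prod (fun _ _ => norm_nonneg _) fun j _ => by
        rw [Complex.norm_real]; exact abs_truncAt_le_two_mul hT _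
    _ = _ := by simp

lemma norm_estimator_le {m l : ℕ} (hm : 1 ≤ m) {r T : ℝ} (hr : 0 < r) (hT : 0 < T)
    {G : (Fin l → ℂ) → ℂ} {M : ℝ} (hM : ∀ w, ‖multiLap G w‖ ≤ M) (X : Fin m → Fin l → ℂ × ℂ)
    (y : Fin m → Fin l → Fin 4 → ℝ) :
    ‖estimator r T G X y‖ ≤ (greenConst r ^ l)⁻¹ * ((2 * T) ^ l * M) := by
  have hκ := greenConst_pos hr
  have hm0 : (0 : ℝ) < m := by exact_mod_cast hm
  rw [estimator, norm_mul, norm_mul, norm_inv, norm_inv, norm_pow, Complex.norm_real,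
    Real.norm_of_nonneg hκ.le, Complex.norm_natCast]
  refine mul_le_mul_of_nonneg_left ?_ (by positivity)
  rw [inv_mul_le_iff₀ hm0]
  refine (norm_sum_le _ _).trans ?_
  calc _ ≤ ∑ _s : Fin m, (2 * T) ^ l * M :=
        Finset.sum_le_sum fun s _ => norm_sampleValue_le hT hM _ _
    _ = _ := by simp

lemma measurable_sampleValue {l : ℕ} (T : ℝ) {G : (Fin l → ℂ) → ℂ}
    (hG : ContDiff ℝ (⊤ : ℕ∞) G) :
    Measurable fun xy : (Fin l → ℂ × ℂ) × (Fin l → Fin 4 → ℝ) => sampleValue T G xy.1 xy.2 := by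
  refine Continuous.measurable ?_
  unfold sampleValue
  refine Continuous.mul (continuous_finsetProd _ fun j _ => ?_) ?_
  · refine Complex.continuous_ofReal.comp ((continuous_truncAt T).comp ?_)
    refine continuous_finsetSum _ fun q _ => Continuous.mul ?_ (by fun_prop)
    exact (continuous_weight q).comp (by fun_prop)
  · exact (contDiff_multiLap hG).continuous.comp (by fun_prop)

lemma measurable_nodes {l : ℕ} {U : Fin l → ℂ → ℝ} (hU : ∀ j, Measurable (U j)) :
    Measurable fun (x : Fin l → ℂ × ℂ) (j : Fin l) (q : Fin 4) => U j (node (x j) q) := by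
  refine measurable_pi_lambda _ fun j => measurable_pi_lambda _ fun q => ?_
  exact (hU j).comp ((continuous_node q).measurable.comp (measurable_pi_apply j))

lemma measurable_sampleValue_nodes {l : ℕ} (T : ℝ) {G : (Fin l → ℂ) → ℂ}
    (hG : ContDiff ℝ (⊤ : ℕ∞) G) {U : Fin l → ℂ → ℝ} (hU : ∀ j, Measurable (U j)) :
    Measurable fun x : Fin l → ℂ × ℂ => sampleValue T G x (fun j q => U j (node (x j) q)) := by
  have h := (measurable_sampleValue T hG).comp (measurable_id.prodMk (measurable_nodes hU))
  exact h

/-- The bias of the estimator, caused by truncation. -/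
lemma norm_integral_sampleValue_sub_le {l : ℕ} {r : ℝ} (hr : 1 ≤ r) {ι : Type*} [Fintype ι]
    {ζ : Fin l → ι → ℂ} {U : Fin l → ℂ → ℝ} (hUm : ∀ j, Measurable (U j))
    (hU : ∀ j, IsLogPotential (ζ j) (U j)) {D T₁ K : ℝ} (hD : 0 < D) (hT₁ : 0 < T₁) {p : ℕ}
    (hmom : ∀ j, Integrable (fun x => (1 + |residual (U j) x| / D) ^ (p + 1))
        ((diskMeasure r).prod (diskMeasure r)) ∧
      ∫ x, (1 + |residual (U j) x| / D) ^ (p + 1) ∂((diskMeasure r).prod (diskMeasure r)) ≤ K)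
    {G : (Fin l → ℂ) → ℂ} (hG : ContDiff ℝ (⊤ : ℕ∞) G)
    (hGs : Function.support G ⊆ Set.pi Set.univ fun _ => Metric.closedBall (0 : ℂ) r) {M : ℝ}
    (hM : ∀ w, ‖multiLap G w‖ ≤ M) :
    ‖∫ x, sampleValue (D * T₁) G x (fun j q => U j (node (x j) q)) ∂(sampleMeasure r l) -
      (greenConst r : ℂ) ^ l * ∑ i : Fin l → ι, G fun j => ζ j (i j)‖ ≤
      2 * D ^ l * (T₁ ^ p)⁻¹ * K ^ l * M := by
  have hr0 : 0 < r := by linarith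
  have := isProbabilityMeasure_diskMeasure hr0
  have := isProbabilityMeasure_sampleMeasure hr0 l
  have hM0 : 0 ≤ M := (norm_nonneg _).trans (hM 0)
  obtain ⟨hgi, hg⟩ := integral_pi_prod_mul_multiLap ((diskMeasure r).prod (diskMeasure r))
    measurable_fst (r := r) (greenConst r : ℂ) (v := fun j => residual (U j)) (ζ := ζ)
    (fun j => integrable_residual hr (hU j).locallyIntegrable)
    (fun j φ hφ hφs => (hU j).integral_residual_mul_planeLap hr hφ hφs) hG hGs
  have hsi : Integrable (fun x => sampleValue (D * T₁) G x (fun j q => U j (node (x j) q)))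
      (sampleMeasure r l) :=
    Integrable.of_bound (measurable_sampleValue_nodes _ hG hUm).aestronglyMeasurable _
      (.of_forall fun x => norm_sampleValue_le (by positivity) hM _ _)
  have hprod : Integrable (fun x : Fin l → ℂ × ℂ =>
      ∏ j, (1 + |residual (U j) (x j)| / D) ^ (p + 1)) (sampleMeasure r l) :=
    Integrable.fintype_prod_dep (f := fun j x => (1 + |residual (U j) x| / D) ^ (p + 1))
      fun j => (hmom j).1
  rw [← hg, ← sampleMeasure]
  rw [← integral_sub hsi hgi]
  calc _ ≤ ∫ x, 2 * D ^ l * (T₁ ^ p)⁻¹ * M *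
        (∏ j, (1 + |residual (U j) (x j)| / D) ^ (p + 1)) ∂(sampleMeasure r l) := by
        refine norm_integral_le_of_norm_le (hprod.const_mul _) (.of_forall fun x => ?_)
        have h := abs_prod_sub_prod_truncAt_le hD hT₁ p (fun j => residual (U j) (x j))
        rw [abs_sub_comm] at h
        have hs : sampleValue (D * T₁) G x (fun j q => U j (node (x j) q)) -
            (∏ j, (residual (U j) (x j) : ℂ)) * multiLap G (fun j => (x j).1) =
            ((∏ j, truncAt (D * T₁) (residual (U j) (x j)) - ∏ j, residual (U j) (x j) : ℝ) : ℂ) *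
              multiLap G (fun j => (x j).1) := by
          unfold sampleValue
          push_cast
          rw [sub_mul]
          rfl
        rw [hs, norm_mul, Complex.norm_real, Real.norm_eq_abs]
        calc _ ≤ (2 * D ^ l * (T₁ ^ p)⁻¹ * ∏ j, (1 + |residual (U j) (x j)| / D) ^ (p + 1)) * M :=
              mul_le_mul h (hM _) (norm_nonneg _) ((abs_nonneg _).trans h)
          _ = _ := by ring
    _ ≤ 2 * D ^ l * (T₁ ^ p)⁻¹ * M * K ^ l := by
        rw [integral_const_mul]
        refine mul_le_mul_of_nonneg_left ?_ (by positivity)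
        rw [sampleMeasure, integral_fintype_prod_eq_prod
          (f := fun j x => (1 + |residual (U j) x| / D) ^ (p + 1))]
        calc _ ≤ ∏ _j : Fin l, K := Finset.prod_le_prod
              (fun j _ => integral_nonneg fun x => by positivity) fun j _ => (hmom j).2
          _ = _ := by simp
    _ = _ := by ring

/-- On average over the samples, the error of the estimator is at most its fluctuation plus its
bias. -/
lemma integral_norm_estimator_sub_le {m l : ℕ} (hm : 1 ≤ m) {r : ℝ} (hr : 1 ≤ r) {ι : Type*}
    [Fintype ι] {ζ : Fin l → ι → ℂ} {U : Fin l → ℂ → ℝ} (hUm : ∀ j, Measurable (U j))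
    (hU : ∀ j, IsLogPotential (ζ j) (U j)) {D T₁ K : ℝ} (hD : 0 < D) (hT₁ : 0 < T₁) {p : ℕ}
    (hmom : ∀ j, Integrable (fun x => (1 + |residual (U j) x| / D) ^ (p + 1))
        ((diskMeasure r).prod (diskMeasure r)) ∧
      ∫ x, (1 + |residual (U j) x| / D) ^ (p + 1) ∂((diskMeasure r).prod (diskMeasure r)) ≤ K)
    {G : (Fin l → ℂ) → ℂ} (hG : ContDiff ℝ (⊤ : ℕ∞) G)
    (hGs : Function.support G ⊆ Set.pi Set.univ fun _ => Metric.closedBall (0 : ℂ) r) {M : ℝ}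
    (hM : ∀ w, ‖multiLap G w‖ ≤ M) :
    ∫ X, ‖estimator r (D * T₁) G X (fun s j q => U j (node (X s j) q)) -
        ∑ i : Fin l → ι, G fun j => ζ j (i j)‖ ∂(Measure.pi fun _ : Fin m => sampleMeasure r l) ≤
      (greenConst r ^ l)⁻¹ * (2 * ((2 * (D * T₁)) ^ l * M) / Real.sqrt m +
        2 * D ^ l * (T₁ ^ p)⁻¹ * K ^ l * M) := by
  have hr0 : 0 < r := by linarith
  have := isProbabilityMeasure_sampleMeasure hr0 l
  have hκ := greenConst_pos hr0
  have hκc : (greenConst r : ℂ) ^ l ≠ 0 := pow_ne_zero _ (by exact_mod_cast hκ.ne')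
  let W : (Fin l → ℂ × ℂ) → ℂ := fun x =>
    sampleValue (D * T₁) G x (fun j q => U j (node (x j) q))
  have hWm : Measurable W := measurable_sampleValue_nodes _ hG hUm
  have hWb : ∀ x, ‖W x‖ ≤ (2 * (D * T₁)) ^ l * M := fun x =>
    norm_sampleValue_le (by positivity) hM _ _
  have hmc := integral_norm_average_sub_le (ρ := sampleMeasure r l) hWm hWb hm
  have hbias := norm_integral_sampleValue_sub_le hr hUm hU hD hT₁ hmom hG hGs hM
  generalize ∑ i : Fin l → ι, G (fun j => ζ j (i j)) = S at hbias ⊢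
  have hest : ∀ X : Fin m → Fin l → ℂ × ℂ,
      estimator r (D * T₁) G X (fun s j q => U j (node (X s j) q)) =
        ((greenConst r : ℂ) ^ l)⁻¹ * ((m : ℂ)⁻¹ * ∑ s, W (X s)) := fun X => rfl
  simp only [hest]
  change ‖∫ x, W x ∂(sampleMeasure r l) - (greenConst r : ℂ) ^ l * S‖ ≤ _ at hbias
  clear_value W
  have hint : Integrable (fun X : Fin m → Fin l → ℂ × ℂ =>
      ‖(m : ℂ)⁻¹ * ∑ s, W (X s) - ∫ x, W x ∂(sampleMeasure r l)‖)
      (Measure.pi fun _ : Fin m => sampleMeasure r l) := by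
    refine Integrable.norm (Integrable.sub (Integrable.const_mul ?_ _) (integrable_const _))
    exact integrable_finsetSum _ fun s _ =>
      Integrable.of_bound (hWm.comp (measurable_pi_apply s)).aestronglyMeasurable _
        (.of_forall fun X => hWb (X s))
  calc _ ≤ ∫ X : Fin m → Fin l → ℂ × ℂ, (greenConst r ^ l)⁻¹ *
        (‖(m : ℂ)⁻¹ * ∑ s, W (X s) - ∫ x, W x ∂(sampleMeasure r l)‖ +
          2 * D ^ l * (T₁ ^ p)⁻¹ * K ^ l * M) ∂(Measure.pi fun _ : Fin m => sampleMeasure r l) := by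
        refine integral_mono_of_nonneg (.of_forall fun X => norm_nonneg _)
          ((hint.add (integrable_const _)).const_mul _) (.of_forall fun X => ?_)
        have h1 : ((greenConst r : ℂ) ^ l)⁻¹ * ((m : ℂ)⁻¹ * ∑ s, W (X s)) - S =
            ((greenConst r : ℂ) ^ l)⁻¹ * (((m : ℂ)⁻¹ * ∑ s, W (X s) -
              ∫ x, W x ∂(sampleMeasure r l)) +
              (∫ x, W x ∂(sampleMeasure r l) - (greenConst r : ℂ) ^ l * S)) := by
          rw [sub_add_sub_cancel, mul_sub, inv_mul_cancel_left₀ hκc]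
        dsimp only
        rw [h1, norm_mul, norm_inv, norm_pow, Complex.norm_real, Real.norm_of_nonneg hκ.le]
        refine mul_le_mul_of_nonneg_left ?_ (by positivity)
        exact (norm_add_le _ _).trans (add_le_add le_rfl hbias)
    _ ≤ _ := by
        rw [integral_const_mul, integral_add hint (integrable_const _)]
        refine mul_le_mul_of_nonneg_left ?_ (by positivity)
        refine add_le_add hmc ?_
        simp

/-! ### Derivatives of the estimator with respect to the observed logarithms -/

/-- Written as a Euclidean norm, `gradNorm` satisfies the triangle inequality. -/
lemma gradNorm_eq_norm {k : ℕ} (a : ℕ) (G : (Fin k → ℂ) → ℂ) (w : Fin k → ℂ) :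
    gradNorm a G w = ‖(WithLp.toLp 2 fun e : Fin a → Fin k × Bool =>
      iteratedFDeriv ℝ a G w (fun s => realBasis (e s)) :
        EuclideanSpace ℂ (Fin a → Fin k × Bool))‖ := by
  rw [EuclideanSpace.norm_eq, gradNorm]

lemma gradNorm_sum_le {k : ℕ} {σ : Type*} [Fintype σ] (a : ℕ) {F : σ → (Fin k → ℂ) → ℂ}
    (hF : ∀ s, ContDiff ℝ (⊤ : ℕ∞) (F s)) (w : Fin k → ℂ) :
    gradNorm a (fun w => ∑ s, F s w) w ≤ ∑ s, gradNorm a (F s) w := by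
  simp only [gradNorm_eq_norm]
  rw [iteratedFDeriv_fun_sum_apply fun s _ => (contDiff_nat_of_top (hF s) a).contDiffAt]
  refine le_trans (le_of_eq ?_) (norm_sum_le _ _)
  congr 1
  ext e
  simp

/-- The tensor of derivatives of `Q ∘ L` is controlled by the Hilbert-Schmidt norm of `L`. This
does not involve the number of variables. -/
lemma gradNorm_const_mul_comp_le {k l : ℕ} (a : ℕ) {Q : (Fin l → ℝ) → ℂ}
    (hQ : ContDiff ℝ (⊤ : ℕ∞) Q) {K : ℝ} (hK : ∀ v, ‖iteratedFDeriv ℝ a Q v‖ ≤ K)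
    (L : (Fin k → ℂ) →L[ℝ] (Fin l → ℝ)) {Λ : ℝ} (hL : ∑ e, ‖L (realBasis e)‖ ^ 2 ≤ Λ)
    (c : ℂ) (w : Fin k → ℂ) :
    gradNorm a (fun w => c * Q (L w)) w ≤ ‖c‖ * (K * Real.sqrt (Λ ^ a)) := by
  have hK0 : 0 ≤ K := (norm_nonneg _).trans (hK 0)
  have h1 : iteratedFDeriv ℝ a (fun w => c * Q (L w)) w =
      c • (iteratedFDeriv ℝ a Q (L w)).compContinuousLinearMap fun _ => L := by
    have h2 : (fun w => c * Q (L w)) = c • (Q ∘ L) := rfl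
    rw [h2, iteratedFDeriv_const_smul_apply
      (contDiff_nat_of_top (hQ.comp L.contDiff) a).contDiffAt,
      L.iteratedFDeriv_comp_right (contDiff_nat_of_top hQ a) w le_rfl]
  have h3 : ∀ e : Fin a → Fin k × Bool,
      ‖iteratedFDeriv ℝ a (fun w => c * Q (L w)) w (fun s => realBasis (e s))‖ ^ 2 ≤
        (‖c‖ * K) ^ 2 * ∏ s, ‖L (realBasis (e s))‖ ^ 2 := by
    intro e
    rw [h1, _root_.smul_apply, norm_smul, Finset.prod_pow, ← mul_pow, mul_assoc]
    refine pow_le_pow_left₀ (by positivity) (mul_le_mul_of_nonneg_left ?_ (norm_nonneg _)) 2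
    rw [ContinuousMultilinearMap.compContinuousLinearMap_apply]
    refine (ContinuousMultilinearMap.le_opNorm _ _).trans ?_
    exact mul_le_mul_of_nonneg_right (hK _) (Finset.prod_nonneg fun s _ => norm_nonneg _)
  have h4 : ∑ e : Fin a → Fin k × Bool,
      ‖iteratedFDeriv ℝ a (fun w => c * Q (L w)) w (fun s => realBasis (e s))‖ ^ 2 ≤
        (‖c‖ * K) ^ 2 * Λ ^ a := by
    refine (Finset.sum_le_sum fun e _ => h3 e).trans ?_
    rw [← Finset.mul_sum, ← Fintype.sum_pow (fun b => ‖L (realBasis b)‖ ^ 2) a]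
    refine mul_le_mul_of_nonneg_left ?_ (sq_nonneg _)
    exact pow_le_pow_left₀ (Finset.sum_nonneg fun _ _ => sq_nonneg _) hL a
  refine (Real.sqrt_le_sqrt h4).trans_eq ?_
  rw [Real.sqrt_mul (sq_nonneg _), Real.sqrt_sq (by positivity), mul_assoc]

/-- The product of truncations, as a function of real variables. -/
def truncProd (l : ℕ) (v : Fin l → ℝ) : ℂ := ∏ j, ((trunc (v j) : ℝ) : ℂ)

lemma contDiff_truncProd (l : ℕ) : ContDiff ℝ (⊤ : ℕ∞) (truncProd l) :=
  contDiff_prod fun j _ =>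
    Complex.ofRealCLM.contDiff.comp (contDiff_trunc.comp (contDiff_apply ℝ ℝ j))

lemma exists_norm_iteratedFDeriv_truncProd_le (l a₀ : ℕ) :
    ∃ K : ℝ, 0 ≤ K ∧ ∀ a ≤ a₀, ∀ v, ‖iteratedFDeriv ℝ a (truncProd l) v‖ ≤ K := by
  have hc : HasCompactSupport (truncProd l) := by
    refine HasCompactSupport.intro (K := Set.pi Set.univ fun _ => tsupport trunc)
      (isCompact_univ_pi fun _ => hasCompactSupport_trunc.isCompact) fun v hv => ?_
    simp only [Set.mem_pi, Set.mem_univ, true_implies, not_forall] at hv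
    obtain ⟨j, hj⟩ := hv
    refine Finset.prod_eq_zero (Finset.mem_univ j) ?_
    rw [image_eq_zero_of_notMem_tsupport hj, Complex.ofReal_zero]
  have h : ∀ a, ∃ K : ℝ, ∀ v, ‖iteratedFDeriv ℝ a (truncProd l) v‖ ≤ K := fun a =>
    (hc.iteratedFDeriv (𝕜 := ℝ) a).exists_bound_of_continuous
      ((contDiff_nat_of_top (contDiff_truncProd l) a).continuous_iteratedFDeriv le_rfl)
  choose K hK using h
  refine ⟨∑ a ∈ Finset.range (a₀ + 1), |K a|, Finset.sum_nonneg fun _ _ => abs_nonneg _,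
    fun a ha v => ?_⟩
  refine (hK a v).trans ((le_abs_self _).trans ?_)
  exact Finset.single_le_sum (f := fun a => |K a|) (fun _ _ => abs_nonneg _)
    (Finset.mem_range.2 (Nat.lt_succ_of_le ha))

/-- The scaled residuals of a sample as a linear function of the observed logarithms. -/
def residualCLM {N m l : ℕ} (e : Fin m × Fin l × Fin 4 ≃ Fin N) (T : ℝ)
    (X : Fin m → Fin l → ℂ × ℂ) (s : Fin m) : (Fin N → ℂ) →L[ℝ] (Fin l → ℝ) :=
  ContinuousLinearMap.pi fun j => ∑ q, (T⁻¹ * weight (X s j) q) •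
    Complex.reCLM.comp (ContinuousLinearMap.proj (R := ℝ) (φ := fun _ : Fin N => ℂ) (e (s, j, q)))

lemma residualCLM_apply {N m l : ℕ} (e : Fin m × Fin l × Fin 4 ≃ Fin N) (T : ℝ)
    (X : Fin m → Fin l → ℂ × ℂ) (s : Fin m) (w : Fin N → ℂ) (j : Fin l) :
    residualCLM e T X s w j = (∑ q, weight (X s j) q * (w (e (s, j, q))).re) / T := by
  simp only [residualCLM, ContinuousLinearMap.coe_pi', _root_.sum_apply,
    _root_.smul_apply, ContinuousLinearMap.comp_apply, ContinuousLinearMap.proj_apply,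
    Complex.reCLM_apply, smul_eq_mul]
  rw [Finset.sum_div]
  exact Finset.sum_congr rfl fun q _ => by ring

/-- The estimator as a function of the observed logarithms, listed in one tuple along `e`. -/
def estimatorFun {N m l : ℕ} (e : Fin m × Fin l × Fin 4 ≃ Fin N) (r T : ℝ)
    (G : (Fin l → ℂ) → ℂ) (X : Fin m → Fin l → ℂ × ℂ) (w : Fin N → ℂ) : ℂ :=
  estimator r T G X fun s j q => (w (e (s, j, q))).re

lemma estimatorFun_eq {N m l : ℕ} (e : Fin m × Fin l × Fin 4 ≃ Fin N) (r T : ℝ)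
    (G : (Fin l → ℂ) → ℂ) (X : Fin m → Fin l → ℂ × ℂ) :
    estimatorFun e r T G X = fun w => ∑ s, (((greenConst r : ℂ) ^ l)⁻¹ * (m : ℂ)⁻¹ * (T : ℂ) ^ l *
      multiLap G fun j => (X s j).1) * truncProd l (residualCLM e T X s w) := by
  funext w
  simp only [estimatorFun, estimator, Finset.mul_sum]
  refine Finset.sum_congr rfl fun s _ => ?_
  have h : (∏ j, ((truncAt T (∑ q, weight (X s j) q * (w (e (s, j, q))).re) : ℝ) : ℂ)) =
      (T : ℂ) ^ l * truncProd l (residualCLM e T X s w) := by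
    have hT : (T : ℂ) ^ l = ∏ _j : Fin l, (T : ℂ) := by simp
    rw [hT, truncProd, ← Finset.prod_mul_distrib]
    refine Finset.prod_congr rfl fun j _ => ?_
    rw [residualCLM_apply, truncAt, Complex.ofReal_mul]
  rw [sampleValue, h]
  ring

lemma contDiff_estimatorFun {N m l : ℕ} (e : Fin m × Fin l × Fin 4 ≃ Fin N) (r T : ℝ)
    (G : (Fin l → ℂ) → ℂ) (X : Fin m → Fin l → ℂ × ℂ) :
    ContDiff ℝ (⊤ : ℕ∞) (estimatorFun e r T G X) := by
  rw [estimatorFun_eq]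
  exact ContDiff.sum fun s _ => contDiff_const.mul
    ((contDiff_truncProd l).comp (residualCLM e T X s).contDiff)

lemma sum_norm_residualCLM_realBasis_le {N m l : ℕ} (e : Fin m × Fin l × Fin 4 ≃ Fin N) {r T : ℝ}
    (hr : 1 ≤ r) (hT : 1 ≤ T) {X : Fin m → Fin l → ℂ × ℂ}
    (hX : ∀ s j, ‖(X s j).1‖ ≤ r ∧ ‖(X s j).2‖ ≤ r) (s : Fin m) :
    ∑ b, ‖residualCLM e T X s (realBasis b)‖ ^ 2 ≤ 100 * l * r ^ 2 := by
  have hT0 : 0 < T := by linarith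
  have hone : ∀ (t : Fin m × Fin l × Fin 4) (b : Bool),
      ‖residualCLM e T X s (realBasis (e t, b))‖ ^ 2 ≤
        if t.1 = s ∧ b = false then 25 * r ^ 2 else 0 := by
    rintro ⟨s', j', q'⟩ b
    have happ : ∀ j, residualCLM e T X s (realBasis (e (s', j', q'), b)) j =
        if s' = s ∧ j' = j ∧ b = false then weight (X s j) q' / T else 0 := by
      intro j
      rw [residualCLM_apply]
      simp only [realBasis, Pi.single_apply, e.apply_eq_iff_eq, Prod.mk.injEq]
      by_cases h : s' = s ∧ j' = j ∧ b = false
      · obtain ⟨rfl, rfl, rfl⟩ := h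
        rw [Finset.sum_eq_single q']
        · simp
        · intro q _ hq
          simp [hq]
        · simp
      · rw [if_neg h]
        refine div_eq_zero_iff.2 (Or.inl (Finset.sum_eq_zero fun q _ => ?_))
        by_cases h2 : s = s' ∧ j = j' ∧ q = q'
        · obtain ⟨rfl, rfl, rfl⟩ := h2
          have hb : b = true := by simpa using h
          simp [hb]
        · rw [if_neg h2]; simp
    by_cases h : s' = s ∧ b = false
    · rw [if_pos h]
      have : ‖residualCLM e T X s (realBasis (e (s', j', q'), b))‖ ≤ 5 * r := by
        refine (pi_norm_le_iff_of_nonneg (by linarith)).2 fun j => ?_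
        rw [happ]
        split_ifs
        · rw [norm_div, Real.norm_eq_abs, Real.norm_of_nonneg hT0.le]
          exact (div_le_self (abs_nonneg _) hT).trans (abs_weight_le hr (hX s j).1 (hX s j).2 q')
        · rw [norm_zero]; linarith
      calc _ ≤ (5 * r) ^ 2 := pow_le_pow_left₀ (norm_nonneg _) this 2
        _ = _ := by ring
    · rw [if_neg h]
      have : residualCLM e T X s (realBasis (e (s', j', q'), b)) = 0 := by
        funext j
        rw [happ, if_neg fun h' => h ⟨h'.1, h'.2.2⟩]
        rfl
      rw [this]; simp
  rw [Fintype.sum_prod_type, ← e.sum_comp]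
  calc _ ≤ ∑ t : Fin m × Fin l × Fin 4, ∑ b : Bool,
        (if t.1 = s ∧ b = false then 25 * r ^ 2 else 0) :=
        Finset.sum_le_sum fun t _ => Finset.sum_le_sum fun b _ => hone t b
    _ = 100 * l * r ^ 2 := by
        rw [Fintype.sum_prod_type]
        simp [Finset.sum_ite_eq']
        ring

/-- Bounds for the derivatives of the estimator that do not depend on the number of samples. -/
lemma exists_gradNorm_estimatorFun_le (l a₀ : ℕ) {r : ℝ} (hr : 1 ≤ r) :
    ∃ K : ℝ, 0 < K ∧ ∀ (N m : ℕ) (e : Fin m × Fin l × Fin 4 ≃ Fin N) (T M : ℝ)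
      (G : (Fin l → ℂ) → ℂ) (X : Fin m → Fin l → ℂ × ℂ), 1 ≤ m → 1 ≤ T →
      (∀ w, ‖multiLap G w‖ ≤ M) → (∀ s j, ‖(X s j).1‖ ≤ r ∧ ‖(X s j).2‖ ≤ r) →
      ∀ a ≤ a₀, ∀ w, gradNorm a (estimatorFun e r T G X) w ≤ K * (T ^ l * M) := by
  obtain ⟨KQ, hKQ0, hKQ⟩ := exists_norm_iteratedFDeriv_truncProd_le l a₀
  have hκ := greenConst_pos (by linarith : 0 < r)
  let Λ : ℝ := 100 * l * r ^ 2
  let K : ℝ := (greenConst r ^ l)⁻¹ * (KQ * Real.sqrt ((1 + Λ) ^ a₀)) + 1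
  have hΛ : 0 ≤ Λ := by positivity
  refine ⟨K, by positivity, ?_⟩
  intro N m e T M G X hm hT hM hX a ha w
  have hM0 : 0 ≤ M := (norm_nonneg _).trans (hM 0)
  have hm0 : (0 : ℝ) < m := by exact_mod_cast hm
  have hT0 : 0 < T := by linarith
  have hκm : (0 : ℝ) ≤ greenConst r := hκ.le
  rw [estimatorFun_eq]
  refine (gradNorm_sum_le a (fun s => contDiff_const.mul
    ((contDiff_truncProd l).comp (residualCLM e T X s).contDiff)) w).trans ?_
  have hs : ∀ s, gradNorm a (fun w => (((greenConst r : ℂ) ^ l)⁻¹ * (m : ℂ)⁻¹ * (T : ℂ) ^ l *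
      multiLap G fun j => (X s j).1) * truncProd l (residualCLM e T X s w)) w ≤
      (m : ℝ)⁻¹ * (K * (T ^ l * M)) := by
    intro s
    refine (gradNorm_const_mul_comp_le a (contDiff_truncProd l) (hKQ a ha)
      (residualCLM e T X s) (sum_norm_residualCLM_realBasis_le e hr hT hX s) _ w).trans ?_
    rw [norm_mul, norm_mul, norm_mul, norm_inv, norm_inv, norm_pow, norm_pow, Complex.norm_real,
      Complex.norm_real, Real.norm_of_nonneg hκm, Real.norm_of_nonneg hT0.le, Complex.norm_natCast]
    have h1 : Real.sqrt (Λ ^ a) ≤ Real.sqrt ((1 + Λ) ^ a₀) := by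
      refine Real.sqrt_le_sqrt ?_
      calc Λ ^ a ≤ (1 + Λ) ^ a := pow_le_pow_left₀ hΛ (by linarith) a
        _ ≤ (1 + Λ) ^ a₀ := pow_le_pow_right₀ (by linarith) ha
    calc _ ≤ (greenConst r ^ l)⁻¹ * (m : ℝ)⁻¹ * T ^ l * M *
          (KQ * Real.sqrt ((1 + Λ) ^ a₀)) := by
          gcongr
          exact hM _
      _ = (m : ℝ)⁻¹ * ((greenConst r ^ l)⁻¹ * (KQ * Real.sqrt ((1 + Λ) ^ a₀)) * (T ^ l * M)) := by
          ring
      _ ≤ _ := by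
          refine mul_le_mul_of_nonneg_left (mul_le_mul_of_nonneg_right ?_ (by positivity))
            (by positivity)
          simp only [K]; linarith
  calc _ ≤ ∑ _s : Fin m, (m : ℝ)⁻¹ * (K * (T ^ l * M)) := Finset.sum_le_sum fun s _ => hs s
    _ = _ := by
      rw [Finset.sum_const, Finset.card_univ, Fintype.card_fin, nsmul_eq_mul]
      field_simp

/-! ### Zeros of a polynomial as an indexed family -/

lemma sum_roots_coe (p : ℂ[X]) {E : Type*} [AddCommMonoid E] (φ : ℂ → E) :
    ∑ x : p.roots, φ x = (p.roots.map φ).sum := by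
  conv_rhs => rw [← Multiset.map_univ_coe p.roots, Multiset.map_map]
  rfl

lemma prod_roots_coe (p : ℂ[X]) {E : Type*} [CommMonoid E] (φ : ℂ → E) :
    ∏ x : p.roots, φ x = (p.roots.map φ).prod := by
  conv_rhs => rw [← Multiset.map_univ_coe p.roots, Multiset.map_map]
  rfl

lemma eq_C_mul_prod_roots (p : ℂ[X]) :
    p = Polynomial.C p.leadingCoeff * ∏ x : p.roots, (X - Polynomial.C (x : ℂ)) := by
  rw [prod_roots_coe p fun x => X - Polynomial.C x]
  exact (IsAlgClosed.splits p).eq_prod_roots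

lemma zeroCount_eq_card (p : ℂ[X]) (S : Set ℂ) [DecidablePred (· ∈ S)] :
    zeroCount p S = (Finset.univ.filter fun x : p.roots => (x : ℂ) ∈ S).card := by
  classical
  rw [Finset.card_filter, sum_roots_coe p fun x => if x ∈ S then 1 else 0, zeroCount,
    Multiset.countP_eq_card_filter]
  induction p.roots using Multiset.induction_on with
  | empty => simp
  | cons a s ih =>
    rw [Multiset.map_cons, Multiset.sum_cons, ← ih]
    by_cases ha : a ∈ S <;> simp [ha, add_comm]

lemma zeroTupleMeasure_one_apply (p : ℂ[X]) {S : Set ℂ} (hS : MeasurableSet S) :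
    zeroTupleMeasure 1 p {u | u 0 ∈ S} = zeroCount p S := by
  classical
  have hS' : MeasurableSet {u : Fin 1 → ℂ | u 0 ∈ S} := (measurable_pi_apply 0) hS
  rw [zeroTupleMeasure, Measure.finsetSum_apply, zeroCount_eq_card]
  simp only [Measure.dirac_apply' _ hS', Set.indicator_apply, Set.mem_ofPred_eq, Pi.one_apply]
  rw [Finset.card_filter, Nat.cast_sum,
    ← (Equiv.uniqueEmbeddingEquivResult (α := Fin 1) (β := p.roots)).symm.sum_comp]
  refine Finset.sum_congr rfl fun x _ => ?_
  push_cast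
  rfl

/-- The logarithm of `|p|`, recentred at `c`. -/
def logAt (p : ℂ[X]) (c w : ℂ) : ℝ := Real.log ‖p.eval (c + w)‖

lemma measurable_logAt (p : ℂ[X]) (c : ℂ) : Measurable (logAt p c) := by
  have h : Continuous fun w => ‖p.eval (c + w)‖ :=
    (p.continuous.comp (continuous_const.add continuous_id)).norm
  exact Real.measurable_log.comp h.measurable

lemma isLogPotential_logAt {p : ℂ[X]} (hp : p ≠ 0) (c : ℂ) :
    IsLogPotential (fun x : p.roots => (x : ℂ) - c) (logAt p c) := by
  have h := isLogPotential_log_norm_eval (leadingCoeff_ne_zero.2 hp)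
    (fun x : p.roots => (x : ℂ)) c
  rwa [← eq_C_mul_prod_roots p] at h

lemma ae_logAt_eq {p : ℂ[X]} (hp : p ≠ 0) (c : ℂ) : ∀ᵐ w, logAt p c w =
    Real.log ‖p.leadingCoeff‖ + ∑ x : p.roots, Real.log ‖w - ((x : ℂ) - c)‖ := by
  filter_upwards [ae_forall_ne_sub (fun x : p.roots => (x : ℂ)) c] with w hw
  have h := log_norm_eval_eq (leadingCoeff_ne_zero.2 hp) (fun x : p.roots => (x : ℂ)) c w hw
  rwa [← eq_C_mul_prod_roots p] at h

/-! ### Good polynomials -/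

/-- `p` is nonzero, and the disks of dyadic radii `2^t R`, `t ≤ L`, about the centres `c j` contain
at most `B (2^t R)²` zeros. -/
def IsGood {l : ℕ} (c : Fin l → ℂ) (B R : ℝ) (L : ℕ) (p : ℂ[X]) : Prop :=
  p ≠ 0 ∧ ∀ j, ∀ t ≤ L, (zeroCount p (Metric.ball (c j) (2 ^ t * R)) : ℝ) ≤ B * (2 ^ t * R) ^ 2

lemma IsGood.nonClustered {l : ℕ} {c : Fin l → ℂ} {B R : ℝ} {L : ℕ} {p : ℂ[X]}
    (h : IsGood c B R L p) (j : Fin l) :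
    NonClustered (fun x : p.roots => (x : ℂ) - c j) B R L := by
  classical
  intro t ht
  have := h.2 j t ht
  rw [zeroCount_eq_card] at this
  convert this using 3
  ext x
  simp [dist_eq_norm]

/-- For a good polynomial, the estimator built from random samples is close in mean to the sum
over tuples of zeros. -/
lemma exists_integral_norm_estimator_logAt_le {r : ℝ} (hr : 1 ≤ r) (p : ℕ) :
    ∃ K : ℝ, 1 ≤ K ∧ ∀ (l m n L : ℕ) (c : Fin l → ℂ) (B D T₁ M : ℝ) (f : ℂ[X])
      (G : (Fin l → ℂ) → ℂ), 1 ≤ m → 0 < B → 0 < T₁ → n ≤ 2 ^ L → f.natDegree ≤ n →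
      IsGood c B (8 * r) L f →
      5 * r * (B * (8 * r) ^ 2) ≤ D → 16 * r ^ 2 * (4 * B * L + 1) ≤ D →
      ContDiff ℝ (⊤ : ℕ∞) G →
      Function.support G ⊆ (Set.pi Set.univ fun _ => Metric.closedBall (0 : ℂ) r) →
      (∀ w, ‖multiLap G w‖ ≤ M) →
      ∫ X, ‖estimator r (D * T₁) G X (fun s j q => logAt f (c j) (node (X s j) q)) -
          fullSum G c f‖ ∂(Measure.pi fun _ : Fin m => sampleMeasure r l) ≤
        (greenConst r ^ l)⁻¹ * (2 * ((2 * (D * T₁)) ^ l * M) / Real.sqrt m +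
          2 * D ^ l * (T₁ ^ p)⁻¹ * K ^ l * M) := by
  obtain ⟨K, hK⟩ := exists_moment_le hr p
  refine ⟨max K 1, le_max_right _ _, ?_⟩
  intro l m n L c B D T₁ M f G hm hB hT₁ hnL hdeg hgood hD1 hD2 hG hGs hM
  have hr0 : 0 < r := by linarith
  have hD : 0 < D := lt_of_lt_of_le (by positivity) hD1
  have hcard : (Fintype.card f.roots : ℝ) ≤ 2 ^ L := by
    rw [Multiset.card_coe]
    exact_mod_cast (card_roots' f).trans (hdeg.trans hnL)
  refine integral_norm_estimator_sub_le hm hr (fun j => measurable_logAt f (c j))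
    (fun j => isLogPotential_logAt hgood.1 (c j)) hD hT₁ (fun j => ?_) hG hGs hM
  have := hK _ _ _ _ B D L (isLogPotential_logAt hgood.1 (c j)).locallyIntegrable
    (ae_logAt_eq hgood.1 (c j)) hB (hgood.nonClustered j) hcard hD1 hD2
  exact ⟨this.1, this.2.trans (le_max_left _ _)⟩

/-! ### Measurability -/

section
variable {Ω : Type*} [MeasurableSpace Ω] {n : ℕ} {f : Ω → ℂ[X]}

lemma IsRandomPolynomial.measurable_eval (hf : IsRandomPolynomial n f) :
    Measurable fun p : Ω × ℂ => (f p.1).eval p.2 := by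
  have h : ∀ p : Ω × ℂ, (f p.1).eval p.2 =
      ∑ i ∈ Finset.range (n + 1), (f p.1).coeff i * p.2 ^ i := fun p =>
    eval_eq_sum_range' (Nat.lt_succ_of_le (hf.natDegree_le p.1)) p.2
  simp only [h]
  exact Finset.measurable_sum _ fun i _ =>
    ((hf.measurable_coeff i).comp measurable_fst).mul (measurable_snd.pow_const i)

lemma IsRandomPolynomial.measurableSet_ne_zero (hf : IsRandomPolynomial n f) :
    MeasurableSet {ω | f ω ≠ 0} := by
  have : {ω | f ω ≠ 0} = ⋃ i : ℕ, {ω | (f ω).coeff i ≠ 0} := by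
    ext ω
    simp only [Set.mem_ofPred_eq, Set.mem_iUnion]
    constructor
    · intro h
      by_contra! h'
      exact h (Polynomial.ext fun i => by simpa using h' i)
    · rintro ⟨i, hi⟩ h
      exact hi (by simp [h])
  rw [this]
  exact MeasurableSet.iUnion fun i => (hf.measurable_coeff i) (measurableSet_singleton 0).compl

lemma IsRandomPolynomial.measurable_zeroCount (hf : IsRandomPolynomial n f) {S : Set ℂ}
    (hS : MeasurableSet S) : Measurable fun ω => (zeroCount (f ω) S : ℝ) := by
  have h := (measurable_zeroTupleMeasure hf 1)
  have h2 : Measurable fun ω => zeroTupleMeasure 1 (f ω) {u | u 0 ∈ S} :=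
    (Measure.measurable_coe ((measurable_pi_apply 0) hS)).comp h
  simp only [zeroTupleMeasure_one_apply _ hS] at h2
  have h3 := h2.ennreal_toReal
  simpa using h3

lemma IsRandomPolynomial.measurable_logAt (hf : IsRandomPolynomial n f) (c : ℂ) :
    Measurable fun p : Ω × ℂ => logAt (f p.1) c p.2 :=
  Real.measurable_log.comp (hf.measurable_eval.comp
    (measurable_fst.prodMk (measurable_snd.const_add c))).norm

/-- The probability that a random polynomial fails to be good. -/
lemma measureReal_not_isGood_le {P : Measure Ω} [IsProbabilityMeasure P]
    (hf : IsRandomPolynomial n f) {k l : ℕ} {z : Fin k → ℂ} {c : Fin l → ℂ}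
    (hc : ∀ j, ∃ i, c j = z i) {C A R : ℝ} (hR : 1 ≤ R) (L : ℕ)
    (hnd : NonDegenerate P f C A n) (hncl : NonClustering P f C A n z) :
    MeasurableSet {ω | IsGood c (C * (n : ℝ) ^ (1 / A)) R L (f ω)} ∧
    P.real {ω | IsGood c (C * (n : ℝ) ^ (1 / A)) R L (f ω)}ᶜ ≤
      (1 + l * (L + 1)) * (C * (n : ℝ) ^ (-A)) := by
  let S : Fin l → ℕ → Set Ω := fun j t => {ω | (zeroCount (f ω) (Metric.ball (c j) (2 ^ t * R)) : ℝ) ≤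
    C * (n : ℝ) ^ (1 / A) * (2 ^ t * R) ^ 2}
  have hS : ∀ j t, MeasurableSet (S j t) := fun j t =>
    measurableSet_le (hf.measurable_zeroCount Metric.isOpen_ball.measurableSet) measurable_const
  have h0 := hf.measurableSet_ne_zero
  have heq : {ω | IsGood c (C * (n : ℝ) ^ (1 / A)) R L (f ω)} =
      {ω | f ω ≠ 0} ∩ ⋂ j, ⋂ t ∈ Finset.range (L + 1), S j t := by
    ext ω
    simp only [IsGood, S, Set.mem_ofPred_eq, Set.mem_inter_iff, Set.mem_iInter, Finset.mem_range,
      Nat.lt_succ_iff]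
  have hmeas : MeasurableSet {ω | IsGood c (C * (n : ℝ) ^ (1 / A)) R L (f ω)} := by
    rw [heq]
    exact h0.inter (MeasurableSet.iInter fun j =>
      Finset.measurableSet_biInter _ fun t _ => hS j t)
  refine ⟨hmeas, ?_⟩
  have hb0 : P.real {ω | f ω ≠ 0}ᶜ ≤ C * (n : ℝ) ^ (-A) := by
    rw [probReal_compl_eq_one_sub h0]
    unfold NonDegenerate at hnd
    linarith
  have hb : ∀ j t, P.real (S j t)ᶜ ≤ C * (n : ℝ) ^ (-A) := by
    intro j t
    rw [probReal_compl_eq_one_sub (hS j t)]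
    obtain ⟨i, hi⟩ := hc j
    have hrad : 1 ≤ 2 ^ t * R := one_le_mul_of_one_le_of_one_le (one_le_pow₀ (by norm_num)) hR
    have := hncl i (2 ^ t * R) hrad
    rw [← hi] at this
    simp only [S]
    linarith
  rw [heq, Set.compl_inter]
  simp only [Set.compl_iInter]
  refine (measureReal_union_le _ _).trans ?_
  have h1 : P.real (⋃ j, ⋃ t ∈ Finset.range (L + 1), (S j t)ᶜ) ≤
      l * ((L + 1) * (C * (n : ℝ) ^ (-A))) := by
    refine (measureReal_iUnion_fintype_le _).trans ?_
    calc _ ≤ ∑ _j : Fin l, (L + 1) * (C * (n : ℝ) ^ (-A)) := by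
          refine Finset.sum_le_sum fun j _ => ?_
          refine (measureReal_biUnion_finset_le _ _).trans ?_
          calc _ ≤ ∑ _t ∈ Finset.range (L + 1), C * (n : ℝ) ^ (-A) :=
                Finset.sum_le_sum fun t _ => hb j t
            _ = _ := by simp
      _ = _ := by simp
  calc _ ≤ C * (n : ℝ) ^ (-A) + l * ((L + 1) * (C * (n : ℝ) ^ (-A))) := add_le_add hb0 h1
    _ = _ := by ring

lemma norm_fullSum_le {l n : ℕ} {p : ℂ[X]} (hp : p.natDegree ≤ n) {G : (Fin l → ℂ) → ℂ} {M : ℝ}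
    (hM : ∀ w, ‖G w‖ ≤ M) (c : Fin l → ℂ) : ‖fullSum G c p‖ ≤ (n : ℝ) ^ l * M := by
  have hM0 : 0 ≤ M := (norm_nonneg _).trans (hM 0)
  refine (norm_sum_le _ _).trans ?_
  calc _ ≤ ∑ _i : Fin l → p.roots, M := Finset.sum_le_sum fun i _ => hM _
    _ = (Multiset.card p.roots : ℝ) ^ l * M := by simp
    _ ≤ _ := by
      gcongr
      exact (card_roots' p).trans hp

/-- Green's formula shows that the sum over tuples of zeros depends measurably on `ω`. -/
lemma IsRandomPolynomial.measurable_fullSum (hf : IsRandomPolynomial n f) {l : ℕ} (hl : 1 ≤ l)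
    {r : ℝ} (hr : 1 ≤ r) {G : (Fin l → ℂ) → ℂ} (hG : ContDiff ℝ (⊤ : ℕ∞) G)
    (hGs : Function.support G ⊆ Set.pi Set.univ fun _ => Metric.closedBall (0 : ℂ) r)
    (c : Fin l → ℂ) : Measurable fun ω => fullSum G c (f ω) := by
  have hr0 : 0 < r := by linarith
  have := isProbabilityMeasure_diskMeasure hr0
  have := isProbabilityMeasure_sampleMeasure hr0 l
  have hκ : (greenConst r : ℂ) ^ l ≠ 0 :=
    pow_ne_zero _ (by exact_mod_cast (greenConst_pos hr0).ne')
  have hres : ∀ j, Measurable fun p : Ω × (Fin l → ℂ × ℂ) => residual (logAt (f p.1) (c j)) (p.2 j) := by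
    intro j
    unfold residual
    refine Finset.measurable_sum _ fun q _ => Measurable.mul ?_ ?_
    · exact (continuous_weight q).measurable.comp ((measurable_pi_apply j).comp measurable_snd)
    · exact (hf.measurable_logAt (c j)).comp (measurable_fst.prodMk
        ((continuous_node q).measurable.comp ((measurable_pi_apply j).comp measurable_snd)))
  have hjoint : Measurable fun p : Ω × (Fin l → ℂ × ℂ) =>
      (∏ j, (residual (logAt (f p.1) (c j)) (p.2 j) : ℂ)) * multiLap G fun j => (p.2 j).1 := by
    refine Measurable.mul (Finset.measurable_prod _ fun j _ =>
      Complex.measurable_ofReal.comp (hres j)) ?_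
    exact (contDiff_multiLap hG).continuous.measurable.comp (measurable_pi_lambda _ fun j =>
      measurable_fst.comp ((measurable_pi_apply j).comp measurable_snd))
  have hint := (hjoint.stronglyMeasurable.integral_prod_right'
    (ν := sampleMeasure r l)).measurable
  have heq : ∀ ω, fullSum G c (f ω) = ((greenConst r : ℂ) ^ l)⁻¹ *
      ∫ x, (∏ j, (residual (logAt (f ω) (c j)) (x j) : ℂ)) * multiLap G (fun j => (x j).1)
        ∂(sampleMeasure r l) := by
    intro ω
    by_cases h0 : f ω = 0
    · have h1 : fullSum G c (f ω) = 0 := by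
        have : IsEmpty (Fin l → (f ω).roots) := by
          rw [← Fintype.card_eq_zero_iff]
          simp [h0]
          omega
        exact Fintype.sum_empty _
      have h2 : ∀ x : Fin l → ℂ × ℂ,
          (∏ j, (residual (logAt (f ω) (c j)) (x j) : ℂ)) = 0 := by
        intro x
        refine Finset.prod_eq_zero (Finset.mem_univ ⟨0, hl⟩) ?_
        simp [h0, residual, logAt]
      simp [h1, h2]
    · have h := (integral_pi_prod_mul_multiLap ((diskMeasure r).prod (diskMeasure r))
        measurable_fst (r := r) (greenConst r : ℂ) (v := fun j => residual (logAt (f ω) (c j)))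
        (ζ := fun j (x : (f ω).roots) => (x : ℂ) - c j)
        (fun j => integrable_residual hr (isLogPotential_logAt h0 (c j)).locallyIntegrable)
        (fun j φ hφ hφs => (isLogPotential_logAt h0 (c j)).integral_residual_mul_planeLap
          hr hφ hφs) hG hGs).2
      rw [sampleMeasure, h, inv_mul_cancel_left₀ hκ]
      rfl
  simp only [heq]
  exact hint.const_mul _

end

/-! ### The log statistic computed from random sample points -/

/-- The points at which the logarithms entering the estimator are observed, listed along `e`. -/
def samplePoints {N m l : ℕ} (e : Fin m × Fin l × Fin 4 ≃ Fin N) (c : Fin l → ℂ)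
    (X : Fin m → Fin l → ℂ × ℂ) (i : Fin N) : ℂ :=
  c (e.symm i).2.1 + node (X (e.symm i).1 (e.symm i).2.1) (e.symm i).2.2

/-- The statistic of the observed logarithms to which the comparison hypothesis is applied. As in
`logStatistic`, it is `0` when `p` vanishes at one of the sample points. -/
def sampleStatistic {m l : ℕ} (r T : ℝ) (G : (Fin l → ℂ) → ℂ) (c : Fin l → ℂ)
    (X : Fin m → Fin l → ℂ × ℂ) (p : ℂ[X]) : ℂ :=
  open scoped Classical in
  if ∀ s j q, p.eval (c j + node (X s j) q) ≠ 0 then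
    estimator r T G X fun s j q => logAt p (c j) (node (X s j) q) else 0

lemma logStatistic_estimatorFun {N m l : ℕ} (e : Fin m × Fin l × Fin 4 ≃ Fin N) (r T : ℝ)
    (G : (Fin l → ℂ) → ℂ) (c : Fin l → ℂ) (X : Fin m → Fin l → ℂ × ℂ) (p : ℂ[X]) :
    logStatistic (estimatorFun e r T G X) (samplePoints e c X) p =
      sampleStatistic r T G c X p := by
  have hiff : (∀ i, p.eval (samplePoints e c X i) ≠ 0) ↔
      ∀ s j q, p.eval (c j + node (X s j) q) ≠ 0 := by
    rw [← e.forall_congr_right]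
    simp [samplePoints]
  unfold logStatistic sampleStatistic
  by_cases h : ∀ s j q, p.eval (c j + node (X s j) q) ≠ 0
  · rw [if_pos h, if_pos (hiff.2 h)]
    simp [estimatorFun, samplePoints, logAt]
  · rw [if_neg h, if_neg (hiff.not.2 h)]

lemma norm_sampleStatistic_le {m l : ℕ} (hm : 1 ≤ m) {r T : ℝ} (hr : 0 < r) (hT : 0 < T)
    {G : (Fin l → ℂ) → ℂ} {M : ℝ} (hM : ∀ w, ‖multiLap G w‖ ≤ M) (c : Fin l → ℂ)
    (X : Fin m → Fin l → ℂ × ℂ) (p : ℂ[X]) :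
    ‖sampleStatistic r T G c X p‖ ≤ (greenConst r ^ l)⁻¹ * ((2 * T) ^ l * M) := by
  have h := norm_estimator_le hm hr hT hM X fun s j q => logAt p (c j) (node (X s j) q)
  unfold sampleStatistic
  split_ifs
  · exact h
  · rw [norm_zero]
    exact (norm_nonneg _).trans h

lemma ae_eval_sample_ne_zero {m l : ℕ} {r : ℝ} (hr : 0 < r) {p : ℂ[X]} (hp : p ≠ 0)
    (c : Fin l → ℂ) : ∀ᵐ X ∂(Measure.pi fun _ : Fin m => sampleMeasure r l),
      ∀ s j q, p.eval (c j + node (X s j) q) ≠ 0 := by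
  have := isProbabilityMeasure_diskMeasure hr
  have := isProbabilityMeasure_sampleMeasure hr l
  rw [ae_all_iff]
  intro s
  rw [ae_all_iff]
  intro j
  have h1 : ∀ᵐ w : ℂ, p.eval (c j + w) ≠ 0 := by
    filter_upwards [ae_forall_ne_sub (fun x : p.roots => (x : ℂ)) (c j)] with w hw h0
    have hmem : c j + w ∈ p.roots := (mem_roots hp).2 h0
    refine hw ⟨c j + w, ⟨0, Multiset.count_pos.2 hmem⟩⟩ ?_
    simp
  have h2 : ∀ᵐ x ∂(sampleMeasure r l), ∀ q, p.eval (c j + node (x j) q) ≠ 0 :=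
    (measurePreserving_eval (fun _ : Fin l => (diskMeasure r).prod (diskMeasure r))
      j).quasiMeasurePreserving.ae (ae_node h1)
  exact (measurePreserving_eval (fun _ : Fin m => sampleMeasure r l)
    s).quasiMeasurePreserving.ae h2

lemma ae_sample_mem {m l : ℕ} {r : ℝ} (hr : 0 < r) :
    ∀ᵐ X ∂(Measure.pi fun _ : Fin m => sampleMeasure r l),
      ∀ s j, ‖(X s j).1‖ ≤ r ∧ ‖(X s j).2‖ ≤ r := by
  have := isProbabilityMeasure_diskMeasure hr
  have := isProbabilityMeasure_sampleMeasure hr l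
  rw [ae_all_iff]
  intro s
  rw [ae_all_iff]
  intro j
  have h2 : ∀ᵐ x ∂(sampleMeasure r l), ‖(x j).1‖ ≤ r ∧ ‖(x j).2‖ ≤ r :=
    (measurePreserving_eval (fun _ : Fin l => (diskMeasure r).prod (diskMeasure r))
      j).quasiMeasurePreserving.ae (ae_diskMeasure_prod_mem r)
  exact (measurePreserving_eval (fun _ : Fin m => sampleMeasure r l)
    s).quasiMeasurePreserving.ae h2

lemma measurable_estimator {α : Type*} [MeasurableSpace α] {m l : ℕ} (r T : ℝ)
    {G : (Fin l → ℂ) → ℂ} (hG : ContDiff ℝ (⊤ : ℕ∞) G) {X : α → Fin m → Fin l → ℂ × ℂ}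
    {y : α → Fin m → Fin l → Fin 4 → ℝ} (hX : ∀ s, Measurable fun a => X a s)
    (hy : ∀ s, Measurable fun a => y a s) :
    Measurable fun a => estimator r T G (X a) (y a) := by
  have hs : ∀ s, Measurable fun a => sampleValue T G (X a s) (y a s) := by
    intro s
    have h := (measurable_sampleValue T hG).comp ((hX s).prodMk (hy s))
    exact h
  unfold estimator
  exact ((Finset.measurable_sum _ fun s _ => hs s).const_mul _).const_mul _

section
variable {Ω : Type*} [MeasurableSpace Ω] {n : ℕ} {f : Ω → ℂ[X]}

lemma IsRandomPolynomial.measurable_eval_sample (hf : IsRandomPolynomial n f) {m l : ℕ}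
    (c : Fin l → ℂ) (s : Fin m) (j : Fin l) (q : Fin 4) :
    Measurable fun p : (Fin m → Fin l → ℂ × ℂ) × Ω =>
      (f p.2).eval (c j + node (p.1 s j) q) := by
  have h : Measurable fun p : (Fin m → Fin l → ℂ × ℂ) × Ω => node (p.1 s j) q :=
    (continuous_node q).measurable.comp ((measurable_pi_apply j).comp
      ((measurable_pi_apply s).comp measurable_fst))
  exact hf.measurable_eval.comp (measurable_snd.prodMk (h.const_add (c j)))

lemma IsRandomPolynomial.measurable_sampleStatistic (hf : IsRandomPolynomial n f) {m l : ℕ}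
    (r T : ℝ) {G : (Fin l → ℂ) → ℂ} (hG : ContDiff ℝ (⊤ : ℕ∞) G) (c : Fin l → ℂ) :
    Measurable fun p : (Fin m → Fin l → ℂ × ℂ) × Ω => sampleStatistic r T G c p.1 (f p.2) := by
  unfold sampleStatistic
  refine Measurable.ite ?_ ?_ measurable_const
  · have : {p : (Fin m → Fin l → ℂ × ℂ) × Ω |
        ∀ s j q, (f p.2).eval (c j + node (p.1 s j) q) ≠ 0} =
        ⋂ s, ⋂ j, ⋂ q, {p | (f p.2).eval (c j + node (p.1 s j) q) ≠ 0} := by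
      ext p; simp
    rw [this]
    exact MeasurableSet.iInter fun s => MeasurableSet.iInter fun j => MeasurableSet.iInter fun q =>
      (hf.measurable_eval_sample c s j q) (measurableSet_singleton 0).compl
  · refine measurable_estimator r T hG (fun s => (measurable_pi_apply s).comp measurable_fst)
      fun s => measurable_pi_lambda _ fun j => measurable_pi_lambda _ fun q => ?_
    exact Real.measurable_log.comp (hf.measurable_eval_sample c s j q).norm

/-- The mean distance between the statistic of random samples and the sum over tuples of zeros,
given the distance for good polynomials. -/
lemma IsRandomPolynomial.integral_sampleStatistic_sub_le {P : Measure Ω} [IsProbabilityMeasure P]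
    (hf : IsRandomPolynomial n f) {m l : ℕ} (hm : 1 ≤ m) (hl : 1 ≤ l) {r T : ℝ} (hr : 1 ≤ r)
    (hT : 0 < T) {G : (Fin l → ℂ) → ℂ} (hG : ContDiff ℝ (⊤ : ℕ∞) G)
    (hGs : Function.support G ⊆ Set.pi Set.univ fun _ => Metric.closedBall (0 : ℂ) r) {M₀ M : ℝ}
    (hM₀ : ∀ w, ‖G w‖ ≤ M₀) (hM : ∀ w, ‖multiLap G w‖ ≤ M) (c : Fin l → ℂ) {S : Set Ω}
    (hS : MeasurableSet S) (hS0 : ∀ ω ∈ S, f ω ≠ 0) {ε δ : ℝ} (hε : 0 ≤ ε) (hδ : P.real Sᶜ ≤ δ)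
    (hgood : ∀ ω ∈ S, ∫ X, ‖estimator r T G X
      (fun s j q => logAt (f ω) (c j) (node (X s j) q)) - fullSum G c (f ω)‖
        ∂(Measure.pi fun _ : Fin m => sampleMeasure r l) ≤ ε) :
    Integrable (fun X => ∫ ω, ‖sampleStatistic r T G c X (f ω) - fullSum G c (f ω)‖ ∂P)
      (Measure.pi fun _ : Fin m => sampleMeasure r l) ∧
    ∫ X, ∫ ω, ‖sampleStatistic r T G c X (f ω) - fullSum G c (f ω)‖ ∂P
      ∂(Measure.pi fun _ : Fin m => sampleMeasure r l) ≤
      ε + δ * ((greenConst r ^ l)⁻¹ * ((2 * T) ^ l * M) + (n : ℝ) ^ l * M₀) := by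
  have hr0 : 0 < r := by linarith
  have := isProbabilityMeasure_sampleMeasure hr0 l
  let ν : Measure (Fin m → Fin l → ℂ × ℂ) := Measure.pi fun _ : Fin m => sampleMeasure r l
  have hν : IsProbabilityMeasure ν := by unfold ν; infer_instance
  let b : ℝ := (greenConst r ^ l)⁻¹ * ((2 * T) ^ l * M) + (n : ℝ) ^ l * M₀
  let H : (Fin m → Fin l → ℂ × ℂ) × Ω → ℝ := fun p =>
    ‖sampleStatistic r T G c p.1 (f p.2) - fullSum G c (f p.2)‖
  have hHm : Measurable H := ((hf.measurable_sampleStatistic r T hG c).sub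
    ((hf.measurable_fullSum hl hr hG hGs c).comp measurable_snd)).norm
  have hHb : ∀ p, H p ≤ b := fun p => (norm_sub_le _ _).trans
    (add_le_add (norm_sampleStatistic_le hm hr0 hT hM c _ _)
      (norm_fullSum_le (hf.natDegree_le _) hM₀ c))
  have hH0 : ∀ p, 0 ≤ H p := fun p => norm_nonneg _
  have hHn : ∀ p, ‖H p‖ ≤ b := fun p => by rw [Real.norm_of_nonneg (hH0 p)]; exact hHb p
  have hb : 0 ≤ b := (hH0 (fun _ _ => 0, (nonempty_of_isProbabilityMeasure P).some)).trans (hHb _)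
  have hHi : Integrable H (ν.prod P) :=
    Integrable.of_bound hHm.aestronglyMeasurable b (.of_forall hHn)
  refine ⟨hHi.integral_prod_left, ?_⟩
  change ∫ X, ∫ ω, H (X, ω) ∂P ∂ν ≤ ε + δ * b
  -- exchange the two expectations, then treat each polynomial separately
  rw [integral_integral_swap hHi]
  have hpt : ∀ ω, ∫ X, H (X, ω) ∂ν ≤ ε + Sᶜ.indicator (fun _ => b) ω := by
    intro ω
    by_cases hω : ω ∈ S
    · rw [Set.indicator_of_notMem (Set.notMem_compl_iff.2 hω), add_zero]
      refine le_trans (le_of_eq (integral_congr_ae ?_)) (hgood ω hω)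
      filter_upwards [ae_eval_sample_ne_zero hr0 (hS0 ω hω) c] with X hX
      simp only [H, sampleStatistic, if_pos hX]
    · rw [Set.indicator_of_mem hω]
      have : ∫ X, H (X, ω) ∂ν ≤ ∫ _X, b ∂ν :=
        integral_mono_of_nonneg (.of_forall fun X => hH0 _) (integrable_const _)
          (.of_forall fun X => hHb _)
      simp at this
      linarith
  have hSi : Integrable (Sᶜ.indicator fun _ : Ω => b) P :=
    (integrable_const b).indicator hS.compl
  calc _ ≤ ∫ ω, (ε + Sᶜ.indicator (fun _ => b) ω) ∂P :=
        integral_mono_of_nonneg (.of_forall fun ω => integral_nonneg fun X => hH0 _)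
          ((integrable_const _).add hSi) (.of_forall hpt)
    _ = ε + P.real Sᶜ * b := by
        rw [integral_add (integrable_const _) hSi, integral_indicator_const _ hS.compl]
        simp
    _ ≤ _ := by gcongr

lemma IsRandomPolynomial.norm_integral_sampleStatistic_sub_le {P : Measure Ω}
    [IsProbabilityMeasure P] (hf : IsRandomPolynomial n f) {m l : ℕ} (hm : 1 ≤ m) (hl : 1 ≤ l)
    {r T : ℝ} (hr : 1 ≤ r) (hT : 0 < T) {G : (Fin l → ℂ) → ℂ} (hG : ContDiff ℝ (⊤ : ℕ∞) G)
    (hGs : Function.support G ⊆ Set.pi Set.univ fun _ => Metric.closedBall (0 : ℂ) r) {M₀ M : ℝ}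
    (hM₀ : ∀ w, ‖G w‖ ≤ M₀) (hM : ∀ w, ‖multiLap G w‖ ≤ M) (c : Fin l → ℂ)
    (X : Fin m → Fin l → ℂ × ℂ) :
    ‖(∫ ω, sampleStatistic r T G c X (f ω) ∂P) - ∫ ω, fullSum G c (f ω) ∂P‖ ≤
      ∫ ω, ‖sampleStatistic r T G c X (f ω) - fullSum G c (f ω)‖ ∂P := by
  rw [← integral_sub]
  · exact norm_integral_le_integral_norm _
  · exact Integrable.of_bound ((hf.measurable_sampleStatistic r T hG c).comp
      (measurable_const.prodMk measurable_id)).aestronglyMeasurable _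
      (.of_forall fun ω => norm_sampleStatistic_le hm (by linarith) hT hM c X _)
  · exact Integrable.of_bound (hf.measurable_fullSum hl hr hG hGs c).aestronglyMeasurable _
      (.of_forall fun ω => norm_fullSum_le (hf.natDegree_le ω) hM₀ c)

end

lemma gradNorm_const_mul {k : ℕ} (a : ℕ) {F : (Fin k → ℂ) → ℂ} (hF : ContDiff ℝ (⊤ : ℕ∞) F)
    (b : ℂ) (w : Fin k → ℂ) : gradNorm a (fun w => b * F w) w = ‖b‖ * gradNorm a F w := by
  have h2 : (fun w => b * F w) = b • F := rfl
  rw [gradNorm, gradNorm, h2, iteratedFDeriv_const_smul_apply (contDiff_nat_of_top hF a).contDiffAt]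
  simp only [_root_.smul_apply, norm_smul, mul_pow]
  rw [← Finset.mul_sum, Real.sqrt_mul (sq_nonneg _), Real.sqrt_sq (norm_nonneg _)]

lemma logStatistic_const_mul {N : ℕ} (F : (Fin N → ℂ) → ℂ) (z : Fin N → ℂ) (b : ℂ) (p : ℂ[X]) :
    logStatistic (fun w => b * F w) z p = b * logStatistic F z p := by
  unfold logStatistic
  split_ifs <;> simp

/-- The comparison hypothesis for functions with derivatives bounded by an arbitrary constant. -/
lemma LogComparable.norm_sub_le {Ω Ω' : Type*} [MeasurableSpace Ω] [MeasurableSpace Ω']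
    {P : Measure Ω} {P' : Measure Ω'} {f : Ω → ℂ[X]} {g : Ω' → ℂ[X]} {C r₀ c₀ : ℝ} {a₀ n k : ℕ}
    {z : Fin k → ℂ} (h : LogComparable P P' f g C r₀ c₀ a₀ n z) (hn : 1 ≤ n) (hc₀ : 0 ≤ c₀) {N : ℕ}
    (hN : 1 ≤ N) (hNn : (N : ℝ) ≤ (n : ℝ) ^ c₀) {z' : Fin N → ℂ}
    (hz' : ∀ i, z' i ∈ ⋃ j, Metric.ball (z j) (20 * r₀)) {F : (Fin N → ℂ) → ℂ}
    (hF : ContDiff ℝ (⊤ : ℕ∞) F) {K : ℝ} (hK : 0 < K)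
    (hFK : ∀ a ≤ a₀, ∀ w, gradNorm a F w ≤ K) :
    ‖(∫ ω, logStatistic F z' (f ω) ∂P) - ∫ ω, logStatistic F z' (g ω) ∂P'‖ ≤
      K * (C * (n : ℝ) ^ (-c₀)) := by
  have hKc : ‖((K : ℂ))⁻¹‖ = K⁻¹ := by
    rw [norm_inv, Complex.norm_real, Real.norm_of_nonneg hK.le]
  have := h N hN hNn z' hz' (fun w => (K : ℂ)⁻¹ * F w) (contDiff_const.mul hF) fun a ha w => by
    rw [gradNorm_const_mul a hF, hKc]
    calc K⁻¹ * gradNorm a F w ≤ K⁻¹ * K := by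
          gcongr
          exact hFK a ha w
      _ = 1 := inv_mul_cancel₀ hK.ne'
      _ ≤ _ := Real.one_le_rpow (by exact_mod_cast hn) hc₀
  simp only [logStatistic_const_mul] at this
  rw [integral_const_mul, integral_const_mul, ← mul_sub, norm_mul, hKc] at this
  rwa [inv_mul_le_iff₀ hK] at this

/-! ### Comparison of sums over tuples of zeros -/

/-- Comparison of the expected sums over tuples of zeros, with the number `m` of samples, the
typical size `D` of the residuals and the relative truncation height `T₁` as parameters. -/
lemma exists_norm_integral_fullSum_sub_le_of_parameters {r : ℝ} (hr : 1 ≤ r) {l : ℕ} (hl : 1 ≤ l)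
    (a₀ p : ℕ) :
    ∃ K : ℝ, 1 ≤ K ∧ ∀ (n : ℕ), 1 ≤ n →
      ∀ {Ω : Type*} [MeasurableSpace Ω] {P : Measure Ω} [IsProbabilityMeasure P]
        {Ω' : Type*} [MeasurableSpace Ω'] {P' : Measure Ω'} [IsProbabilityMeasure P']
        {f : Ω → ℂ[X]} {g : Ω' → ℂ[X]} {k : ℕ} {z : Fin k → ℂ} {C A c₀ : ℝ},
        IsRandomPolynomial n f → IsRandomPolynomial n g →
        NonDegenerate P f C A n → NonDegenerate P' g C A n →
        NonClustering P f C A n z → NonClustering P' g C A n z →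
        LogComparable P P' f g C r c₀ a₀ n z → 0 < C → 0 ≤ c₀ →
        ∀ {c : Fin l → ℂ}, (∀ j, ∃ i, c j = z i) →
        ∀ {G : (Fin l → ℂ) → ℂ} {M : ℝ}, ContDiff ℝ (⊤ : ℕ∞) G →
          Function.support G ⊆ (Set.pi Set.univ fun _ => Metric.closedBall (0 : ℂ) r) →
          (∀ w, ‖G w‖ ≤ M) → (∀ w, ‖multiLap G w‖ ≤ M) → 0 < M →
        ∀ {m L : ℕ} {D T₁ : ℝ}, 1 ≤ m → ((m * (l * 4) : ℕ) : ℝ) ≤ (n : ℝ) ^ c₀ → n ≤ 2 ^ L →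
          1 ≤ D → 1 ≤ T₁ → 5 * r * (C * (n : ℝ) ^ (1 / A) * (8 * r) ^ 2) ≤ D →
          16 * r ^ 2 * (4 * (C * (n : ℝ) ^ (1 / A)) * L + 1) ≤ D →
        ‖(∫ ω, fullSum G c (f ω) ∂P) - ∫ ω, fullSum G c (g ω) ∂P'‖ ≤
          2 * ((greenConst r ^ l)⁻¹ * (2 * ((2 * (D * T₁)) ^ l * M) / Real.sqrt m +
              2 * D ^ l * (T₁ ^ p)⁻¹ * K ^ l * M) +
            (1 + l * (L + 1)) * (C * (n : ℝ) ^ (-A)) *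
              ((greenConst r ^ l)⁻¹ * ((2 * (D * T₁)) ^ l * M) + (n : ℝ) ^ l * M)) +
          K * ((D * T₁) ^ l * M) * (C * (n : ℝ) ^ (-c₀)) := by
  obtain ⟨K₁, hK₁, hest⟩ := exists_integral_norm_estimator_logAt_le hr p
  obtain ⟨K₂, hK₂, hgrad⟩ := exists_gradNorm_estimatorFun_le l a₀ hr
  refine ⟨max K₁ K₂, hK₁.trans (le_max_left _ _), ?_⟩
  intro n hn Ω _ P _ Ω' _ P' _ f g k z C A c₀ hf hg hndf hndg hncf hncg hcomp hC hc₀ c hc G M hG hGs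
    hGM hHM hM m L D T₁ hm hmn hnL hD hT₁ hD1 hD2
  have hr0 : 0 < r := by linarith
  have hT : 1 ≤ D * T₁ := one_le_mul_of_one_le_of_one_le hD hT₁
  have hκ := greenConst_pos hr0
  have hn0 : (0 : ℝ) < n := by exact_mod_cast hn
  have := isProbabilityMeasure_sampleMeasure hr0 l
  set ε : ℝ := (greenConst r ^ l)⁻¹ * (2 * ((2 * (D * T₁)) ^ l * M) / Real.sqrt m +
    2 * D ^ l * (T₁ ^ p)⁻¹ * K₁ ^ l * M) with hε
  set δ : ℝ := (1 + l * (L + 1)) * (C * (n : ℝ) ^ (-A)) with hδ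
  set b : ℝ := (greenConst r ^ l)⁻¹ * ((2 * (D * T₁)) ^ l * M) + (n : ℝ) ^ l * M with hb
  have hB : 0 < C * (n : ℝ) ^ (1 / A) := by positivity
  have hε0 : 0 ≤ ε := by positivity
  have h8 : 1 ≤ 8 * r := by linarith
  obtain ⟨hSf, hPf⟩ := measureReal_not_isGood_le hf hc h8 L hndf hncf
  obtain ⟨hSg, hPg⟩ := measureReal_not_isGood_le hg hc h8 L hndg hncg
  obtain ⟨hif, hbf⟩ := hf.integral_sampleStatistic_sub_le hm hl hr (by linarith : 0 < D * T₁) hG hGs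
    hGM hHM c hSf (fun ω h => h.1) hε0 hPf fun ω h =>
      hest l m n L c _ D T₁ M (f ω) G hm hB (by linarith) hnL (hf.natDegree_le ω) h hD1 hD2 hG hGs hHM
  obtain ⟨hig, hbg⟩ := hg.integral_sampleStatistic_sub_le hm hl hr (by linarith : 0 < D * T₁) hG hGs
    hGM hHM c hSg (fun ω h => h.1) hε0 hPg fun ω h =>
      hest l m n L c _ D T₁ M (g ω) G hm hB (by linarith) hnL (hg.natDegree_le ω) h hD1 hD2 hG hGs hHM
  -- the errors for `f` and `g` are added before choosing the samples, so one choice serves both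
  obtain ⟨X, hX, hXle⟩ := exists_notMem_null_le_integral (hif.add hig)
    (ae_iff.1 (ae_sample_mem (m := m) (l := l) hr0))
  rw [Set.mem_ofPred_eq, not_not] at hX
  simp only [Pi.add_apply] at hXle
  rw [integral_add hif hig] at hXle
  let e : Fin m × Fin l × Fin 4 ≃ Fin (m * (l * 4)) := Fintype.equivFinOfCardEq (by simp)
  have hN : 1 ≤ m * (l * 4) := Nat.mul_pos hm (by omega)
  have hpts : ∀ i, samplePoints e c X i ∈ ⋃ j, Metric.ball (z j) (20 * r) := by
    intro i
    obtain ⟨i', hi'⟩ := hc (e.symm i).2.1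
    refine Set.mem_iUnion.2 ⟨i', ?_⟩
    rw [samplePoints, hi', Metric.mem_ball, dist_eq_norm, add_sub_cancel_left]
    have := norm_node_le hr (hX (e.symm i).1 (e.symm i).2.1).1 (hX (e.symm i).1 (e.symm i).2.1).2
      (e.symm i).2.2
    linarith
  have hcmp := hcomp.norm_sub_le hn hc₀ hN hmn hpts (contDiff_estimatorFun e r (D * T₁) G X)
    (K := K₂ * ((D * T₁) ^ l * M)) (by positivity)
    (hgrad _ m e (D * T₁) M G X hm hT hHM hX)
  simp only [logStatistic_estimatorFun] at hcmp
  have h1 := hf.norm_integral_sampleStatistic_sub_le (P := P) hm hl hr (by linarith : 0 < D * T₁)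
    hG hGs hGM hHM c X
  have h2 := hg.norm_integral_sampleStatistic_sub_le (P := P') hm hl hr (by linarith : 0 < D * T₁)
    hG hGs hGM hHM c X
  have hK₁' : K₁ ≤ max K₁ K₂ := le_max_left _ _
  have hK₂' : K₂ ≤ max K₁ K₂ := le_max_right _ _
  have hεK : ε ≤ (greenConst r ^ l)⁻¹ * (2 * ((2 * (D * T₁)) ^ l * M) / Real.sqrt m +
      2 * D ^ l * (T₁ ^ p)⁻¹ * max K₁ K₂ ^ l * M) := by
    rw [hε]
    gcongr
  have h3 : K₂ * ((D * T₁) ^ l * M) * (C * (n : ℝ) ^ (-c₀)) ≤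
      max K₁ K₂ * ((D * T₁) ^ l * M) * (C * (n : ℝ) ^ (-c₀)) := by gcongr
  rw [norm_sub_rev] at h1
  have h4 := norm_sub_le_norm_sub_add_norm_sub (∫ ω, fullSum G c (f ω) ∂P)
    (∫ ω, sampleStatistic r (D * T₁) G c X (f ω) ∂P) (∫ ω, fullSum G c (g ω) ∂P')
  have h5 := norm_sub_le_norm_sub_add_norm_sub (∫ ω, sampleStatistic r (D * T₁) G c X (f ω) ∂P)
    (∫ ω, sampleStatistic r (D * T₁) G c X (g ω) ∂P') (∫ ω, fullSum G c (g ω) ∂P')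
  linarith

/-- With `y = n ^ (c₀ / 100)`, every error term is at most a constant multiple of `M y⁻²⁵`. Here
`t ^ k = y`, the residuals have size `D = C₁ t²` and are truncated at height `D t`, `s` stands for
the square root of the number of samples, and `nl`, `nA`, `nc` for `n ^ l`, `n ^ (-A)` and
`n ^ (-c₀)`. -/
lemma error_terms_le {k l : ℕ} (hlk : l ≤ k) {κ K C C₁ C₂ t y M s nl nA nc L : ℝ} (hκ : 0 ≤ κ)
    (hK : 1 ≤ K) (hC : 1 ≤ C) (hC₁ : 1 ≤ C₁) (hC₂ : 1 ≤ C₂) (ht : 1 ≤ t) (hy : y = t ^ k)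
    (hM : 0 < M) (hs : y ^ 50 ≤ C₂ * s) (hL : L ≤ C₂ * y) (hnA0 : 0 ≤ nA) (hnA : nA ≤ (y ^ 100)⁻¹)
    (hnl : nl * nA ≤ (y ^ 100)⁻¹) (hnc : nc = (y ^ 100)⁻¹) (hnl0 : 0 ≤ nl) :
    2 * (κ * (2 * ((2 * (C₁ * t ^ 2 * t)) ^ l * M) / s +
        2 * (C₁ * t ^ 2) ^ l * (t ^ (100 * k))⁻¹ * K ^ l * M) +
      (1 + l * (L + 1)) * (C * nA) * (κ * ((2 * (C₁ * t ^ 2 * t)) ^ l * M) + nl * M)) +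
      K * ((C₁ * t ^ 2 * t) ^ l * M) * (C * nc) ≤
    (2 * (κ * (2 * (2 ^ l * C₁ ^ l) * C₂ + 2 * C₁ ^ l * K ^ l) +
      (1 + l * (C₂ + 1)) * C * (κ * (2 ^ l * C₁ ^ l) + 1)) + K * C₁ ^ l * C) * M * (y ^ 25)⁻¹ := by
  have ht0 : 0 < t := by linarith
  have hy1 : 1 ≤ y := hy ▸ one_le_pow₀ ht
  have hy0 : 0 < y := by linarith
  have hs0 : 0 < s := by
    have : 0 < C₂ * s := lt_of_lt_of_le (by positivity) hs
    exact pos_of_mul_pos_right this (by linarith)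
  have hll : t ^ l ≤ y := hy ▸ pow_le_pow_right₀ ht hlk
  have htl : 0 < t ^ l := by positivity
  have hD : (C₁ * t ^ 2) ^ l ≤ C₁ ^ l * y ^ 2 := by
    rw [mul_pow, ← pow_mul, mul_comm 2 l, pow_mul]
    gcongr
  have hT : (C₁ * t ^ 2 * t) ^ l ≤ C₁ ^ l * y ^ 3 := by
    rw [show C₁ * t ^ 2 * t = C₁ * t ^ 3 by ring, mul_pow, ← pow_mul, mul_comm 3 l, pow_mul]
    gcongr
  have hT2 : (2 * (C₁ * t ^ 2 * t)) ^ l ≤ 2 ^ l * C₁ ^ l * y ^ 3 := by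
    rw [mul_pow 2, mul_assoc ((2 : ℝ) ^ l)]
    exact mul_le_mul_of_nonneg_left hT (by positivity)
  have htk : t ^ (100 * k) = y ^ 100 := by rw [hy, ← pow_mul, mul_comm]
  have hpow : ∀ a b : ℕ, a + 25 ≤ b → y ^ a * (y ^ b)⁻¹ ≤ (y ^ 25)⁻¹ := by
    intro a b hab
    rw [← div_eq_mul_inv, div_le_iff₀ (by positivity), ← div_eq_inv_mul,
      le_div_iff₀ (by positivity), ← pow_add]
    exact pow_le_pow_right₀ hy1 hab
  have hs' : s⁻¹ ≤ C₂ * (y ^ 50)⁻¹ := by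
    rw [← div_eq_mul_inv, inv_le_comm₀ hs0 (by positivity), inv_div, div_le_iff₀ (by positivity)]
    linarith
  -- the fluctuation of the samples
  have e1 : 2 * ((2 * (C₁ * t ^ 2 * t)) ^ l * M) / s ≤
      2 * (2 ^ l * C₁ ^ l) * C₂ * M * (y ^ 25)⁻¹ := by
    calc _ = 2 * ((2 * (C₁ * t ^ 2 * t)) ^ l * M) * s⁻¹ := div_eq_mul_inv _ _
      _ ≤ 2 * (2 ^ l * C₁ ^ l * y ^ 3 * M) * (C₂ * (y ^ 50)⁻¹) := by gcongr
      _ = 2 * (2 ^ l * C₁ ^ l) * C₂ * M * (y ^ 3 * (y ^ 50)⁻¹) := by ring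
      _ ≤ _ := mul_le_mul_of_nonneg_left (hpow 3 50 (by norm_num)) (by positivity)
  -- the bias caused by truncation
  have e2 : 2 * (C₁ * t ^ 2) ^ l * (t ^ (100 * k))⁻¹ * K ^ l * M ≤
      2 * C₁ ^ l * K ^ l * M * (y ^ 25)⁻¹ := by
    rw [htk]
    calc _ ≤ 2 * (C₁ ^ l * y ^ 2) * (y ^ 100)⁻¹ * K ^ l * M := by gcongr
      _ = 2 * C₁ ^ l * K ^ l * M * (y ^ 2 * (y ^ 100)⁻¹) := by ring
      _ ≤ _ := mul_le_mul_of_nonneg_left (hpow 2 100 (by norm_num)) (by positivity)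
  -- the polynomials that are not good
  have e3 : (1 + l * (L + 1)) * (C * nA) * (κ * ((2 * (C₁ * t ^ 2 * t)) ^ l * M) + nl * M) ≤
      (1 + l * (C₂ + 1)) * C * (κ * (2 ^ l * C₁ ^ l) + 1) * M * (y ^ 25)⁻¹ := by
    have h1 : 1 + l * (L + 1) ≤ (1 + l * (C₂ + 1)) * y := by
      have : (l : ℝ) * (L + 1) ≤ l * (C₂ * y + y) := by gcongr
      nlinarith
    have h2 : nA * (κ * ((2 * (C₁ * t ^ 2 * t)) ^ l * M) + nl * M) ≤
        (κ * (2 ^ l * C₁ ^ l) + 1) * M * (y ^ 3 * (y ^ 100)⁻¹) := by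
      calc _ = κ * ((2 * (C₁ * t ^ 2 * t)) ^ l * M) * nA + nl * nA * M := by ring
        _ ≤ κ * (2 ^ l * C₁ ^ l * y ^ 3 * M) * (y ^ 100)⁻¹ + (y ^ 3 * (y ^ 100)⁻¹) * M := by
            have h3 : nl * nA ≤ y ^ 3 * (y ^ 100)⁻¹ := hnl.trans
              (le_mul_of_one_le_left (by positivity) (one_le_pow₀ hy1))
            gcongr
        _ = _ := by ring
    calc _ = (1 + l * (L + 1)) * C * (nA * (κ * ((2 * (C₁ * t ^ 2 * t)) ^ l * M) + nl * M)) := by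
          ring
      _ ≤ (1 + l * (C₂ + 1)) * y * C *
          ((κ * (2 ^ l * C₁ ^ l) + 1) * M * (y ^ 3 * (y ^ 100)⁻¹)) :=
          mul_le_mul (mul_le_mul_of_nonneg_right h1 (by linarith)) h2 (by positivity)
            (by positivity)
      _ = (1 + l * (C₂ + 1)) * C * (κ * (2 ^ l * C₁ ^ l) + 1) * M * (y ^ 4 * (y ^ 100)⁻¹) := by ring
      _ ≤ _ := mul_le_mul_of_nonneg_left (hpow 4 100 (by norm_num)) (by positivity)
  have e4 : K * ((C₁ * t ^ 2 * t) ^ l * M) * (C * nc) ≤ K * C₁ ^ l * C * M * (y ^ 25)⁻¹ := by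
    rw [hnc]
    calc _ ≤ K * (C₁ ^ l * y ^ 3 * M) * (C * (y ^ 100)⁻¹) := by gcongr
      _ = K * C₁ ^ l * C * M * (y ^ 3 * (y ^ 100)⁻¹) := by ring
      _ ≤ _ := mul_le_mul_of_nonneg_left (hpow 3 100 (by norm_num)) (by positivity)
  have e12 := mul_le_mul_of_nonneg_left (add_le_add e1 e2) hκ
  calc _ ≤ 2 * (κ * (2 * (2 ^ l * C₁ ^ l) * C₂ * M * (y ^ 25)⁻¹ +
        2 * C₁ ^ l * K ^ l * M * (y ^ 25)⁻¹) +
        (1 + l * (C₂ + 1)) * C * (κ * (2 ^ l * C₁ ^ l) + 1) * M * (y ^ 25)⁻¹) +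
        K * C₁ ^ l * C * M * (y ^ 25)⁻¹ := by linarith
    _ = _ := by ring

/-- Logarithmically many dyadic radii cost less than any power of `n`. -/
lemma natLog_two_succ_le {A : ℝ} (hA : 0 < A) {n : ℕ} (hn : 1 ≤ n) :
    ((Nat.log 2 n + 1 : ℕ) : ℝ) ≤ (2 * A + 1) * (n : ℝ) ^ (1 / A) := by
  have hn1 : (1 : ℝ) ≤ n := by exact_mod_cast hn
  have h1 : (Nat.log 2 n : ℝ) ≤ Real.logb 2 n := Real.natLog_le_logb n 2
  have h2 : Real.log n ≤ (n : ℝ) ^ (1 / A) / (1 / A) :=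
    Real.log_le_rpow_div (by positivity) (by positivity)
  have h3 : (1 : ℝ) ≤ (n : ℝ) ^ (1 / A) := Real.one_le_rpow hn1 (by positivity)
  have h4 : Real.logb 2 n ≤ 2 * Real.log n := by
    rw [Real.logb, div_le_iff₀ (Real.log_pos one_lt_two)]
    have := Real.log_two_gt_d9
    have := Real.log_nonneg hn1
    nlinarith
  have h5 : (n : ℝ) ^ (1 / A) / (1 / A) = A * (n : ℝ) ^ (1 / A) := by
    field_simp
  push_cast
  nlinarith

lemma le_mul_sqrt_of_sq_le {a b x : ℝ} (hb : 0 ≤ b) (h : a ^ 2 ≤ b ^ 2 * x) :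
    a ≤ b * Real.sqrt x := by
  rw [← Real.sqrt_sq hb, ← Real.sqrt_mul (sq_nonneg b)]
  exact Real.le_sqrt_of_sq_le h

/-- The replacement principle for sums over all tuples of zeros, distinct or not. -/
lemma exists_norm_integral_fullSum_sub_le {C r₀ c₀ : ℝ} (hC : 1 ≤ C) (hr₀ : 1 ≤ r₀) (hc₀ : 0 < c₀)
    (hc₀' : c₀ ≤ 1) {k a₀ : ℕ} (hk : 1 ≤ k) (ha₀ : 1 ≤ a₀) {A : ℝ} (hA : A = 100 * k * a₀ / c₀)
    {l : ℕ} (hl : 1 ≤ l) (hlk : l ≤ k) :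
    ∃ C' : ℝ, 0 ≤ C' ∧ ∀ (n : ℕ), 1 ≤ n →
      ∀ {Ω : Type*} [MeasurableSpace Ω] {P : Measure Ω} [IsProbabilityMeasure P]
        {Ω' : Type*} [MeasurableSpace Ω'] {P' : Measure Ω'} [IsProbabilityMeasure P']
        {f : Ω → ℂ[X]} {g : Ω' → ℂ[X]} {z : Fin k → ℂ},
        IsRandomPolynomial n f → IsRandomPolynomial n g →
        NonDegenerate P f C A n → NonDegenerate P' g C A n →
        NonClustering P f C A n z → NonClustering P' g C A n z →
        LogComparable P P' f g C r₀ c₀ a₀ n z →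
        ∀ {c : Fin l → ℂ}, (∀ j, ∃ i, c j = z i) →
        ∀ {G : (Fin l → ℂ) → ℂ} {M : ℝ}, ContDiff ℝ (⊤ : ℕ∞) G →
          Function.support G ⊆ (Set.pi Set.univ fun _ => Metric.closedBall (0 : ℂ) r₀) →
          (∀ w, ‖G w‖ ≤ M) → (∀ w, ‖multiLap G w‖ ≤ M) → 0 < M →
        ‖(∫ ω, fullSum G c (f ω) ∂P) - ∫ ω, fullSum G c (g ω) ∂P'‖ ≤
          C' * M * (n : ℝ) ^ (-(c₀ / 4)) := by
  obtain ⟨K, hK, hmain⟩ := exists_norm_integral_fullSum_sub_le_of_parameters hr₀ hl a₀ (100 * k)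
  have hk1 : (1 : ℝ) ≤ k := by exact_mod_cast hk
  have ha1 : (1 : ℝ) ≤ a₀ := by exact_mod_cast ha₀
  have hl1 : (1 : ℝ) ≤ l := by exact_mod_cast hl
  have hlk1 : (l : ℝ) ≤ k := by exact_mod_cast hlk
  have hA100 : 100 * (k : ℝ) ≤ A := by
    rw [hA, le_div_iff₀ hc₀, mul_assoc, mul_assoc]
    refine mul_le_mul_of_nonneg_left ?_ (by norm_num)
    exact mul_le_mul_of_nonneg_left (hc₀'.trans ha1) (by positivity)
  have hA0 : 0 < A := by linarith
  have hAinv : 1 / A ≤ c₀ / (100 * k) := by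
    rw [hA, one_div_div]
    refine div_le_div_of_nonneg_left hc₀.le (by positivity) ?_
    exact le_mul_of_one_le_right (by positivity) ha1
  have hκ := greenConst_pos (by linarith : 0 < r₀)
  let C₁ : ℝ := 320 * r₀ ^ 3 * C + 16 * r₀ ^ 2 * (4 * C * (2 * A + 1) + 1)
  let C₂ : ℝ := 8 * l + (2 * A + 1)
  let κ : ℝ := (greenConst r₀ ^ l)⁻¹
  let E₁ : ℝ := 2 * (κ * (2 * (2 ^ l * C₁ ^ l) * C₂ + 2 * C₁ ^ l * K ^ l) +
      (1 + l * (C₂ + 1)) * C * (κ * (2 ^ l * C₁ ^ l) + 1)) + K * C₁ ^ l * C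
  let E₂ : ℝ := 2 * (4 * l) ^ (l / c₀) * (4 * l)
  have hC₁ : 1 ≤ C₁ := by
    have h1 : 1 ≤ 16 * r₀ ^ 2 * (4 * C * (2 * A + 1) + 1) :=
      one_le_mul_of_one_le_of_one_le (by nlinarith) (by nlinarith)
    have h2 : 0 ≤ 320 * r₀ ^ 3 * C := by positivity
    simp only [C₁]; linarith
  have hC₂ : 1 ≤ C₂ := by simp only [C₂]; linarith
  have hκ0 : 0 ≤ κ := by positivity
  have hE₁ : 0 ≤ E₁ := by positivity
  have hE₂ : 0 ≤ E₂ := by positivity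
  refine ⟨E₁ + E₂, by positivity, ?_⟩
  intro n hn Ω _ P _ Ω' _ P' _ f g z hf hg hndf hndg hncf hncg hcomp c hc G M hG hGs hGM hHM hM
  have hn1 : (1 : ℝ) ≤ n := by exact_mod_cast hn
  have hn0 : (0 : ℝ) < n := by linarith
  have hq0 : 0 < (n : ℝ) ^ (-(c₀ / 4)) := by positivity
  rcases lt_or_ge ((n : ℝ) ^ c₀) (4 * l) with hsmall | hlarge
  · -- for bounded `n` the number of zeros is bounded
    have h1 : ‖∫ ω, fullSum G c (f ω) ∂P‖ ≤ (n : ℝ) ^ l * M := by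
      simpa using norm_integral_le_of_norm_le_const (μ := P)
        (.of_forall fun ω => norm_fullSum_le (hf.natDegree_le ω) hGM c)
    have h2 : ‖∫ ω, fullSum G c (g ω) ∂P'‖ ≤ (n : ℝ) ^ l * M := by
      simpa using norm_integral_le_of_norm_le_const (μ := P')
        (.of_forall fun ω => norm_fullSum_le (hg.natDegree_le ω) hGM c)
    have h3 : (n : ℝ) ^ l ≤ (4 * l) ^ (l / c₀) := by
      calc (n : ℝ) ^ l = ((n : ℝ) ^ c₀) ^ (l / c₀) := by
            rw [← Real.rpow_mul hn0.le, mul_div_cancel₀ _ hc₀.ne', Real.rpow_natCast]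
        _ ≤ _ := Real.rpow_le_rpow (by positivity) hsmall.le (by positivity)
    have h4 : 1 ≤ 4 * l * (n : ℝ) ^ (-(c₀ / 4)) := by
      rw [Real.rpow_neg hn0.le, ← div_eq_mul_inv, one_le_div (by positivity)]
      exact (Real.rpow_le_rpow_of_exponent_le hn1 (by linarith)).trans hsmall.le
    calc _ ≤ (n : ℝ) ^ l * M + (n : ℝ) ^ l * M := (norm_sub_le _ _).trans (add_le_add h1 h2)
      _ = 2 * (n : ℝ) ^ l * M * 1 := by ring
      _ ≤ 2 * (4 * l) ^ (l / c₀) * M * (4 * l * (n : ℝ) ^ (-(c₀ / 4))) := by gcongr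
      _ = E₂ * M * (n : ℝ) ^ (-(c₀ / 4)) := by simp only [E₂]; ring
      _ ≤ _ := by
          refine mul_le_mul_of_nonneg_right (mul_le_mul_of_nonneg_right ?_ hM.le) hq0.le
          linarith
  · -- `t` is at least `n ^ (1 / A)`, a multiple of `t` bounds the number of dyadic radii, and
    -- `n ^ c₀ = t ^ (100 k)` leaves room for the powers of `t` lost in the estimates
    obtain ⟨t, ht⟩ : ∃ t, t = (n : ℝ) ^ (c₀ / (100 * k)) := ⟨_, rfl⟩
    obtain ⟨y, hy⟩ : ∃ y, y = t ^ k := ⟨_, rfl⟩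
    have hyn : y = (n : ℝ) ^ (c₀ / 100) := by
      rw [hy, ht, ← Real.rpow_natCast, ← Real.rpow_mul hn0.le]
      congr 1
      field_simp
    have hy100 : y ^ 100 = (n : ℝ) ^ c₀ := by
      rw [hyn, ← Real.rpow_natCast, ← Real.rpow_mul hn0.le]
      congr 1
      push_cast; ring
    have hy25 : (y ^ 25)⁻¹ = (n : ℝ) ^ (-(c₀ / 4)) := by
      rw [hyn, ← Real.rpow_natCast, ← Real.rpow_mul hn0.le, ← Real.rpow_neg hn0.le]
      congr 1
      push_cast; ring
    have hnc : (n : ℝ) ^ (-c₀) = (y ^ 100)⁻¹ := by rw [hy100, Real.rpow_neg hn0.le]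
    have ht1 : 1 ≤ t := ht ▸ Real.one_le_rpow hn1 (by positivity)
    have hty : t ≤ y := hy ▸ le_self_pow₀ ht1 (by omega)
    have hnt : (n : ℝ) ^ (1 / A) ≤ t := ht ▸ Real.rpow_le_rpow_of_exponent_le hn1 hAinv
    have hL := natLog_two_succ_le hA0 hn
    obtain ⟨L, hLdef⟩ : ∃ L, L = Nat.log 2 n + 1 := ⟨_, rfl⟩
    rw [← hLdef] at hL
    have hnL : n ≤ 2 ^ L := hLdef ▸ (Nat.lt_pow_succ_log_self one_lt_two n).le
    have hLt : (L : ℝ) ≤ (2 * A + 1) * t := hL.trans (by gcongr)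
    have hLy : (L : ℝ) ≤ C₂ * y := by
      refine hLt.trans (mul_le_mul ?_ hty (by linarith) (by linarith))
      simp only [C₂]; linarith
    obtain ⟨m, hmdef⟩ : ∃ m, m = ⌊(n : ℝ) ^ c₀ / (4 * l)⌋₊ := ⟨_, rfl⟩
    have hm : 1 ≤ m := by
      rw [hmdef, Nat.one_le_floor_iff, one_le_div (by positivity)]
      exact hlarge
    have hm1 : (1 : ℝ) ≤ m := by exact_mod_cast hm
    have hmle : (m : ℝ) ≤ (n : ℝ) ^ c₀ / (4 * l) := hmdef ▸ Nat.floor_le (by positivity)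
    have hmlt : (n : ℝ) ^ c₀ / (4 * l) < m + 1 := hmdef ▸ Nat.lt_floor_add_one _
    rw [le_div_iff₀ (by positivity)] at hmle
    rw [div_lt_iff₀ (by positivity)] at hmlt
    have hmn : ((m * (l * 4) : ℕ) : ℝ) ≤ (n : ℝ) ^ c₀ := by push_cast; linarith
    have hs : y ^ 50 ≤ C₂ * Real.sqrt m := by
      have hsq : (y ^ 50) ^ 2 = (n : ℝ) ^ c₀ := by
        rw [← hy100]; ring
      have h1 : (n : ℝ) ^ c₀ ≤ 8 * l * m := by nlinarith
      have h3 : (8 * l : ℝ) ≤ C₂ := by simp only [C₂]; linarith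
      have h2 : (8 * l : ℝ) ≤ C₂ ^ 2 := h3.trans (le_self_pow₀ hC₂ two_ne_zero)
      refine le_mul_sqrt_of_sq_le (by linarith) ?_
      rw [hsq]
      exact h1.trans (mul_le_mul_of_nonneg_right h2 (by linarith))
    have ht2 : t ≤ t ^ 2 := le_self_pow₀ ht1 two_ne_zero
    have ht21 : 1 ≤ t ^ 2 := one_le_pow₀ ht1
    have hD : 1 ≤ C₁ * t ^ 2 := one_le_mul_of_one_le_of_one_le hC₁ ht21
    have hCA : 0 ≤ 16 * r₀ ^ 2 * (4 * C * (2 * A + 1) + 1) := by positivity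
    have hD1 : 5 * r₀ * (C * (n : ℝ) ^ (1 / A) * (8 * r₀) ^ 2) ≤ C₁ * t ^ 2 := by
      calc _ = 320 * r₀ ^ 3 * C * (n : ℝ) ^ (1 / A) := by ring
        _ ≤ 320 * r₀ ^ 3 * C * t ^ 2 :=
            mul_le_mul_of_nonneg_left (hnt.trans ht2) (by positivity)
        _ ≤ _ := mul_le_mul_of_nonneg_right (le_add_of_nonneg_right hCA) (by positivity)
    have hD2 : 16 * r₀ ^ 2 * (4 * (C * (n : ℝ) ^ (1 / A)) * L + 1) ≤ C₁ * t ^ 2 := by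
      calc _ ≤ 16 * r₀ ^ 2 * (4 * (C * t) * ((2 * A + 1) * t) + t ^ 2) := by gcongr
        _ = 16 * r₀ ^ 2 * (4 * C * (2 * A + 1) + 1) * t ^ 2 := by ring
        _ ≤ _ := mul_le_mul_of_nonneg_right (le_add_of_nonneg_left (by positivity))
            (by positivity)
    have hnA : (n : ℝ) ^ (-A) ≤ (y ^ 100)⁻¹ := by
      rw [← hnc]
      exact Real.rpow_le_rpow_of_exponent_le hn1 (by linarith)
    have hnl : (n : ℝ) ^ l * (n : ℝ) ^ (-A) ≤ (y ^ 100)⁻¹ := by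
      rw [← hnc, ← Real.rpow_natCast, ← Real.rpow_add hn0]
      exact Real.rpow_le_rpow_of_exponent_le hn1 (by linarith)
    refine (hmain n hn hf hg hndf hndg hncf hncg hcomp (by linarith) hc₀.le hc hG hGs hGM hHM hM hm
      hmn hnL hD ht1 hD1 hD2).trans ?_
    refine (error_terms_le hlk hκ0 hK hC hC₁ hC₂ ht1 hy hM hs hLy (by positivity) hnA hnl hnc
      (by positivity)).trans ?_
    rw [hy25]
    refine mul_le_mul_of_nonneg_right (mul_le_mul_of_nonneg_right ?_ hM.le) hq0.le
    change E₁ ≤ E₁ + E₂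
    linarith

/-! ### From distinct tuples to all tuples -/

/-- The integral against the correlation measure as an alternating sum of expected sums over all
tuples of zeros. -/
lemma IsRandomPolynomial.integral_correlationMeasure_eq {Ω : Type*} [MeasurableSpace Ω]
    {P : Measure Ω} [IsProbabilityMeasure P] {n : ℕ} {f : Ω → ℂ[X]} (hf : IsRandomPolynomial n f)
    {k : ℕ} (hk : 1 ≤ k) {r : ℝ} (hr : 1 ≤ r) {G : (Fin k → ℂ) → ℂ} (hG : ContDiff ℝ (⊤ : ℕ∞) G)
    (hGs : Function.support G ⊆ Set.pi Set.univ fun _ => Metric.ball (0 : ℂ) r) {M : ℝ}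
    (hM : ∀ w, ‖G w‖ ≤ M) (z : Fin k → ℂ) :
    ∫ u, G (u - z) ∂(correlationMeasure P f k) =
      ∑ E ∈ (Finset.univ : Finset (Fin k)).offDiag.powerset, (-1) ^ E.card *
        ∫ ω, fullSum (diagRestrict E z G)
          (fun b => z (Function.surjInv (merge_surjective E) b)) (f ω) ∂P := by
  have hφ : Continuous fun u : Fin k → ℂ => G (u - z) :=
    hG.continuous.comp (continuous_id.sub continuous_const)
  have hφc : HasCompactSupport fun u : Fin k → ℂ => G (u - z) := by
    refine HasCompactSupport.intro
      (isCompact_univ_pi fun j => isCompact_closedBall (z j) r) fun u hu => ?_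
    by_contra h
    refine hu fun j _ => ?_
    have := hGs h j (Set.mem_univ j)
    rw [Metric.mem_ball, dist_zero_right, Pi.sub_apply] at this
    rw [Metric.mem_closedBall, dist_eq_norm]
    exact this.le
  rw [integral_correlationMeasure P hf k _ hφ hφc]
  have h1 : ∀ ω, ∑ i : Fin k ↪ (f ω).roots, G ((fun j => ((i j : (f ω).roots) : ℂ)) - z) =
      ∑ E ∈ (Finset.univ : Finset (Fin k)).offDiag.powerset, (-1) ^ E.card *
        fullSum (diagRestrict E z G)
          (fun b => z (Function.surjInv (merge_surjective E) b)) (f ω) := fun ω =>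
    sum_embedding_roots_eq G z (f ω)
  simp only [h1]
  rw [integral_finsetSum]
  · simp only [integral_const_mul]
  · intro E _
    refine Integrable.const_mul (Integrable.of_bound (C := (n : ℝ) ^ mergeCard E * M) ?_ ?_) _
    · exact (hf.measurable_fullSum (mergeCard_pos hk E) hr (contDiff_diagRestrict E z hG)
        (support_diagRestrict E z hGs) _).aestronglyMeasurable
    · exact .of_forall fun ω => norm_fullSum_le (hf.natDegree_le ω) (fun w => hM _) _

end ReplacementPrinciple

end

theorem theorem2p1
    (C r₀ c₀ : ℝ) (hC : 1 ≤ C) (hr₀ : 1 ≤ r₀) (hc₀ : 0 < c₀) (hc₀' : c₀ ≤ 1)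
    (k a₀ : ℕ) (hk : 1 ≤ k) (ha₀ : 1 ≤ a₀)
    (A : ℝ) (hA : A = 100 * k * a₀ / c₀) :
    ∃ C' : ℝ, ∀ (n : ℕ), 1 ≤ n →
      ∀ (Ω : Type*) [MeasurableSpace Ω] (P : Measure Ω) [IsProbabilityMeasure P]
        (Ω' : Type*) [MeasurableSpace Ω'] (P' : Measure Ω') [IsProbabilityMeasure P']
        (f : Ω → ℂ[X]) (g : Ω' → ℂ[X]) (z : Fin k → ℂ),
        IsRandomPolynomial n f → IsRandomPolynomial n g →
        NonDegenerate P f C A n → NonDegenerate P' g C A n →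
        NonClustering P f C A n z → NonClustering P' g C A n z →
        LogComparable P P' f g C r₀ c₀ a₀ n z →
        ∀ (G : (Fin k → ℂ) → ℂ) (M : ℝ), 0 < M → ContDiff ℝ (⊤ : ℕ∞) G →
          Function.support G ⊆ Set.pi Set.univ (fun _ => Metric.ball (0 : ℂ) r₀) →
          (∀ a ≤ a₀ + 2 * k + 1, ∀ w, gradNorm a G w ≤ M) →
          ‖(∫ u, G (u - z) ∂(correlationMeasure P f k))
              - ∫ u, G (u - z) ∂(correlationMeasure P' g k)‖
            ≤ C' * M * (n : ℝ) ^ (-(c₀ / 4)) := by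
  have hk1 : (1 : ℝ) ≤ k := by exact_mod_cast hk
  choose C' hC' hmain using fun E : Finset (Fin k × Fin k) =>
    exists_norm_integral_fullSum_sub_le hC hr₀ hc₀ hc₀' hk ha₀ hA (mergeCard_pos hk E)
      (mergeCard_le E)
  refine ⟨∑ E ∈ (Finset.univ : Finset (Fin k)).offDiag.powerset,
    C' E * (2 ^ k * (2 * k) ^ (2 * k)), ?_⟩
  intro n hn Ω _ P _ Ω' _ P' _ f g z hf hg hndf hndg hncf hncg hcomp G M hM hG hGs hGM
  have hG0 : ∀ w, ‖G w‖ ≤ M := fun w => by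
    have h := (norm_iteratedFDeriv_le_gradNorm 0 G w).trans
      (mul_le_mul_of_nonneg_left (hGM 0 (Nat.zero_le _) w) (by positivity))
    simpa using h
  rw [hf.integral_correlationMeasure_eq hk hr₀ hG hGs hG0 z,
    hg.integral_correlationMeasure_eq hk hr₀ hG hGs hG0 z, ← Finset.sum_sub_distrib,
    Finset.sum_mul, Finset.sum_mul]
  refine norm_sum_le_of_le _ fun E _ => ?_
  rw [← mul_sub, norm_mul, norm_pow, norm_neg, norm_one, one_pow, one_mul]
  have hlk := mergeCard_le E
  have h2k : (1 : ℝ) ≤ 2 * k := by linarith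
  have hone : (1 : ℝ) ≤ 2 ^ k * (2 * k) ^ (2 * k) :=
    one_le_mul_of_one_le_of_one_le (one_le_pow₀ one_le_two) (one_le_pow₀ h2k)
  -- the Laplacians in `mergeCard E ≤ k` variables take `2 * mergeCard E ≤ 2 * k` derivatives
  have hbound : ∀ w, ‖multiLap (diagRestrict E z G) w‖ ≤ 2 ^ k * (2 * k) ^ (2 * k) * M := by
    intro w
    refine (norm_multiLap_le (contDiff_diagRestrict E z hG)
      (norm_iteratedFDeriv_diagRestrict_le E z hG (hGM (2 * mergeCard E) (by omega))) w).trans ?_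
    rw [mul_assoc]
    have h1 : (2 : ℝ) ^ mergeCard E ≤ 2 ^ k := pow_le_pow_right₀ one_le_two hlk
    have h2 : (2 * k : ℝ) ^ (2 * mergeCard E) ≤ (2 * k) ^ (2 * k) :=
      pow_le_pow_right₀ h2k (by omega)
    gcongr
  refine (hmain E n hn hf hg hndf hndg hncf hncg hcomp (fun b => ⟨_, rfl⟩)
    (contDiff_diagRestrict E z hG) (support_diagRestrict E z hGs)
    (fun w => (hG0 _).trans (le_mul_of_one_le_left hM.le hone)) hbound (by positivity)).trans_eq ?_
  ring
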